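/- **The queue.** In the $GI/G/1/\ell$ queue ($\ell\ge 1$ an integer) customers arrive at the points of a renewal process, are served first-come first-served by a single server with i.i.d. service times that are independent of the arrivals, and an arriving customer is accepted if and only if it finds fewer than $\ell$ customers in the system (waiting or in service). Inter-arrival and service times are almost surely positive. Let $X(t)=(L(t),R_1(t),R_2(t))$, where $L(t)\in\{0,\dots,\ell\}$ is the number of customers in the system, $R_1(t)>0$ the remaining time to the next arrival and $R_2(t)>0$ the remaining service time (while the system is empty, $R_2(t)$ is the service time of the next customer); $X(\cdot)$ is a right-continuous Markov process. When $X(\cdot)$ is stationary, $\mathbb P_1$ denotes the Palm distribution with respect to the point process $N_1$ of all arrivals (accepted or not): with $t_1<t_2<\cdots$ the arrival instants in $(0,\infty)$ and $\alpha_1=\mathbb E[N_1(1)]$, $$\mathbb P_1(X(0-)\in B)=\alpha_1^{-1}\,\mathbb E\Big[\sum_{m\ge1}1(X(t_m-)\in B)\,1(t_m\le 1)\Big].$$ **The sequence.** Let $R\subseteq(0,1]$ have $0$ as an accumulation point; all limits $r\downarrow0$ and all $o(r)$ are taken within $r\in R$. For $r\in R$ consider a $GI/G/1/\ell^{(r)}_0$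 queue with generic inter-arrival time $T^{(r)}_e$ and service time $T^{(r)}_s$; write $m^{(r)}_e,m^{(r)}_s$ for their means, $\lambda^{(r)}=1/m^{(r)}_e$, $\mu^{(r)}=1/m^{(r)}_s$, and $\sigma^{(r)}_e,\sigma^{(r)}_s$ for their standard deviations. Assume that * (4.a) $\{(T^{(r)}_e)^2;r\in R\}$ and $\{(T^{(r)}_s)^2;r\in R\}$ are uniformly integrable; * (4.b) as $r\downarrow0$, $m^{(r)}_e,\lambda^{(r)},\sigma^{(r)}_e,m^{(r)}_s,\mu^{(r)},\sigma^{(r)}_s$ converge to finite limits $m_e,\lambda,\sigma_e,m_s,\mu,\sigma_s$, and $\sigma_e,\sigma_s$ are not both $0$; * (4.c) there is $b\in\mathbb R$ with $\mu^{(r)}-\lambda^{(r)}=r\mu b+o(r)$; * (4.d) $r\ell^{(r)}_0\to\ell_0$ for some $\ell_0>0$. **Theorem.** Assume that, for every $r\in R$, the process $X^{(r)}(\cdot)$ of the $r$-th queue has a stationary distribution; let $X^{(r)}(\cdot)$ be stationary under it, $L^{(r)}$ the queue length under it, and $\mathbb P^{(r)}_1$ the corresponding Palm distribution. Then $rL^{(r)}$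 converges in distribution, as $r\downarrow0$, to a probability law that has a density $g$, and $g$ vanishes outside $[0,\ell_0]$. (i) If $b=0$, then $g(x)=1/\ell_0$ for $x\in[0,\ell_0]$, and both $$\mathbb P(L^{(r)}=0)=\frac{\lambda^2\sigma_e^2+\mu^2\sigma_s^2}{2\ell_0}\,r+o(r),\qquad \mathbb P^{(r)}_1(L^{(r)}(0-)=\ell^{(r)}_0)=\frac{\lambda^2\sigma_e^2+\mu^2\sigma_s^2}{2\ell_0}\,r+o(r).$$ (ii) If $b\ne0$, let $\beta=\dfrac{2b}{\lambda^2\sigma_e^2+\mu^2\sigma_s^2}$. Then $$\mathbb P(L^{(r)}=0)=\frac{b\,e^{\beta\ell_0}}{e^{\beta\ell_0}-1}\,r+o(r),\qquad \mathbb P^{(r)}_1(L^{(r)}(0-)=\ell^{(r)}_0)=\frac{b}{e^{\beta\ell_0}-1}\,r+o(r),$$ $$g(x)=\frac{\beta}{1-e^{-\beta\ell_0}}\,e^{-\beta x},\qquad x\in[0,\ell_0],$$ and on $[0,\ell_0]$ the density $g$ is strictly decreasing if $b>0$ and strictly increasing if $b<0$. -/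

import Mathlib

open MeasureTheory Filter Topology Asymptotics

/-- State `(q, a, v)` of the queue: `q` customers in the system (including the one in service),
remaining time `a` until the next arrival, remaining service time `v`. While the system is empty,
`v` is the (already drawn) service time of the next customer. -/
abbrev QState : Type := ℕ × ℝ × ℝ

/-- Randomness that drives the queue: the initial state, the successive inter-arrival times that
start after time `0`, and the successive service times drawn after time `0`. -/
abbrev QSample : Type := QState × (ℕ → ℝ) × (ℕ → ℝ)

/-- A `GI/G/1/ℓ` queue: a threshold `ℓ ≥ 1` and the laws of the (almost surely positive)
inter-arrival and service times. -/
structure FiniteQueue where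
  threshold : ℕ
  interarrival : ProbabilityMeasure ℝ
  service : ProbabilityMeasure ℝ
  threshold_pos : 0 < threshold
  interarrival_pos : ∀ᵐ x ∂(interarrival : Measure ℝ), 0 < x
  service_pos : ∀ᵐ x ∂(service : Measure ℝ), 0 < x

namespace FiniteQueue

/-- Time until the next arrival or service completion. -/
noncomputable def timeToEvent (x : QState) : ℝ :=
  if x.1 = 0 then x.2.1 else min x.2.1 x.2.2

/-- Deterministic evolution during `u` time units without events: the remaining arrival time
decreases at rate `1`, the remaining service time at rate `1` if the system is not empty and at
rate `0` otherwise. -/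
noncomputable def drift (x : QState) (u : ℝ) : QState :=
  (x.1, x.2.1 - u, if x.1 = 0 then x.2.2 else x.2.2 - u)

/-- State after the event(s) that occur in the state `y` just before an event instant. There is an
arrival if the remaining arrival time is `0`; the arriving customer is accepted if and only if fewer
than `ℓ` customers are found, and a new inter-arrival time starts. There is a service completion if
the system is not empty and the remaining service time is `0`; one customer leaves, and the next
service time is drawn. -/
noncomputable def jump (ℓ : ℕ) (y : QState) (newArrival newService : ℝ) : QState :=
  ((y.1 + if y.2.1 = 0 ∧ y.1 < ℓ then 1 else 0) - (if y.1 ≠ 0 ∧ y.2.2 = 0 then 1 else 0),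
    if y.2.1 = 0 then newArrival else y.2.1,
    if y.1 ≠ 0 ∧ y.2.2 = 0 then newService else y.2.2)

/-- An event instant, the numbers of arrivals and of service completions in `(0, time]`, and the
state right after the event. -/
structure EventRecord where
  time : ℝ
  arrivals : ℕ
  services : ℕ
  state : QState

/-- Passage from one event instant to the next one. -/
noncomputable def nextEvent (ℓ : ℕ) (e s : ℕ → ℝ) (z : EventRecord) : EventRecord where
  time := z.time + timeToEvent z.state
  arrivals := z.arrivals + if (drift z.state (timeToEvent z.state)).2.1 = 0 then 1 else 0
  services := z.services +
    if z.state.1 ≠ 0 ∧ (drift z.state (timeToEvent z.state)).2.2 = 0 then 1 else 0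
  state := jump ℓ (drift z.state (timeToEvent z.state)) (e z.arrivals) (s z.services)

/-- The record after `n` event instants; the time origin counts as the event instant number `0`. -/
noncomputable def eventRecord (ℓ : ℕ) (ω : QSample) : ℕ → EventRecord
  | 0 => ⟨0, 0, 0, ω.1⟩
  | n + 1 => nextEvent ℓ ω.2.1 ω.2.2 (eventRecord ℓ ω n)

/-- Index of the last event instant in `[0, t]`. -/
noncomputable def lastEvent (ℓ : ℕ) (ω : QSample) (t : ℝ) : ℕ :=
  sSup {n : ℕ | (eventRecord ℓ ω n).time ≤ t}

/-- The right-continuous path `t ↦ X(t) = (L(t), R₁(t), R₂(t))` of the queue. -/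
noncomputable def process (ℓ : ℕ) (ω : QSample) (t : ℝ) : QState :=
  drift (eventRecord ℓ ω (lastEvent ℓ ω t)).state (t - (eventRecord ℓ ω (lastEvent ℓ ω t)).time)

/-- The instant of the arrival number `m + 1` after time `0`. -/
noncomputable def arrivalTime (ω : QSample) (m : ℕ) : ℝ :=
  ω.1.2.1 + ∑ i ∈ Finset.range m, ω.2.1 i

/-- Law of the driving randomness when the initial state has law `π`: the initial state, the
inter-arrival times and the service times are independent, the latter two being i.i.d. -/
noncomputable def sampleLaw (M : FiniteQueue) (π : ProbabilityMeasure QState) : Measure QSample :=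
  (π : Measure QState).prod
    ((Measure.infinitePi fun _ : ℕ => (M.interarrival : Measure ℝ)).prod
      (Measure.infinitePi fun _ : ℕ => (M.service : Measure ℝ)))

/-- `π` is a stationary distribution of the Markov process `X(·)` on its state space
`{0, …, ℓ} × (0, ∞) × (0, ∞)`: if `X(0)` has law `π`, then so has `X(t)` for every `t ≥ 0`. -/
structure IsStationary (M : FiniteQueue) (π : ProbabilityMeasure QState) : Prop where
  state_space : ∀ᵐ x ∂(π : Measure QState), x.1 ≤ M.threshold ∧ 0 < x.2.1 ∧ 0 < x.2.2
  map_process : ∀ t : ℝ, 0 ≤ t →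
    Measure.map (fun ω => process M.threshold ω t) (M.sampleLaw π) = (π : Measure QState)

/-- Intensity `α₁ = 𝔼[N₁(1)]` of the arrival point process (accepted or not). -/
noncomputable def arrivalIntensity (M : FiniteQueue) (π : ProbabilityMeasure QState) : ENNReal :=
  ∫⁻ ω, ∑' m : ℕ, Set.indicator {ω : QSample | arrivalTime ω m ≤ 1} 1 ω ∂(M.sampleLaw π)

/-- Palm probability `ℙ₁(X(0-) ∈ B)` with respect to the arrival point process, that is
`α₁⁻¹ 𝔼[∑ₘ 1(X(tₘ-) ∈ B) 1(tₘ ≤ 1)]`, the sum being over the arrival instants `tₘ > 0`. -/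
noncomputable def palmArrivalProb (M : FiniteQueue) (π : ProbabilityMeasure QState)
    (B : Set QState) : ℝ :=
  ((∫⁻ ω, ∑' m : ℕ, Set.indicator {ω : QSample | arrivalTime ω m ≤ 1 ∧
      Function.leftLim (process M.threshold ω) (arrivalTime ω m) ∈ B} 1 ω ∂(M.sampleLaw π)) /
    M.arrivalIntensity π).toReal

end FiniteQueue

/-- Law of `r * L` when the state `(L, R₁, R₂)` has law `π`. -/
noncomputable def scaledQueueLaw (r : ℝ) (π : ProbabilityMeasure QState) : ProbabilityMeasure ℝ :=
  π.map (f := fun x : QState => r * (x.1 : ℝ))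
    ((measurable_of_countable fun n : ℕ => r * (n : ℝ)).comp measurable_fst).aemeasurable

/-- Mean of a law on `ℝ`. -/
noncomputable def lawMean (F : ProbabilityMeasure ℝ) : ℝ := ∫ x, x ∂(F : Measure ℝ)

/-- Standard deviation of a law on `ℝ`. -/
noncomputable def lawStd (F : ProbabilityMeasure ℝ) : ℝ :=
  Real.sqrt (∫ x, (x - lawMean F) ^ 2 ∂(F : Measure ℝ))

/-- Uniform integrability of `T_r ^ 2`, `r ∈ R`, where `T_r` has law `F r`. -/
def SqUniformlyIntegrable (R : Set ℝ) (F : ℝ → ProbabilityMeasure ℝ) : Prop :=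
  ∀ ε : ℝ, 0 < ε → ∃ K : ℝ, ∀ r ∈ R,
    ∫⁻ x in {x : ℝ | K < x ^ 2}, ENNReal.ofReal (x ^ 2) ∂(F r : Measure ℝ) ≤ ENNReal.ofReal ε

/-! The whole argument rests on one balance identity. For a stationary queue and a function `f` of
the state that is differentiable along the drift, the mean change of `f` over a unit of time is
zero. This change is the drift derivative integrated against `π` plus the mean jump of `f`
integrated against `eventMeasure`, the mean measure of the states seen just before the events of
`(0, 1]` (`IsTestPair.integral_deriv_add_integral_jump`). The Palm probability of a loss is a ratio
of masses of the same event measure (`palmArrivalProb_eq`), so the identity speaks of all the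
quantities in the theorem. It is obtained by telescoping over the Markov chain of event instants;
this needs non-explosion, which follows from a discounting argument (`summable_integral_exp_neg`).

In heavy traffic the identity is applied to `exp (θ r l) * exp (-η (a ∧ 1/r)) * exp (-ξ (v ∧ 1/r))`.
The exponents `η`, `ξ` are chosen so that an accepted arrival and a service completion change this
function by a factor with mean `1 + o(r²)` (`tendsto_exp_mul_laplace`). The only jumps that remain
visible are those at lost arrivals. On the drift side `η + ξ` is of order `r²`, and the service
clock stands still in an empty system, which leaves the term `ξ * idleProb`. With `c = (σ_e² + σ_s²)
/ m²`, where `m` is the common limit of the two means, and with the boundary probabilities divided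
by `r`, this gives `(θ² c / 2 - θ b) E[exp (θ r L)] + θ (idle - exp (θ ℓ₀) palmLoss) → 0`
(`tendsto_boundary`). Conservation of customers gives a second equation, `idle - palmLoss → b`
(`tendsto_flow`).

Two points need care. Only second moments exist, so times are truncated at `1/r`; uniform
integrability of the squares makes the truncation cost `o(r)` in the mean and keeps the third
truncated moment `o(1/r)`. Residual times are controlled through second-moment tails
(`IsResidual.integral_min_sub_le`, and `mul_integral_arrival_le` for the residual service time seen
by an arrival). Moreover, it is not known beforehand that the boundary probabilities are `O(r)`.
Errors are therefore first shown to be small relative to `weight`, and the two equations, the first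
at `θ = 1`, then bound `weight` (`exists_weight_le`).

It remains to solve. If `b ≠ 0`, then `θ = β` kills the transform, and two linear equations
determine `idle` and `palmLoss`. If `b = 0`, the sign of `θ (E[exp (θ r L)] - 1)` gives a lower
bound for `palmLoss` when `θ > 0` and an upper bound when `θ < 0`, and the bounds meet as `θ → 0`.
The boundary equation at the other values of `θ` then yields the limit of the transform, which is
that of the truncated exponential law. On a bounded interval, exponential moments along an
arithmetic progression suffice for weak convergence. -/

open scoped ENNReal

/-! ### Drawing successive terms from an i.i.d. sequence. -/

/-- The sequence `a, e 0, e 1, …`. -/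
def seqCons (a : ℝ) (e : ℕ → ℝ) : ℕ → ℝ
  | 0 => a
  | n + 1 => e n

/-- The sequence `e 1, e 2, …`. -/
def seqTail (e : ℕ → ℝ) : ℕ → ℝ := fun n => e (n + 1)

lemma measurable_seqTail : Measurable seqTail :=
  measurable_pi_lambda _ fun n => measurable_pi_apply (n + 1)

lemma measurable_seqCons : Measurable fun p : ℝ × (ℕ → ℝ) => seqCons p.1 p.2 :=
  measurable_pi_lambda _ fun n => by
    cases n with
    | zero => exact measurable_fst
    | succ n => exact (measurable_pi_apply n).comp measurable_snd

lemma map_seqCons (P : Measure ℝ) [IsProbabilityMeasure P] :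
    Measure.map (fun p : ℝ × (ℕ → ℝ) => seqCons p.1 p.2)
      (P.prod (Measure.infinitePi fun _ : ℕ => P)) = Measure.infinitePi fun _ : ℕ => P := by
  refine Measure.eq_infinitePi _ fun s t ht => ?_
  classical
  -- The index set is enlarged to an initial segment, with full sides at the added indices, so that
  -- removing the head leaves an initial segment again.
  obtain ⟨N, hN⟩ : ∃ N, s ⊆ Finset.range (N + 1) :=
    ⟨s.sup id, fun i hi => Finset.mem_range.2 (Nat.lt_succ_of_le (Finset.le_sup (f := id) hi))⟩
  set t' : ℕ → Set ℝ := fun i => if i ∈ s then t i else Set.univ with ht'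
  have hmeas : ∀ i, MeasurableSet (t' i) := fun i => by
    by_cases h : i ∈ s <;> simp [ht', h, ht i]
  have hpi : (s : Set ℕ).pi t = (Finset.range (N + 1) : Set ℕ).pi t' := by
    ext x
    simp only [Set.mem_pi, Finset.mem_coe, ht']
    refine ⟨fun h i _ => ?_, fun h i hi => by simpa [hi] using h i (hN hi)⟩
    by_cases hi : i ∈ s <;> simp [hi, h i]
  have hprod : ∏ i ∈ s, P (t i) = ∏ i ∈ Finset.range (N + 1), P (t' i) := by
    rw [← Finset.prod_subset hN (f := fun i => P (t' i))]
    · exact Finset.prod_congr rfl fun i hi => by simp [ht', hi]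
    · intro i _ hi
      simp [ht', hi]
  have hpre : (fun p : ℝ × (ℕ → ℝ) => seqCons p.1 p.2) ⁻¹' (Finset.range (N + 1) : Set ℕ).pi t'
      = t' 0 ×ˢ (Finset.range N : Set ℕ).pi fun i => t' (i + 1) := by
    ext p
    simp only [Set.mem_preimage, Set.mem_pi, Finset.mem_coe, Finset.mem_range, Set.mem_prod]
    refine ⟨fun h => ⟨h 0 (Nat.succ_pos _), fun i hi => h (i + 1) (by omega)⟩, fun h i hi => ?_⟩
    cases i with
    | zero => exact h.1
    | succ i => exact h.2 i (by omega)
  rw [hpi, hprod, Measure.map_apply measurable_seqCons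
    (MeasurableSet.pi (Finset.countable_toSet _) fun i _ => hmeas i), hpre, Measure.prod_prod,
    Measure.infinitePi_pi _ fun i _ => hmeas (i + 1), Finset.prod_range_succ', mul_comm]

lemma lintegral_infinitePi_succ (P : Measure ℝ) [IsProbabilityMeasure P] {G : (ℕ → ℝ) → ℝ≥0∞}
    (hG : Measurable G) :
    ∫⁻ e, G e ∂(Measure.infinitePi fun _ : ℕ => P)
      = ∫⁻ a, ∫⁻ e, G (seqCons a e) ∂(Measure.infinitePi fun _ : ℕ => P) ∂P := by
  conv_lhs => rw [← map_seqCons P]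
  rw [lintegral_map hG measurable_seqCons, lintegral_prod]
  exact (hG.comp measurable_seqCons).aemeasurable

/-- Drawing the first term of an i.i.d. sequence, and discarding it if it is used, leaves an
i.i.d. sequence that is independent of the draw. -/
lemma lintegral_infinitePi_draw (P : Measure ℝ) [IsProbabilityMeasure P] (used : Prop)
    [Decidable used] {G : ℝ → (ℕ → ℝ) → ℝ≥0∞} (hG : Measurable fun p : ℝ × (ℕ → ℝ) => G p.1 p.2)
    (hused : ¬ used → ∀ a a' e, G a e = G a' e) :
    ∫⁻ e, G (e 0) (if used then seqTail e else e) ∂(Measure.infinitePi fun _ : ℕ => P)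
      = ∫⁻ a, ∫⁻ e, G a e ∂(Measure.infinitePi fun _ : ℕ => P) ∂P := by
  by_cases h : used
  · simp only [h, if_true]
    rw [lintegral_infinitePi_succ P (G := fun e => G (e 0) (seqTail e))
      (hG.comp ((measurable_pi_apply 0).prodMk measurable_seqTail))]
    rfl
  · simp only [h, if_false]
    have : ∀ a, ∫⁻ e, G a e ∂(Measure.infinitePi fun _ : ℕ => P)
        = ∫⁻ e, G (e 0) e ∂(Measure.infinitePi fun _ : ℕ => P) := fun a =>
      lintegral_congr fun e => hused h _ _ _
    simp [this]

/-! ### The Markov chain of event instants and post-event states. -/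

namespace FiniteQueue

/-- State just before the next event instant. -/
noncomputable def preJump (x : QState) : QState := drift x (timeToEvent x)

/-- The next event instant and the state right after it, given the present instant and state and
the newly drawn times. -/
noncomputable def nextPoint (ℓ : ℕ) (z : ℝ × QState) (d : ℝ × ℝ) : ℝ × QState :=
  (z.1 + timeToEvent z.2, jump ℓ (preJump z.2) d.1 d.2)

lemma measurableSet_empty : MeasurableSet {x : QState | x.1 = 0} :=
  measurable_fst (measurableSet_singleton 0)

/-- States just before an arrival. -/
def arrivalSet : Set QState := {y | y.2.1 = 0}

/-- States just before a service completion. -/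
def serviceSet : Set QState := {y | y.1 ≠ 0 ∧ y.2.2 = 0}

lemma measurableSet_arrivalSet : MeasurableSet arrivalSet :=
  (measurable_fst.comp measurable_snd) (measurableSet_singleton (0 : ℝ))

lemma measurableSet_serviceSet : MeasurableSet serviceSet :=
  measurableSet_empty.compl.inter
    ((measurable_snd.comp measurable_snd) (measurableSet_singleton (0 : ℝ)))

@[fun_prop]
lemma measurable_timeToEvent : Measurable timeToEvent :=
  Measurable.ite measurableSet_empty (by fun_prop) (by fun_prop)

@[fun_prop]
lemma measurable_drift : Measurable fun p : QState × ℝ => drift p.1 p.2 := by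
  unfold drift
  refine (by fun_prop : Measurable fun p : QState × ℝ => p.1.1).prodMk
    ((by fun_prop : Measurable fun p : QState × ℝ => p.1.2.1 - p.2).prodMk ?_)
  exact Measurable.ite (measurable_fst measurableSet_empty) (by fun_prop) (by fun_prop)

@[fun_prop]
lemma measurable_preJump : Measurable preJump :=
  measurable_drift.comp (measurable_id.prodMk measurable_timeToEvent)

@[fun_prop]
lemma measurable_jump (ℓ : ℕ) : Measurable fun p : QState × ℝ × ℝ => jump ℓ p.1 p.2.1 p.2.2 := by
  have hA : MeasurableSet {p : QState × ℝ × ℝ | p.1.2.1 = 0} :=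
    measurable_fst measurableSet_arrivalSet
  have hS : MeasurableSet {p : QState × ℝ × ℝ | p.1.1 ≠ 0 ∧ p.1.2.2 = 0} :=
    measurable_fst measurableSet_serviceSet
  have hl : MeasurableSet {p : QState × ℝ × ℝ | p.1.1 < ℓ} :=
    (measurable_fst.comp measurable_fst) (measurableSet_Iio (a := ℓ))
  unfold jump
  refine Measurable.prodMk ?_ (Measurable.prodMk ?_ ?_)
  · exact ((by fun_prop : Measurable fun p : QState × ℝ × ℝ => p.1.1).add
      (Measurable.ite (hA.inter hl) measurable_const measurable_const)).sub
      (Measurable.ite hS measurable_const measurable_const)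
  · exact Measurable.ite hA (by fun_prop) (by fun_prop)
  · exact Measurable.ite hS (by fun_prop) (by fun_prop)

@[fun_prop]
lemma measurable_nextPoint (ℓ : ℕ) :
    Measurable fun p : (ℝ × QState) × (ℝ × ℝ) => nextPoint ℓ p.1 p.2 := by
  refine Measurable.prodMk (by fun_prop) ?_
  exact (measurable_jump ℓ).comp
    ((measurable_preJump.comp (measurable_snd.comp measurable_fst)).prodMk measurable_snd)

/-- Event instant and state right after it, followed by the inter-arrival and service times that
have not been used yet. -/
abbrev ChainState : Type := (ℝ × QState) × (ℕ → ℝ) × (ℕ → ℝ)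

open Classical in
/-- Passage from one event instant to the next one, with removal of the times that are used. -/
noncomputable def chainStep (ℓ : ℕ) (w : ChainState) : ChainState :=
  (nextPoint ℓ w.1 (w.2.1 0, w.2.2 0),
    if preJump w.1.2 ∈ arrivalSet then seqTail w.2.1 else w.2.1,
    if preJump w.1.2 ∈ serviceSet then seqTail w.2.2 else w.2.2)

lemma measurable_chainStep (ℓ : ℕ) : Measurable (chainStep ℓ) := by
  have hpre : Measurable fun w : ChainState => preJump w.1.2 := by fun_prop
  refine Measurable.prodMk ?_ (Measurable.prodMk ?_ ?_)
  · refine (measurable_nextPoint ℓ).comp (measurable_fst.prodMk (Measurable.prodMk ?_ ?_))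
    · exact (measurable_pi_apply 0).comp (by fun_prop)
    · exact (measurable_pi_apply 0).comp (by fun_prop)
  · exact Measurable.ite (hpre measurableSet_arrivalSet)
      (measurable_seqTail.comp (by fun_prop)) (by fun_prop)
  · exact Measurable.ite (hpre measurableSet_serviceSet)
      (measurable_seqTail.comp (by fun_prop)) (by fun_prop)

/-- The chain after `n` events. -/
noncomputable def chain (ℓ : ℕ) (ω : QSample) : ℕ → ChainState
  | 0 => ((0, ω.1), ω.2)
  | n + 1 => chainStep ℓ (chain ℓ ω n)

lemma measurable_chain (ℓ n : ℕ) : Measurable fun ω => chain ℓ ω n := by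
  induction n with
  | zero => exact (measurable_const.prodMk measurable_fst).prodMk measurable_snd
  | succ n ih => exact (measurable_chainStep ℓ).comp ih

/-- Links the two descriptions of the recursion: discarding used times one by one is the same as
reading the original sequences from the positions given by the counters. -/
lemma chain_eq (ℓ : ℕ) (ω : QSample) (n : ℕ) :
    chain ℓ ω n = (((eventRecord ℓ ω n).time, (eventRecord ℓ ω n).state),
      (fun i => ω.2.1 ((eventRecord ℓ ω n).arrivals + i)),
      fun i => ω.2.2 ((eventRecord ℓ ω n).services + i)) := by
  induction n with
  | zero => simp [chain, eventRecord]
  | succ n ih =>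
    rw [chain, ih]
    simp only [chainStep, eventRecord, nextEvent, nextPoint, Prod.mk.injEq]
    refine ⟨⟨trivial, rfl⟩, ?_, ?_⟩
    · by_cases h : preJump (eventRecord ℓ ω n).state ∈ arrivalSet
      · rw [if_pos h, if_pos (show (drift _ _).2.1 = 0 from h)]
        funext i
        simp only [seqTail]
        exact congrArg _ (by omega)
      · rw [if_neg h, if_neg (show ¬ (drift _ _).2.1 = 0 from h)]
        simp
    · by_cases h : preJump (eventRecord ℓ ω n).state ∈ serviceSet
      · have h' : (eventRecord ℓ ω n).state.1 ≠ 0 ∧ (drift (eventRecord ℓ ω n).state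
          (timeToEvent (eventRecord ℓ ω n).state)).2.2 = 0 := h
        rw [if_pos h, if_pos h']
        funext i
        simp only [seqTail]
        exact congrArg _ (by omega)
      · have h' : ¬ ((eventRecord ℓ ω n).state.1 ≠ 0 ∧ (drift (eventRecord ℓ ω n).state
          (timeToEvent (eventRecord ℓ ω n).state)).2.2 = 0) := h
        rw [if_neg h, if_neg h']
        simp

/-- Event instant number `n` and the state right after it. -/
noncomputable def point (ℓ : ℕ) (n : ℕ) (ω : QSample) : ℝ × QState :=
  ((eventRecord ℓ ω n).time, (eventRecord ℓ ω n).state)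

lemma chain_fst (ℓ n : ℕ) (ω : QSample) : (chain ℓ ω n).1 = point ℓ n ω := by
  rw [chain_eq]; rfl

lemma measurable_point (ℓ n : ℕ) : Measurable (point ℓ n) := by
  have : point ℓ n = fun ω => (chain ℓ ω n).1 := funext fun ω => (chain_fst ℓ n ω).symm
  rw [this]
  exact measurable_fst.comp (measurable_chain ℓ n)

/-- Joint law of a new inter-arrival time and a new service time. -/
noncomputable def drawLaw (M : FiniteQueue) : Measure (ℝ × ℝ) :=
  (M.interarrival : Measure ℝ).prod (M.service : Measure ℝ)

instance (M : FiniteQueue) : IsProbabilityMeasure M.drawLaw := by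
  unfold drawLaw; infer_instance

/-- Law of the event instant number `n` and of the state right after it. -/
noncomputable def pointLaw (M : FiniteQueue) (π : ProbabilityMeasure QState) :
    ℕ → Measure (ℝ × QState)
  | 0 => (Measure.dirac 0).prod (π : Measure QState)
  | n + 1 => Measure.map (fun p : (ℝ × QState) × (ℝ × ℝ) => nextPoint M.threshold p.1 p.2)
      ((pointLaw M π n).prod M.drawLaw)

instance (M : FiniteQueue) (π : ProbabilityMeasure QState) (n : ℕ) :
    IsProbabilityMeasure (M.pointLaw π n) := by
  induction n with
  | zero => unfold pointLaw; infer_instance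
  | succ n ih =>
    unfold pointLaw
    exact Measure.isProbabilityMeasure_map (measurable_nextPoint _).aemeasurable

/-- Law of the inter-arrival and service times that have not been used yet. -/
noncomputable def futureLaw (M : FiniteQueue) : Measure ((ℕ → ℝ) × (ℕ → ℝ)) :=
  (Measure.infinitePi fun _ : ℕ => (M.interarrival : Measure ℝ)).prod
    (Measure.infinitePi fun _ : ℕ => (M.service : Measure ℝ))

instance (M : FiniteQueue) : IsProbabilityMeasure M.futureLaw := by
  unfold futureLaw; infer_instance

lemma jump_congr_arrival (ℓ : ℕ) {y : QState} (hy : y ∉ arrivalSet) (a a' v : ℝ) :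
    jump ℓ y a v = jump ℓ y a' v := by
  have : ¬ y.2.1 = 0 := hy
  simp [jump, this]

lemma jump_congr_service (ℓ : ℕ) {y : QState} (hy : y ∉ serviceSet) (a v v' : ℝ) :
    jump ℓ y a v = jump ℓ y a v' := by
  have : ¬ (y.1 ≠ 0 ∧ y.2.2 = 0) := hy
  simp only [jump, if_neg this]

/-- One step of the Markov property. The heads of the unused sequences serve as fresh draws; a head
that is not consumed does not influence the jump, so it may stay in its sequence without creating
dependence. The two sequences are treated one after the other by Tonelli. -/
lemma lintegral_chainStep (M : FiniteQueue) (z : ℝ × QState) {G : ChainState → ℝ≥0∞}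
    (hG : Measurable G) :
    ∫⁻ w, G (chainStep M.threshold (z, w)) ∂M.futureLaw
      = ∫⁻ d, ∫⁻ w, G (nextPoint M.threshold z d, w) ∂M.futureLaw ∂M.drawLaw := by
  classical
  set Pe := Measure.infinitePi fun _ : ℕ => (M.interarrival : Measure ℝ)
  set Ps := Measure.infinitePi fun _ : ℕ => (M.service : Measure ℝ)
  have hnp : ∀ {α : Type} [MeasurableSpace α] {f : α → ℝ × ℝ}, Measurable f →
      Measurable fun x => nextPoint M.threshold z (f x) := fun hf =>
    (measurable_nextPoint M.threshold).comp (measurable_const.prodMk hf)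
  have e1 : ∀ e : ℕ → ℝ, ∀ a : ℝ, ∫⁻ s, G (nextPoint M.threshold z (a, s 0), e,
      if preJump z.2 ∈ serviceSet then seqTail s else s) ∂Ps
      = ∫⁻ v, ∫⁻ s, G (nextPoint M.threshold z (a, v), e, s) ∂Ps ∂(M.service : Measure ℝ) := by
    intro e a
    refine lintegral_infinitePi_draw (M.service : Measure ℝ) _
      (G := fun v s => G (nextPoint M.threshold z (a, v), e, s)) ?_ ?_
    · exact hG.comp ((hnp (by fun_prop)).prodMk (measurable_const.prodMk measurable_snd))
    · intro h v v' s
      simp only [nextPoint]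
      rw [jump_congr_service _ h]
  have m4 : Measurable fun p : ((ℝ × (ℕ → ℝ)) × ℝ) × (ℕ → ℝ) =>
      G (nextPoint M.threshold z (p.1.1.1, p.1.2), p.1.1.2, p.2) :=
    hG.comp ((hnp (by fun_prop)).prodMk (by fun_prop))
  have m2 : Measurable fun p : ℝ × (ℕ → ℝ) => ∫⁻ v, ∫⁻ s,
      G (nextPoint M.threshold z (p.1, v), p.2, s) ∂Ps ∂(M.service : Measure ℝ) :=
    (m4.lintegral_prod_right' (ν := Ps)).lintegral_prod_right'
  have hchain : Measurable fun w : (ℕ → ℝ) × (ℕ → ℝ) => G (chainStep M.threshold (z, w)) :=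
    hG.comp ((measurable_chainStep _).comp (measurable_const.prodMk measurable_id))
  unfold futureLaw drawLaw
  rw [lintegral_prod _ hchain.aemeasurable]
  have : ∀ e : ℕ → ℝ, ∫⁻ s, G (chainStep M.threshold (z, e, s)) ∂Ps
      = ∫⁻ v, ∫⁻ s, G (nextPoint M.threshold z (e 0, v),
        (if preJump z.2 ∈ arrivalSet then seqTail e else e), s) ∂Ps ∂(M.service : Measure ℝ) := by
    intro e
    rw [← e1]
    refine lintegral_congr fun s => ?_
    simp only [chainStep]
  simp only [Ps] at this m2 m4
  rw [lintegral_congr this]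
  rw [lintegral_infinitePi_draw (M.interarrival : Measure ℝ) (preJump z.2 ∈ arrivalSet)
    (G := fun a e => ∫⁻ v, ∫⁻ s, G (nextPoint M.threshold z (a, v), e, s) ∂Ps
      ∂(M.service : Measure ℝ)) m2 ?_]
  · have m3 : Measurable fun p : ((ℝ × ℝ) × (ℕ → ℝ)) × (ℕ → ℝ) =>
        G (nextPoint M.threshold z (p.1.1.1, p.1.1.2), p.1.2, p.2) :=
      hG.comp ((hnp (by fun_prop)).prodMk (by fun_prop))
    have m3' := m3.lintegral_prod_right' (ν := Ps)
    rw [lintegral_prod]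
    · refine lintegral_congr fun a => ?_
      rw [lintegral_lintegral_swap]
      · refine lintegral_congr fun v => ?_
        rw [lintegral_prod]
        exact (hG.comp ((hnp measurable_const).prodMk measurable_id)).aemeasurable
      · exact (m3'.comp (by fun_prop :
          Measurable fun p : (ℕ → ℝ) × ℝ => ((a, p.2), p.1))).aemeasurable
    · have m5 : Measurable fun p : (ℝ × ℝ) × ((ℕ → ℝ) × (ℕ → ℝ)) =>
        G (nextPoint M.threshold z p.1, p.2) :=
        hG.comp ((hnp (by fun_prop)).prodMk (by fun_prop))
      exact m5.lintegral_prod_right'.aemeasurable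
  · intro h a a' e
    simp only [nextPoint]
    simp_rw [jump_congr_arrival _ h a a']

/-- After any number of events the unused times are still i.i.d. and independent of the past. Hence
the points form a Markov chain whose step is `nextPoint` with independent draws, and later arguments
need only the laws `pointLaw`. -/
lemma map_chain (M : FiniteQueue) (π : ProbabilityMeasure QState) (n : ℕ) :
    Measure.map (fun ω => chain M.threshold ω n) (M.sampleLaw π)
      = (M.pointLaw π n).prod M.futureLaw := by
  induction n with
  | zero =>
    refine Measure.ext_of_lintegral _ fun G hG => ?_
    rw [lintegral_map hG (measurable_chain _ _)]
    unfold sampleLaw pointLaw chain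
    change ∫⁻ ω : QState × ((ℕ → ℝ) × (ℕ → ℝ)), G ((0, ω.1), ω.2)
      ∂((π : Measure QState).prod M.futureLaw) = _
    rw [lintegral_prod _ (by fun_prop), lintegral_prod _ hG.aemeasurable, lintegral_prod,
      lintegral_dirac']
    · have : Measurable fun p : (ℝ × QState) × ((ℕ → ℝ) × (ℕ → ℝ)) => G p := hG
      exact this.lintegral_prod_right'.lintegral_prod_right'
    · exact hG.lintegral_prod_right'.aemeasurable
  | succ n ih =>
    have hm := measurable_chainStep M.threshold
    have : (fun ω => chain M.threshold ω (n + 1))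
        = chainStep M.threshold ∘ fun ω => chain M.threshold ω n := rfl
    rw [this, ← Measure.map_map hm (measurable_chain _ _), ih]
    refine Measure.ext_of_lintegral _ fun G hG => ?_
    have hint : Measurable fun z => ∫⁻ w, G (z, w) ∂M.futureLaw := hG.lintegral_prod_right'
    rw [lintegral_map hG hm, lintegral_prod (fun w => G (chainStep M.threshold w)) (hG.comp hm).aemeasurable,
      lintegral_prod _ hG.aemeasurable, pointLaw, lintegral_map hint (measurable_nextPoint _),
      lintegral_prod (fun p : (ℝ × QState) × (ℝ × ℝ) => ∫⁻ w, G (nextPoint M.threshold p.1 p.2, w)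
        ∂M.futureLaw) (hint.comp (measurable_nextPoint _)).aemeasurable]
    exact lintegral_congr fun z => M.lintegral_chainStep z hG

lemma map_point (M : FiniteQueue) (π : ProbabilityMeasure QState) (n : ℕ) :
    Measure.map (point M.threshold n) (M.sampleLaw π) = M.pointLaw π n := by
  have : point M.threshold n = Prod.fst ∘ fun ω => chain M.threshold ω n :=
    funext fun ω => (chain_fst _ n ω).symm
  rw [this, ← Measure.map_map measurable_fst (measurable_chain _ _), map_chain,
    Measure.map_fst_prod]
  simp

end FiniteQueue

/-! ### Non-explosion: the event instants tend to infinity. -/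

namespace FiniteQueue

/-- The state space `{0, …, ℓ} × (0, ∞) × (0, ∞)`. -/
def stateSpace (ℓ : ℕ) : Set QState := {x | x.1 ≤ ℓ ∧ 0 < x.2.1 ∧ 0 < x.2.2}

/-- The closed state space `{0, …, ℓ} × [0, ∞) × [0, ∞)`. -/
def closedStateSpace (ℓ : ℕ) : Set QState := {x | x.1 ≤ ℓ ∧ 0 ≤ x.2.1 ∧ 0 ≤ x.2.2}

lemma stateSpace_subset (ℓ : ℕ) : stateSpace ℓ ⊆ closedStateSpace ℓ :=
  fun _ hx => ⟨hx.1, hx.2.1.le, hx.2.2.le⟩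

lemma measurableSet_stateSpace (ℓ : ℕ) : MeasurableSet (stateSpace ℓ) :=
  (measurable_fst (measurableSet_Iic (a := ℓ))).inter
    (((measurable_fst.comp measurable_snd) (measurableSet_Ioi (a := (0 : ℝ)))).inter
      ((measurable_snd.comp measurable_snd) (measurableSet_Ioi (a := (0 : ℝ)))))

lemma timeToEvent_pos {ℓ : ℕ} {x : QState} (hx : x ∈ stateSpace ℓ) : 0 < timeToEvent x := by
  unfold timeToEvent
  split_ifs
  · exact hx.2.1
  · exact lt_min hx.2.1 hx.2.2

lemma timeToEvent_le (x : QState) : timeToEvent x ≤ x.2.1 := by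
  unfold timeToEvent
  split_ifs
  · exact le_rfl
  · exact min_le_left _ _

lemma drift_mem_closed {ℓ : ℕ} {x : QState} (hx : x ∈ stateSpace ℓ) {u : ℝ}
    (hu' : u ≤ timeToEvent x) : drift x u ∈ closedStateSpace ℓ := by
  refine ⟨hx.1, sub_nonneg.2 (hu'.trans (timeToEvent_le x)), ?_⟩
  simp only [drift]
  split_ifs with h
  · exact hx.2.2.le
  · rw [timeToEvent, if_neg h] at hu'
    exact sub_nonneg.2 (hu'.trans (min_le_right _ _))

lemma preJump_mem_closed {ℓ : ℕ} {x : QState} (hx : x ∈ stateSpace ℓ) :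
    preJump x ∈ closedStateSpace ℓ := drift_mem_closed hx le_rfl

lemma preJump_mem_union (x : QState) : preJump x ∈ arrivalSet ∪ serviceSet := by
  by_cases h : x.1 = 0
  · left; simp [arrivalSet, preJump, drift, timeToEvent, h]
  · rcases min_choice x.2.1 x.2.2 with h' | h'
    · left; simp [arrivalSet, preJump, drift, timeToEvent, h, h']
    · right; simp [serviceSet, preJump, drift, timeToEvent, h, h']

/-- In an empty system a zero service clock would not ring and so would not be renewed; this is why
positivity of that clock is required separately when `y.1 = 0`. -/
lemma jump_mem {ℓ : ℕ} {y : QState} (hy : y ∈ closedStateSpace ℓ)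
    (hy' : y.1 = 0 → 0 < y.2.2) {d : ℝ × ℝ} (hd : 0 < d.1 ∧ 0 < d.2) :
    jump ℓ y d.1 d.2 ∈ stateSpace ℓ := by
  obtain ⟨h1, h2, h3⟩ := hy
  refine ⟨?_, ?_, ?_⟩
  · simp only [jump]
    split_ifs <;> omega
  · simp only [jump]
    split_ifs with h
    · exact hd.1
    · exact lt_of_le_of_ne h2 (Ne.symm h)
  · simp only [jump]
    split_ifs with h
    · exact hd.2
    · by_cases h0 : y.1 = 0
      · exact hy' h0
      · exact lt_of_le_of_ne h3 fun h4 => h ⟨h0, h4.symm⟩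

lemma ae_drawLaw (M : FiniteQueue) : ∀ᵐ d ∂M.drawLaw, 0 < d.1 ∧ 0 < d.2 :=
  (Measure.quasiMeasurePreserving_fst.ae M.interarrival_pos).and
    (Measure.quasiMeasurePreserving_snd.ae M.service_pos)

lemma ae_pointLaw (M : FiniteQueue) {π : ProbabilityMeasure QState}
    (hπ : ∀ᵐ x ∂(π : Measure QState), x ∈ stateSpace M.threshold) (n : ℕ) :
    ∀ᵐ z ∂M.pointLaw π n, 0 ≤ z.1 ∧ z.2 ∈ stateSpace M.threshold := by
  have hset : MeasurableSet {z : ℝ × QState | 0 ≤ z.1 ∧ z.2 ∈ stateSpace M.threshold} :=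
    (measurable_fst (measurableSet_Ici (a := (0 : ℝ)))).inter
      (measurable_snd (measurableSet_stateSpace _))
  induction n with
  | zero =>
    rw [pointLaw]
    have h0 : ∀ᵐ t ∂(Measure.dirac (0 : ℝ)), 0 ≤ t :=
      (ae_dirac_iff (measurableSet_Ici (a := (0 : ℝ)))).2 le_rfl
    exact (Measure.quasiMeasurePreserving_fst.ae h0).and
      (Measure.quasiMeasurePreserving_snd.ae hπ)
  | succ n ih =>
    rw [pointLaw, ae_map_iff (measurable_nextPoint _).aemeasurable hset]
    filter_upwards [Measure.quasiMeasurePreserving_fst.ae ih,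
      Measure.quasiMeasurePreserving_snd.ae M.ae_drawLaw] with p hp hd
    refine ⟨add_nonneg hp.1 (timeToEvent_pos hp.2).le,
      jump_mem (preJump_mem_closed hp.2) (fun h => ?_) hd⟩
    have h' : p.1.2.1 = 0 := h
    simp only [preJump, drift, h', if_true]
    exact hp.2.2.2

lemma integrable_of_ae_bound {α : Type*} [MeasurableSpace α] {μ : Measure α} [IsFiniteMeasure μ]
    {f : α → ℝ} (hf : Measurable f) {C : ℝ} (hC : ∀ᵐ x ∂μ, |f x| ≤ C) : Integrable f μ :=
  Integrable.of_bound hf.aestronglyMeasurable C hC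

/-- The integral of a function of the next point. -/
lemma integral_pointLaw_succ (M : FiniteQueue) (π : ProbabilityMeasure QState) (n : ℕ)
    {F : ℝ × QState → ℝ} (hF : Measurable F) (hint : Integrable F (M.pointLaw π (n + 1))) :
    ∫ z, F z ∂M.pointLaw π (n + 1)
      = ∫ z, ∫ d, F (nextPoint M.threshold z d) ∂M.drawLaw ∂M.pointLaw π n := by
  rw [pointLaw] at hint ⊢
  rw [integral_map (measurable_nextPoint _).aemeasurable hF.aestronglyMeasurable,
    integral_prod (fun p : (ℝ × QState) × (ℝ × ℝ) => F (nextPoint M.threshold p.1 p.2))]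
  exact (integrable_map_measure hF.aestronglyMeasurable
    (measurable_nextPoint _).aemeasurable).1 hint

/-- Almost sure positivity already gives a strict contraction factor for discounted renewals; no
moment is needed. -/
lemma integral_exp_neg_lt_one {P : Measure ℝ} [IsProbabilityMeasure P] (hP : ∀ᵐ x ∂P, 0 < x) :
    ∫ x, Real.exp (-x) ∂P < 1 := by
  have hint : Integrable (fun x => Real.exp (-x)) P :=
    integrable_of_ae_bound (by fun_prop) (C := 1) (by
      filter_upwards [hP] with x hx
      rw [abs_of_pos (Real.exp_pos _)]
      exact Real.exp_le_one_iff.2 (by linarith))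
  have h := integral_pos_iff_support_of_nonneg_ae (f := fun x => 1 - Real.exp (-x)) (μ := P) (by
      filter_upwards [hP] with x hx
      have := Real.exp_le_one_iff.2 (neg_nonpos.2 hx.le)
      simpa using this) ((integrable_const 1).sub hint)
  have hsupp : P (Function.support fun x => 1 - Real.exp (-x)) = 1 := by
    rw [prob_compl_eq_zero_iff₀ _ |>.symm]
    · refine measure_mono_null ?_ (ae_iff.1 hP)
      intro x hx
      simp only [Set.mem_compl_iff, Function.mem_support, not_not] at hx
      intro h'
      have : Real.exp (-x) < 1 := by rw [Real.exp_lt_one_iff]; linarith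
      linarith
    · exact (measurableSet_support (by fun_prop)).nullMeasurableSet
  rw [hsupp] at h
  have := h.2 one_pos
  rw [integral_sub (integrable_const 1) hint] at this
  simpa using this

lemma integral_drawLaw_fst (M : FiniteQueue) (k : ℝ → ℝ) :
    ∫ d, k d.1 ∂M.drawLaw = ∫ x, k x ∂(M.interarrival : Measure ℝ) := by
  simp [drawLaw, integral_fun_fst]

lemma integral_drawLaw_snd (M : FiniteQueue) (k : ℝ → ℝ) :
    ∫ d, k d.2 ∂M.drawLaw = ∫ x, k x ∂(M.service : Measure ℝ) := by
  simp [drawLaw, integral_fun_snd]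

/-- Discounted residual times after an event. -/
noncomputable def discount (z : ℝ × QState) : ℝ :=
  Real.exp (-(z.1 + z.2.2.1)) + Real.exp (-(z.1 + z.2.2.2))

@[fun_prop]
lemma measurable_discount : Measurable discount := by unfold discount; fun_prop

lemma discount_nonneg (z : ℝ × QState) : 0 ≤ discount z := by unfold discount; positivity

lemma discount_le {ℓ : ℕ} {z : ℝ × QState} (hz : 0 ≤ z.1 ∧ z.2 ∈ stateSpace ℓ) :
    discount z ≤ 2 := by
  have h1 : Real.exp (-(z.1 + z.2.2.1)) ≤ 1 := Real.exp_le_one_iff.2 (by linarith [hz.1, hz.2.2.1])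
  have h2 : Real.exp (-(z.1 + z.2.2.2)) ≤ 1 := Real.exp_le_one_iff.2 (by linarith [hz.1, hz.2.2.2])
  unfold discount; linarith

/-- Let `τ` be the next event instant. A clock that rings contributes `exp (-τ)` before the event,
and in the mean at most `q * exp (-τ)` after its renewal. A clock that does not ring keeps its
contribution, or lowers it if it is the frozen service clock. At least one clock rings, so at least
`(1 - q) * exp (-τ)` is lost. -/
lemma integral_discount_nextPoint_le (M : FiniteQueue) {q : ℝ}
    (hqe : ∫ x, Real.exp (-x) ∂(M.interarrival : Measure ℝ) ≤ q)
    (hqs : ∫ x, Real.exp (-x) ∂(M.service : Measure ℝ) ≤ q) (hq : q ≤ 1)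
    {z : ℝ × QState} (hz : 0 ≤ z.1 ∧ z.2 ∈ stateSpace M.threshold) :
    ∫ d, discount (nextPoint M.threshold z d) ∂M.drawLaw
        + (1 - q) * Real.exp (-(z.1 + timeToEvent z.2)) ≤ discount z := by
  classical
  set τ := z.1 + timeToEvent z.2 with hτ
  set y := preJump z.2 with hy
  have hyc := preJump_mem_closed hz.2
  have hA : Real.exp (-(z.1 + z.2.2.1)) = Real.exp (-τ) * Real.exp (-y.2.1) := by
    rw [← Real.exp_add]; congr 1; simp [hτ, hy, preJump, drift]; ring
  have hS : Real.exp (-τ) * Real.exp (-y.2.2) ≤ Real.exp (-(z.1 + z.2.2.2)) := by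
    rw [← Real.exp_add, Real.exp_le_exp]
    simp only [hτ, hy, preJump, drift]
    have := (timeToEvent_pos hz.2).le
    split_ifs <;> linarith
  have e : ∀ d, discount (nextPoint M.threshold z d)
      = Real.exp (-τ) * (if y ∈ arrivalSet then Real.exp (-d.1) else Real.exp (-y.2.1))
      + Real.exp (-τ) * (if y ∈ serviceSet then Real.exp (-d.2) else Real.exp (-y.2.2)) := by
    intro d
    simp only [discount, nextPoint, jump, ← hτ, ← hy, neg_add, Real.exp_add]
    congr 2
    · by_cases h : y ∈ arrivalSet
      · rw [if_pos h, if_pos (show y.2.1 = 0 from h)]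
      · rw [if_neg h, if_neg (show ¬ y.2.1 = 0 from h)]
    · by_cases h : y ∈ serviceSet
      · rw [if_pos h, if_pos (show y.1 ≠ 0 ∧ y.2.2 = 0 from h)]
      · rw [if_neg h, if_neg (show ¬ (y.1 ≠ 0 ∧ y.2.2 = 0) from h)]
  have i1 : Integrable (fun d : ℝ × ℝ =>
      if y ∈ arrivalSet then Real.exp (-d.1) else Real.exp (-y.2.1)) M.drawLaw := by
    refine integrable_of_ae_bound (C := 1) ?_ ?_
    · split_ifs <;> fun_prop
    · filter_upwards [M.ae_drawLaw] with d hd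
      split_ifs
      · rw [abs_of_pos (Real.exp_pos _)]; exact Real.exp_le_one_iff.2 (by linarith [hd.1])
      · rw [abs_of_pos (Real.exp_pos _)]; exact Real.exp_le_one_iff.2 (by linarith [hyc.2.1])
  have i2 : Integrable (fun d : ℝ × ℝ =>
      if y ∈ serviceSet then Real.exp (-d.2) else Real.exp (-y.2.2)) M.drawLaw := by
    refine integrable_of_ae_bound (C := 1) ?_ ?_
    · split_ifs <;> fun_prop
    · filter_upwards [M.ae_drawLaw] with d hd
      split_ifs
      · rw [abs_of_pos (Real.exp_pos _)]; exact Real.exp_le_one_iff.2 (by linarith [hd.2])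
      · rw [abs_of_pos (Real.exp_pos _)]; exact Real.exp_le_one_iff.2 (by linarith [hyc.2.2])
  have j1 : ∫ d : ℝ × ℝ, (if y ∈ arrivalSet then Real.exp (-d.1) else Real.exp (-y.2.1)) ∂M.drawLaw
      + (if y ∈ arrivalSet then 1 - q else 0) ≤ Real.exp (-y.2.1) := by
    split_ifs with h
    · rw [M.integral_drawLaw_fst fun x => Real.exp (-x)]
      have : y.2.1 = 0 := h
      simp only [this, neg_zero, Real.exp_zero]; linarith
    · simp
  have j2 : ∫ d : ℝ × ℝ, (if y ∈ serviceSet then Real.exp (-d.2) else Real.exp (-y.2.2)) ∂M.drawLaw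
      + (if y ∈ serviceSet then 1 - q else 0) ≤ Real.exp (-y.2.2) := by
    split_ifs with h
    · rw [M.integral_drawLaw_snd fun x => Real.exp (-x)]
      have : y.2.2 = 0 := h.2
      simp only [this, neg_zero, Real.exp_zero]; linarith
    · simp
  have j3 : 1 - q ≤ (if y ∈ arrivalSet then 1 - q else 0) + (if y ∈ serviceSet then 1 - q else 0) := by
    have : y ∈ arrivalSet ∪ serviceSet := preJump_mem_union z.2
    rcases this with h | h <;> rw [if_pos h] <;> split_ifs <;> linarith
  simp_rw [e]
  rw [integral_add (i1.const_mul _) (i2.const_mul _), integral_const_mul, integral_const_mul,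
    discount, hA]
  have hp := Real.exp_pos (-τ)
  nlinarith [mul_le_mul_of_nonneg_left j1 hp.le, mul_le_mul_of_nonneg_left j2 hp.le,
    mul_le_mul_of_nonneg_left j3 hp.le]

/-- The bounded nonnegative mean of `discount` drops at each event by a fixed multiple of the mean
discounted event instant, so these means can be summed by telescoping. -/
lemma summable_integral_exp_neg (M : FiniteQueue) {π : ProbabilityMeasure QState}
    (hπ : ∀ᵐ x ∂(π : Measure QState), x ∈ stateSpace M.threshold) :
    Summable fun n => ∫ z, Real.exp (-(z.1 + timeToEvent z.2)) ∂M.pointLaw π n := by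
  set qe := ∫ x, Real.exp (-x) ∂(M.interarrival : Measure ℝ)
  set qs := ∫ x, Real.exp (-x) ∂(M.service : Measure ℝ)
  set q := max qe qs with hq
  have hq1 : q < 1 := max_lt (integral_exp_neg_lt_one M.interarrival_pos)
    (integral_exp_neg_lt_one M.service_pos)
  have hint : ∀ n, Integrable discount (M.pointLaw π n) := fun n =>
    integrable_of_ae_bound measurable_discount (C := 2) (by
      filter_upwards [M.ae_pointLaw hπ n] with z hz
      rw [abs_of_nonneg (discount_nonneg z)]
      exact discount_le hz)
  have hint' : ∀ n, Integrable (fun z : ℝ × QState => Real.exp (-(z.1 + timeToEvent z.2)))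
      (M.pointLaw π n) := fun n =>
    integrable_of_ae_bound (by fun_prop) (C := 1) (by
      filter_upwards [M.ae_pointLaw hπ n] with z hz
      rw [abs_of_pos (Real.exp_pos _)]
      exact Real.exp_le_one_iff.2 (by linarith [timeToEvent_pos hz.2, hz.1]))
  have hstep : ∀ n, ∫ z, discount z ∂M.pointLaw π (n + 1)
      + (1 - q) * ∫ z, Real.exp (-(z.1 + timeToEvent z.2)) ∂M.pointLaw π n
      ≤ ∫ z, discount z ∂M.pointLaw π n := by
    intro n
    rw [M.integral_pointLaw_succ π n measurable_discount (hint _), ← integral_const_mul,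
      ← integral_add]
    · refine integral_mono_ae ?_ (hint n) ?_
      · refine Integrable.add ?_ ((hint' n).const_mul _)
        have := hint (n + 1)
        rw [pointLaw, integrable_map_measure measurable_discount.aestronglyMeasurable
          (measurable_nextPoint _).aemeasurable] at this
        exact this.integral_prod_left
      · filter_upwards [M.ae_pointLaw hπ n] with z hz
        exact M.integral_discount_nextPoint_le (le_max_left _ _) (le_max_right _ _) hq1.le hz
    · have := hint (n + 1)
      rw [pointLaw, integrable_map_measure measurable_discount.aestronglyMeasurable
        (measurable_nextPoint _).aemeasurable] at this
      exact this.integral_prod_left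
    · exact (hint' n).const_mul _
  have hsum : ∀ N, (1 - q) * ∑ n ∈ Finset.range N,
      ∫ z, Real.exp (-(z.1 + timeToEvent z.2)) ∂M.pointLaw π n
      ≤ ∫ z, discount z ∂M.pointLaw π 0 - ∫ z, discount z ∂M.pointLaw π N := by
    intro N
    induction N with
    | zero => simp
    | succ N ih => rw [Finset.sum_range_succ, mul_add]; linarith [hstep N]
  refine summable_of_sum_range_le (c := (∫ z, discount z ∂M.pointLaw π 0) / (1 - q))
    (fun n => integral_nonneg fun z => (Real.exp_pos _).le) fun N => ?_
  rw [le_div_iff₀ (by linarith), mul_comm]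
  have : 0 ≤ ∫ z, discount z ∂M.pointLaw π N := integral_nonneg discount_nonneg
  linarith [hsum N]

/-- Markov's inequality for `exp (-τ)`. It makes the expected number of events in a bounded interval
finite, which the telescoping in the balance identity requires. -/
lemma summable_measureReal_jump (M : FiniteQueue) {π : ProbabilityMeasure QState}
    (hπ : ∀ᵐ x ∂(π : Measure QState), x ∈ stateSpace M.threshold) (t : ℝ) :
    Summable fun n => (M.pointLaw π n).real {z | z.1 + timeToEvent z.2 ≤ t} := by
  refine Summable.of_nonneg_of_le (fun n => measureReal_nonneg) (fun n => ?_)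
    ((M.summable_integral_exp_neg hπ).mul_left (Real.exp t))
  have hm : MeasurableSet {z : ℝ × QState | z.1 + timeToEvent z.2 ≤ t} :=
    measurableSet_le (by fun_prop) measurable_const
  rw [← integral_indicator_one hm, ← integral_const_mul]
  refine integral_mono_ae ((integrable_const 1).indicator hm) ?_ (ae_of_all _ fun z => ?_)
  · refine Integrable.const_mul (integrable_of_ae_bound (by fun_prop) (C := 1) ?_) _
    filter_upwards [M.ae_pointLaw hπ n] with z hz
    rw [abs_of_pos (Real.exp_pos _)]
    exact Real.exp_le_one_iff.2 (by linarith [timeToEvent_pos hz.2, hz.1])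
  · by_cases h : z.1 + timeToEvent z.2 ≤ t
    · simp only [Set.indicator, Set.mem_ofPred_eq, h, if_true, Pi.one_apply]
      rw [← Real.exp_add]
      exact Real.one_le_exp (by linarith)
    · simp only [Set.indicator, Set.mem_ofPred_eq, h, if_false]
      positivity

lemma ae_points (M : FiniteQueue) {π : ProbabilityMeasure QState}
    (hπ : ∀ᵐ x ∂(π : Measure QState), x ∈ stateSpace M.threshold) :
    ∀ᵐ ω ∂M.sampleLaw π, ∀ n, 0 ≤ (eventRecord M.threshold ω n).time ∧
      (eventRecord M.threshold ω n).state ∈ stateSpace M.threshold := by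
  rw [ae_all_iff]
  intro n
  have := M.ae_pointLaw hπ n
  rw [← M.map_point] at this
  exact ae_of_ae_map (measurable_point _ _).aemeasurable this

lemma ae_tendsto_time (M : FiniteQueue) {π : ProbabilityMeasure QState}
    (hπ : ∀ᵐ x ∂(π : Measure QState), x ∈ stateSpace M.threshold) :
    ∀ᵐ ω ∂M.sampleLaw π, Tendsto (fun n => (eventRecord M.threshold ω n).time) atTop atTop := by
  have hm : ∀ n, Measurable fun ω => ENNReal.ofReal (Real.exp (-((point M.threshold n ω).1 +
      timeToEvent (point M.threshold n ω).2))) := fun n =>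
    (by fun_prop : Measurable fun z : ℝ × QState =>
      ENNReal.ofReal (Real.exp (-(z.1 + timeToEvent z.2)))).comp (measurable_point _ n)
  have hlt : ∫⁻ ω, ∑' n, ENNReal.ofReal (Real.exp (-((point M.threshold n ω).1 +
      timeToEvent (point M.threshold n ω).2))) ∂M.sampleLaw π < ∞ := by
    rw [lintegral_tsum fun n => (hm n).aemeasurable]
    have e : ∀ n, ∫⁻ ω, ENNReal.ofReal (Real.exp (-((point M.threshold n ω).1 +
        timeToEvent (point M.threshold n ω).2))) ∂M.sampleLaw π
        = ENNReal.ofReal (∫ z, Real.exp (-(z.1 + timeToEvent z.2)) ∂M.pointLaw π n) := by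
      intro n
      rw [ofReal_integral_eq_lintegral_ofReal, ← M.map_point,
        lintegral_map (by fun_prop) (measurable_point _ n)]
      · refine integrable_of_ae_bound (by fun_prop) (C := 1) ?_
        filter_upwards [M.ae_pointLaw hπ n] with z hz
        rw [abs_of_pos (Real.exp_pos _)]
        exact Real.exp_le_one_iff.2 (by linarith [timeToEvent_pos hz.2, hz.1])
      · exact ae_of_all _ fun z => (Real.exp_pos _).le
    simp_rw [e]
    exact (M.summable_integral_exp_neg hπ).tsum_ofReal_lt_top
  filter_upwards [ae_lt_top' (by
    exact AEMeasurable.tsum fun n => (hm n).aemeasurable) hlt.ne] with ω hω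
  -- The summand with index `n` involves the instant of event `n + 1`, hence the shift.
  rw [← tendsto_add_atTop_iff_nat 1]
  have h0 := ENNReal.tendsto_atTop_zero_of_tsum_ne_top hω.ne
  have h1 : Tendsto (fun n => Real.exp (-((point M.threshold n ω).1 +
      timeToEvent (point M.threshold n ω).2))) atTop (𝓝 0) := by
    have := (ENNReal.tendsto_toReal ENNReal.zero_ne_top).comp h0
    refine this.congr fun n => ?_
    simp [ENNReal.toReal_ofReal (Real.exp_pos _).le]
  have h2 := Real.tendsto_exp_comp_nhds_zero.1 h1
  exact tendsto_neg_atBot_iff.1 h2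

end FiniteQueue

/-! ### Paths between events, and stationarity as a sum over events. -/

namespace FiniteQueue

/-- The events happen at isolated times, and the states after them lie in the state space. -/
structure IsRegular (ℓ : ℕ) (ω : QSample) : Prop where
  state_mem : ∀ n, (eventRecord ℓ ω n).state ∈ stateSpace ℓ
  tendsto_time : Tendsto (fun n => (eventRecord ℓ ω n).time) atTop atTop

lemma ae_isRegular (M : FiniteQueue) {π : ProbabilityMeasure QState}
    (hπ : ∀ᵐ x ∂(π : Measure QState), x ∈ stateSpace M.threshold) :
    ∀ᵐ ω ∂M.sampleLaw π, IsRegular M.threshold ω := by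
  filter_upwards [M.ae_points hπ, M.ae_tendsto_time hπ] with ω h1 h2
  exact ⟨fun n => (h1 n).2, h2⟩

lemma time_succ (ℓ : ℕ) (ω : QSample) (n : ℕ) : (eventRecord ℓ ω (n + 1)).time
    = (eventRecord ℓ ω n).time + timeToEvent (eventRecord ℓ ω n).state := rfl

namespace IsRegular

variable {ℓ : ℕ} {ω : QSample}

lemma strictMono_time (h : IsRegular ℓ ω) : StrictMono fun n => (eventRecord ℓ ω n).time :=
  strictMono_nat_of_lt_succ fun n => by
    rw [time_succ]
    linarith [timeToEvent_pos (h.state_mem n)]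

lemma lastEvent_eq (h : IsRegular ℓ ω) {n : ℕ} {t : ℝ} (h1 : (eventRecord ℓ ω n).time ≤ t)
    (h2 : t < (eventRecord ℓ ω (n + 1)).time) : lastEvent ℓ ω t = n := by
  have : {k : ℕ | (eventRecord ℓ ω k).time ≤ t} = Set.Iic n := by
    ext k
    simp only [Set.mem_ofPred_eq, Set.mem_Iic]
    refine ⟨fun hk => ?_, fun hk => (h.strictMono_time.monotone hk).trans h1⟩
    exact Nat.lt_succ_iff.1 (h.strictMono_time.lt_iff_lt.1 (hk.trans_lt h2))
  rw [lastEvent, this, csSup_Iic]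

lemma process_eq (h : IsRegular ℓ ω) {n : ℕ} {t : ℝ} (h1 : (eventRecord ℓ ω n).time ≤ t)
    (h2 : t < (eventRecord ℓ ω (n + 1)).time) :
    process ℓ ω t = drift (eventRecord ℓ ω n).state (t - (eventRecord ℓ ω n).time) := by
  rw [process, h.lastEvent_eq h1 h2]

lemma exists_index (h : IsRegular ℓ ω) {t : ℝ} (ht : 0 ≤ t) :
    ∃ n, (eventRecord ℓ ω n).time ≤ t ∧ t < (eventRecord ℓ ω (n + 1)).time := by
  classical
  have hex : ∃ n, t < (eventRecord ℓ ω n).time := (h.tendsto_time.eventually_gt_atTop t).exists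
  have hpos : Nat.find hex ≠ 0 := fun h0 => by
    have := Nat.find_spec hex
    rw [h0] at this
    simp only [eventRecord] at this
    linarith
  obtain ⟨k, hk⟩ := Nat.exists_eq_succ_of_ne_zero hpos
  refine ⟨k, not_lt.1 (Nat.find_min hex (by omega)), ?_⟩
  have := Nat.find_spec hex
  rwa [hk] at this

lemma index_unique (h : IsRegular ℓ ω) {t : ℝ} {n k : ℕ}
    (hn : (eventRecord ℓ ω n).time ≤ t ∧ t < (eventRecord ℓ ω (n + 1)).time)
    (hk : (eventRecord ℓ ω k).time ≤ t ∧ t < (eventRecord ℓ ω (k + 1)).time) : n = k := by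
  rw [← h.lastEvent_eq hn.1 hn.2, h.lastEvent_eq hk.1 hk.2]

lemma leftLim_process (h : IsRegular ℓ ω) (n : ℕ) :
    Function.leftLim (process ℓ ω) (eventRecord ℓ ω (n + 1)).time
      = preJump (eventRecord ℓ ω n).state := by
  apply leftLim_eq_of_tendsto
  have hc : Continuous fun t => drift (eventRecord ℓ ω n).state (t - (eventRecord ℓ ω n).time) := by
    unfold drift
    refine continuous_const.prodMk ((by fun_prop : Continuous fun t =>
      (eventRecord ℓ ω n).state.2.1 - (t - (eventRecord ℓ ω n).time)).prodMk ?_)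
    split_ifs <;> fun_prop
  have hlim := (hc.tendsto (eventRecord ℓ ω (n + 1)).time).mono_left
    (nhdsWithin_le_nhds (s := Set.Iio (eventRecord ℓ ω (n + 1)).time))
  have e : drift (eventRecord ℓ ω n).state
      ((eventRecord ℓ ω (n + 1)).time - (eventRecord ℓ ω n).time)
      = preJump (eventRecord ℓ ω n).state := by
    rw [time_succ, add_sub_cancel_left]; rfl
  rw [← e]
  refine hlim.congr' ?_
  filter_upwards [self_mem_nhdsWithin, mem_nhdsWithin_of_mem_nhds
    (Ioi_mem_nhds (h.strictMono_time n.lt_succ_self))] with t h1 h2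
  exact (h.process_eq (le_of_lt h2) h1).symm

end IsRegular

/-- Points that are followed by no event until the time `s`. -/
def staySet (s : ℝ) : Set (ℝ × QState) := {z | z.1 ≤ s ∧ s < z.1 + timeToEvent z.2}

/-- Points that are followed by an event until the time `s`. -/
def jumpSet (s : ℝ) : Set (ℝ × QState) := {z | z.1 + timeToEvent z.2 ≤ s}

/-- Points at a time at most `s`. -/
def pastSet (s : ℝ) : Set (ℝ × QState) := {z | z.1 ≤ s}

lemma measurableSet_staySet (s : ℝ) : MeasurableSet (staySet s) :=
  (measurableSet_le measurable_fst measurable_const).inter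
    (measurableSet_lt measurable_const
      (by fun_prop : Measurable fun z : ℝ × QState => z.1 + timeToEvent z.2))

lemma measurableSet_jumpSet (s : ℝ) : MeasurableSet (jumpSet s) :=
  measurableSet_le (by fun_prop) measurable_const

lemma measurableSet_pastSet (s : ℝ) : MeasurableSet (pastSet s) :=
  measurableSet_le (by fun_prop) measurable_const

@[fun_prop]
lemma measurable_drift' {α : Type*} [MeasurableSpace α] {f : α → QState} {g : α → ℝ}
    (hf : Measurable f) (hg : Measurable g) : Measurable fun x => drift (f x) (g x) :=
  measurable_drift.comp (hf.prodMk hg)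

namespace IsStationary

variable {M : FiniteQueue} {π : ProbabilityMeasure QState}

lemma ae_mem (h : M.IsStationary π) :
    ∀ᵐ x ∂(π : Measure QState), x ∈ stateSpace M.threshold := h.state_space

/-- Almost surely exactly one point is the last one before `s`, so the law of `X(s)`, which is `π`,
splits according to the index of that point. -/
lemma lintegral_eq_tsum (h : M.IsStationary π) {s : ℝ} (hs : 0 ≤ s) {g : QState → ℝ≥0∞}
    (hg : Measurable g) :
    ∫⁻ x, g x ∂(π : Measure QState)
      = ∑' n, ∫⁻ z in staySet s, g (drift z.2 (s - z.1)) ∂M.pointLaw π n := by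
  -- Measurability of `X(s)` need not be proved from the construction: the image under a map that is
  -- not almost everywhere measurable is the zero measure, which cannot equal `π`.
  have hae : AEMeasurable (fun ω => process M.threshold ω s) (M.sampleLaw π) := by
    by_contra hne
    have := h.map_process s hs
    rw [Measure.map_of_not_aemeasurable hne] at this
    exact IsProbabilityMeasure.ne_zero (π : Measure QState) this.symm
  conv_lhs => rw [← h.map_process s hs]
  rw [lintegral_map' hg.aemeasurable hae]
  have hm : Measurable ((staySet s).indicator fun z : ℝ × QState => g (drift z.2 (s - z.1))) :=
    (hg.comp (by fun_prop)).indicator (measurableSet_staySet s)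
  have e : ∀ n, ∫⁻ z in staySet s, g (drift z.2 (s - z.1)) ∂M.pointLaw π n
      = ∫⁻ ω, (staySet s).indicator (fun z : ℝ × QState => g (drift z.2 (s - z.1)))
        (point M.threshold n ω) ∂M.sampleLaw π := by
    intro n
    rw [← lintegral_indicator (measurableSet_staySet s), ← M.map_point,
      lintegral_map hm (measurable_point _ n)]
  simp_rw [e]
  have hm' : ∀ n, Measurable fun ω => (staySet s).indicator
      (fun z : ℝ × QState => g (drift z.2 (s - z.1))) (point M.threshold n ω) := fun n =>
    hm.comp (measurable_point _ n)
  rw [← lintegral_tsum fun n => (hm' n).aemeasurable]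
  refine lintegral_congr_ae ?_
  filter_upwards [M.ae_isRegular h.ae_mem] with ω hω
  obtain ⟨n, hn⟩ := hω.exists_index hs
  rw [tsum_eq_single n]
  · rw [Set.indicator_of_mem (show point M.threshold n ω ∈ staySet s from hn),
      hω.process_eq hn.1 hn.2]
    rfl
  · intro k hk
    have hk' : point M.threshold k ω ∉ staySet s := fun hk' => hk (hω.index_unique hk' hn)
    rw [Set.indicator_of_notMem hk']

lemma eq_sum_stay (h : M.IsStationary π) {s : ℝ} (hs : 0 ≤ s) :
    (π : Measure QState) = Measure.sum fun n =>
      Measure.map (fun z : ℝ × QState => drift z.2 (s - z.1))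
        ((M.pointLaw π n).restrict (staySet s)) := by
  refine Measure.ext_of_lintegral _ fun g hg => ?_
  rw [h.lintegral_eq_tsum hs hg, lintegral_sum_measure]
  exact tsum_congr fun n => (lintegral_map hg (by fun_prop)).symm

/-- Points and times in `[0, 1)` such that no event separates the time from the point. -/
def stayProdSet : Set ((ℝ × QState) × ℝ) := {p | p.1 ∈ staySet p.2}

lemma measurableSet_stayProdSet : MeasurableSet stayProdSet :=
  (measurableSet_le (by fun_prop : Measurable fun p : (ℝ × QState) × ℝ => p.1.1)
    measurable_snd).inter (measurableSet_lt measurable_snd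
      (by fun_prop : Measurable fun p : (ℝ × QState) × ℝ => p.1.1 + timeToEvent p.1.2))

/-- Stationarity averaged over `s ∈ [0, 1)`. In this form an integral against `π` becomes a sum of
time integrals along the drift, to which the fundamental theorem of calculus applies. -/
lemma eq_sum_occupation (h : M.IsStationary π) :
    (π : Measure QState) = Measure.sum fun n =>
      Measure.map (fun p : (ℝ × QState) × ℝ => drift p.1.2 (p.2 - p.1.1))
        (((M.pointLaw π n).prod (volume.restrict (Set.Ico (0 : ℝ) 1))).restrict stayProdSet) := by
  refine Measure.ext_of_lintegral _ fun g hg => ?_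
  have h1 : ∫⁻ x, g x ∂(π : Measure QState)
      = ∫⁻ s in Set.Ico (0 : ℝ) 1, ∑' n, ∫⁻ z in staySet s, g (drift z.2 (s - z.1))
        ∂M.pointLaw π n := by
    rw [← setLIntegral_congr_fun (f := fun _ => ∫⁻ x, g x ∂(π : Measure QState))
      measurableSet_Ico fun s hs => h.lintegral_eq_tsum hs.1 hg]
    simp
  have hm : Measurable (stayProdSet.indicator
      fun p : (ℝ × QState) × ℝ => g (drift p.1.2 (p.2 - p.1.1))) :=
    (hg.comp (by fun_prop)).indicator measurableSet_stayProdSet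
  have e : ∀ n s, ∫⁻ z in staySet s, g (drift z.2 (s - z.1)) ∂M.pointLaw π n
      = ∫⁻ z, stayProdSet.indicator (fun p : (ℝ × QState) × ℝ =>
        g (drift p.1.2 (p.2 - p.1.1))) (z, s) ∂M.pointLaw π n := by
    intro n s
    rw [← lintegral_indicator (measurableSet_staySet s)]
    rfl
  rw [h1, lintegral_sum_measure]
  simp_rw [e]
  rw [lintegral_tsum fun n => hm.lintegral_prod_left'.aemeasurable]
  refine tsum_congr fun n => ?_
  rw [lintegral_map hg (by fun_prop), ← lintegral_indicator measurableSet_stayProdSet,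
    lintegral_prod_symm' _ hm]

end IsStationary

/-! ### The basic adjoint relationship. -/

/-- A bounded function `f` on the state space together with its derivative along the drift. -/
structure IsTestPair (ℓ : ℕ) (f Df : QState → ℝ) : Prop where
  measurable_fun : Measurable f
  measurable_deriv : Measurable Df
  bound : ∃ C, ∀ x ∈ closedStateSpace ℓ, |f x| ≤ C ∧ |Df x| ≤ C
  integral_eq : ∀ x ∈ stateSpace ℓ, ∀ u, 0 ≤ u → u ≤ timeToEvent x →
    ∫ s in (0 : ℝ)..u, Df (drift x s) = f (drift x u) - f x

/-- Expectation of `f` after the event(s) in the state `y`. -/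
noncomputable def jumpMean (M : FiniteQueue) (f : QState → ℝ) (y : QState) : ℝ :=
  ∫ d, f (jump M.threshold y d.1 d.2) ∂M.drawLaw

/-- Mean number of event instants in `(0, 1]`, according to the state just before the event. -/
noncomputable def eventMeasure (M : FiniteQueue) (π : ProbabilityMeasure QState) :
    Measure QState :=
  Measure.sum fun n => Measure.map (fun z : ℝ × QState => preJump z.2)
    ((M.pointLaw π n).restrict (jumpSet 1))

lemma eventMeasure_apply (M : FiniteQueue) (π : ProbabilityMeasure QState) {B : Set QState}
    (hB : MeasurableSet B) : M.eventMeasure π B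
      = ∑' n, M.pointLaw π n ({z | preJump z.2 ∈ B} ∩ jumpSet 1) := by
  rw [eventMeasure, Measure.sum_apply _ hB]
  refine tsum_congr fun n => ?_
  have hf : Measurable fun z : ℝ × QState => preJump z.2 := by fun_prop
  rw [Measure.map_apply hf hB, Measure.restrict_apply (hf hB)]
  rfl

lemma isFiniteMeasure_eventMeasure (M : FiniteQueue) {π : ProbabilityMeasure QState}
    (hπ : ∀ᵐ x ∂(π : Measure QState), x ∈ stateSpace M.threshold) :
    IsFiniteMeasure (M.eventMeasure π) := by
  refine ⟨?_⟩
  rw [M.eventMeasure_apply π MeasurableSet.univ]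
  have := (M.summable_measureReal_jump hπ 1).tsum_ofReal_lt_top
  refine lt_of_le_of_lt (ENNReal.tsum_le_tsum fun n => ?_) this
  rw [measureReal_def, ENNReal.ofReal_toReal (measure_ne_top _ _)]
  exact measure_mono fun z hz => hz.2

lemma ae_eventMeasure (M : FiniteQueue) {π : ProbabilityMeasure QState}
    (hπ : ∀ᵐ x ∂(π : Measure QState), x ∈ stateSpace M.threshold) :
    ∀ᵐ y ∂M.eventMeasure π, y ∈ closedStateSpace M.threshold ∧ y ∈ arrivalSet ∪ serviceSet := by
  rw [eventMeasure, Measure.ae_sum_iff']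
  · intro n
    have hf : Measurable fun z : ℝ × QState => preJump z.2 := by fun_prop
    rw [ae_map_iff hf.aemeasurable]
    · refine ae_restrict_of_ae ?_
      filter_upwards [M.ae_pointLaw hπ n] with z hz
      exact ⟨preJump_mem_closed hz.2, preJump_mem_union _⟩
    · exact ((measurable_fst (measurableSet_Iic (a := M.threshold))).inter
        (((measurable_fst.comp measurable_snd) (measurableSet_Ici (a := (0 : ℝ)))).inter
        ((measurable_snd.comp measurable_snd) (measurableSet_Ici (a := (0 : ℝ)))))).inter
        (measurableSet_arrivalSet.union measurableSet_serviceSet)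
  · exact ((measurable_fst (measurableSet_Iic (a := M.threshold))).inter
        (((measurable_fst.comp measurable_snd) (measurableSet_Ici (a := (0 : ℝ)))).inter
        ((measurable_snd.comp measurable_snd) (measurableSet_Ici (a := (0 : ℝ)))))).inter
        (measurableSet_arrivalSet.union measurableSet_serviceSet)

/-- Event `n + 1` has happened by time `s` exactly when point `n` is followed by an event until `s`.
-/
lemma pointLaw_succ_pastSet (M : FiniteQueue) (π : ProbabilityMeasure QState) (n : ℕ) (s : ℝ) :
    M.pointLaw π (n + 1) (pastSet s) = M.pointLaw π n (jumpSet s) := by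
  rw [pointLaw, Measure.map_apply (measurable_nextPoint _) (measurableSet_pastSet s)]
  have : (fun p : (ℝ × QState) × (ℝ × ℝ) => nextPoint M.threshold p.1 p.2) ⁻¹' pastSet s
      = jumpSet s ×ˢ Set.univ := by
    ext p; simp [pastSet, jumpSet, nextPoint]
  rw [this, Measure.prod_prod]
  simp

@[fun_prop]
lemma measurable_jumpMean (M : FiniteQueue) {f : QState → ℝ} (hf : Measurable f) :
    Measurable (M.jumpMean f) := by
  have : Measurable fun p : QState × (ℝ × ℝ) => f (jump M.threshold p.1 p.2.1 p.2.2) :=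
    hf.comp (measurable_jump _)
  exact (this.stronglyMeasurable.integral_prod_right' (ν := M.drawLaw)).measurable

namespace IsTestPair

variable {M : FiniteQueue} {π : ProbabilityMeasure QState} {f Df : QState → ℝ}

lemma exists_bound_jumpMean (hf : IsTestPair M.threshold f Df) :
    ∃ C, 0 ≤ C ∧ (∀ x ∈ closedStateSpace M.threshold, |f x| ≤ C ∧ |Df x| ≤ C) ∧
      ∀ x ∈ stateSpace M.threshold, |M.jumpMean f (preJump x)| ≤ C := by
  obtain ⟨C, hC⟩ := hf.bound
  have hC0 : 0 ≤ C := (abs_nonneg _).trans (hC (0, 0, 0) ⟨Nat.zero_le _, le_rfl, le_rfl⟩).1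
  refine ⟨C, hC0, hC, fun x hx => ?_⟩
  have := norm_integral_le_of_norm_le_const (μ := M.drawLaw)
    (f := fun d : ℝ × ℝ => f (jump M.threshold (preJump x) d.1 d.2)) (C := C) (by
      filter_upwards [M.ae_drawLaw] with d hd
      refine (hC _ (stateSpace_subset _ (jump_mem (preJump_mem_closed hx) (fun h => ?_) hd))).1
      have h' : x.1 = 0 := h
      simp only [preJump, drift, h', if_true]
      exact hx.2.2)
  simpa [jumpMean] using this

lemma integral_past_succ (hf : IsTestPair M.threshold f Df)
    (hπ : ∀ᵐ x ∂(π : Measure QState), x ∈ stateSpace M.threshold) (n : ℕ) (s : ℝ) :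
    ∫ z in pastSet s, f z.2 ∂M.pointLaw π (n + 1)
      = ∫ z in jumpSet s, M.jumpMean f (preJump z.2) ∂M.pointLaw π n := by
  obtain ⟨C, hC0, hC, -⟩ := hf.exists_bound_jumpMean
  have hm : Measurable ((pastSet s).indicator fun z : ℝ × QState => f z.2) :=
    (hf.measurable_fun.comp measurable_snd).indicator (measurableSet_pastSet s)
  rw [← integral_indicator (measurableSet_pastSet s), ← integral_indicator (measurableSet_jumpSet s),
    M.integral_pointLaw_succ π n hm]
  · refine integral_congr_ae (ae_of_all _ fun z => ?_)
    by_cases h : z ∈ jumpSet s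
    · rw [Set.indicator_of_mem h]
      refine integral_congr_ae (ae_of_all _ fun d => ?_)
      exact Set.indicator_of_mem (show nextPoint M.threshold z d ∈ pastSet s from h) _
    · rw [Set.indicator_of_notMem h]
      refine integral_eq_zero_of_ae (ae_of_all _ fun d => ?_)
      exact Set.indicator_of_notMem (show nextPoint M.threshold z d ∉ pastSet s from h) _
  · refine integrable_of_ae_bound hm (C := C) ?_
    filter_upwards [M.ae_pointLaw hπ (n + 1)] with z hz
    by_cases h : z ∈ pastSet s
    · rw [Set.indicator_of_mem h]; exact (hC _ (stateSpace_subset _ hz.2)).1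
    · rw [Set.indicator_of_notMem h]; simpa using hC0

/-- Increment of a test function along the drift between two event instants, until time `1`. -/
noncomputable def increment (f : QState → ℝ) (z : ℝ × QState) : ℝ :=
  f (drift z.2 (min (1 - z.1) (timeToEvent z.2))) - f z.2

/-- Up to time `1` a past point either drifts undisturbed to `X(1)` or reaches the next event. The
change of `f` thus splits into the terminal value, the increment along the drift and the jump; these
three terms are summed over `n` in the adjoint relationship. -/
lemma integral_past_sub (hf : IsTestPair M.threshold f Df)
    (hπ : ∀ᵐ x ∂(π : Measure QState), x ∈ stateSpace M.threshold) (n : ℕ) :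
    ∫ z in pastSet 1, f z.2 ∂M.pointLaw π n - ∫ z in pastSet 1, f z.2 ∂M.pointLaw π (n + 1)
      = ∫ z in staySet 1, f (drift z.2 (1 - z.1)) ∂M.pointLaw π n
        - ∫ z in pastSet 1, increment f z ∂M.pointLaw π n
        - ∫ z in jumpSet 1, (M.jumpMean f (preJump z.2) - f (preJump z.2)) ∂M.pointLaw π n := by
  obtain ⟨C, hC0, hC, hC'⟩ := hf.exists_bound_jumpMean
  have hfm := hf.measurable_fun
  have hae := M.ae_pointLaw hπ n
  have hJ := M.measurable_jumpMean hfm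
  have m1 : Measurable fun z : ℝ × QState => f (drift z.2 (min (1 - z.1) (timeToEvent z.2))) :=
    hfm.comp (by fun_prop)
  have m2 : Measurable fun z : ℝ × QState => f (drift z.2 (1 - z.1)) := hfm.comp (by fun_prop)
  have m3 : Measurable fun z : ℝ × QState => f (preJump z.2) := hfm.comp (by fun_prop)
  have m4 : Measurable fun z : ℝ × QState => M.jumpMean f (preJump z.2) := hJ.comp (by fun_prop)
  have i0 : Integrable (fun z : ℝ × QState => f z.2) (M.pointLaw π n) :=
    integrable_of_ae_bound (hfm.comp measurable_snd) (C := C) (by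
      filter_upwards [hae] with z hz
      exact (hC _ (stateSpace_subset _ hz.2)).1)
  have i1 : Integrable (fun z : ℝ × QState => f (drift z.2 (min (1 - z.1) (timeToEvent z.2))))
      (M.pointLaw π n) := integrable_of_ae_bound m1 (C := C) (by
      filter_upwards [hae] with z hz
      exact (hC _ (drift_mem_closed hz.2 (min_le_right _ _))).1)
  have i3 : Integrable (fun z : ℝ × QState => f (preJump z.2)) (M.pointLaw π n) :=
    integrable_of_ae_bound m3 (C := C) (by
      filter_upwards [hae] with z hz
      exact (hC _ (preJump_mem_closed hz.2)).1)
  have i4 : Integrable (fun z : ℝ × QState => M.jumpMean f (preJump z.2)) (M.pointLaw π n) :=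
    integrable_of_ae_bound m4 (C := C) (by
      filter_upwards [hae] with z hz
      exact hC' _ hz.2)
  have i2 : IntegrableOn (fun z : ℝ × QState => f (drift z.2 (1 - z.1))) (staySet 1)
      (M.pointLaw π n) := by
    refine integrable_of_ae_bound m2 (C := C) ?_
    filter_upwards [ae_restrict_of_ae hae, ae_restrict_mem (measurableSet_staySet 1)] with z hz hz'
    exact (hC _ (drift_mem_closed hz.2 (by linarith [hz'.2]))).1
  have key : ∫ z in pastSet 1, f (drift z.2 (min (1 - z.1) (timeToEvent z.2))) ∂M.pointLaw π n
      = ∫ z in staySet 1, f (drift z.2 (1 - z.1)) ∂M.pointLaw π n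
        + ∫ z in jumpSet 1, f (preJump z.2) ∂M.pointLaw π n := by
    rw [← integral_indicator (measurableSet_pastSet 1), ← integral_indicator (measurableSet_jumpSet 1),
      ← integral_indicator (measurableSet_staySet 1), ← integral_add
        (i2.integrable_indicator (measurableSet_staySet 1)) (i3.indicator (measurableSet_jumpSet 1))]
    refine integral_congr_ae ?_
    filter_upwards [hae] with z hz
    have htp := timeToEvent_pos hz.2
    by_cases h : z.1 + timeToEvent z.2 ≤ 1
    · rw [Set.indicator_of_mem (show z ∈ pastSet 1 from by simp only [pastSet, Set.mem_ofPred_eq]; linarith),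
        Set.indicator_of_notMem (show z ∉ staySet 1 from fun h' => by linarith [h'.2]),
        Set.indicator_of_mem (show z ∈ jumpSet 1 from h), min_eq_right (by linarith), zero_add]
      rfl
    · rw [Set.indicator_of_notMem (show z ∉ jumpSet 1 from h)]
      by_cases h' : z.1 ≤ 1
      · rw [Set.indicator_of_mem (show z ∈ pastSet 1 from h'),
          Set.indicator_of_mem (show z ∈ staySet 1 from ⟨h', not_le.1 h⟩),
          min_eq_left (by linarith), add_zero]
      · rw [Set.indicator_of_notMem (show z ∉ pastSet 1 from h'),
          Set.indicator_of_notMem (show z ∉ staySet 1 from fun h2 => h' h2.1), add_zero]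
  rw [hf.integral_past_succ hπ]
  unfold increment
  rw [integral_sub i1.integrableOn i0.integrableOn, integral_sub i4.integrableOn i3.integrableOn,
    key]
  ring

/-- For a fixed point the times of its stay within `[0, 1)` form an interval, over which the
derivative integrates to the increment of `f`. -/
lemma integral_occupation (hf : IsTestPair M.threshold f Df)
    (hπ : ∀ᵐ x ∂(π : Measure QState), x ∈ stateSpace M.threshold) (n : ℕ) :
    ∫ x, Df x ∂(Measure.map (fun p : (ℝ × QState) × ℝ => drift p.1.2 (p.2 - p.1.1))
        (((M.pointLaw π n).prod (volume.restrict (Set.Ico (0 : ℝ) 1))).restrict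
          IsStationary.stayProdSet))
      = ∫ z in pastSet 1, increment f z ∂M.pointLaw π n := by
  obtain ⟨C, hC0, hC, hC'⟩ := hf.exists_bound_jumpMean
  have hms := IsStationary.measurableSet_stayProdSet
  have hm : Measurable fun p : (ℝ × QState) × ℝ => Df (drift p.1.2 (p.2 - p.1.1)) :=
    hf.measurable_deriv.comp (by fun_prop)
  have hae := M.ae_pointLaw hπ n
  rw [integral_map (Measurable.aemeasurable (by fun_prop))
    hf.measurable_deriv.aestronglyMeasurable, ← integral_indicator hms, integral_prod,
    ← integral_indicator (measurableSet_pastSet 1)]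
  · refine integral_congr_ae ?_
    filter_upwards [hae] with z hz
    have htp := timeToEvent_pos hz.2
    have e : ∫ s in Set.Ico (0 : ℝ) 1, IsStationary.stayProdSet.indicator
        (fun p : (ℝ × QState) × ℝ => Df (drift p.1.2 (p.2 - p.1.1))) (z, s)
        = ∫ s in Set.Ico z.1 (min 1 (z.1 + timeToEvent z.2)), Df (drift z.2 (s - z.1)) := by
      have e1 : ∀ s, IsStationary.stayProdSet.indicator
          (fun p : (ℝ × QState) × ℝ => Df (drift p.1.2 (p.2 - p.1.1))) (z, s)
          = (Set.Ico z.1 (z.1 + timeToEvent z.2)).indicator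
            (fun s => Df (drift z.2 (s - z.1))) s := fun s => rfl
      simp_rw [e1]
      rw [setIntegral_indicator measurableSet_Ico, Set.Ico_inter_Ico, max_eq_right hz.1]
    rw [e]
    by_cases h : z.1 ≤ 1
    · rw [Set.indicator_of_mem (show z ∈ pastSet 1 from h), integral_Ico_eq_integral_Ioc,
        ← intervalIntegral.integral_of_le (le_min h (by linarith)),
        intervalIntegral.integral_comp_sub_right (fun s => Df (drift z.2 s)), sub_self]
      have hmin : min 1 (z.1 + timeToEvent z.2) - z.1 = min (1 - z.1) (timeToEvent z.2) := by
        rw [← min_sub_sub_right, add_sub_cancel_left]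
      rw [hmin, hf.integral_eq z.2 hz.2 _ (le_min (by linarith) htp.le) (min_le_right _ _)]
      rfl
    · rw [Set.indicator_of_notMem (show z ∉ pastSet 1 from h), Set.Ico_eq_empty (fun h' => ?_)]
      · simp
      · exact h (h'.le.trans (min_le_left _ _))
  · refine integrable_of_ae_bound (hm.indicator hms) (C := C) ?_
    filter_upwards [Measure.quasiMeasurePreserving_fst.ae hae] with p hp
    by_cases h : p ∈ IsStationary.stayProdSet
    · rw [Set.indicator_of_mem h]
      exact (hC _ (drift_mem_closed hp.2 (by linarith [h.2]))).2
    · rw [Set.indicator_of_notMem h]; simpa using hC0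

/-- The basic adjoint relationship. -/
theorem integral_deriv_add_integral_jump (hf : IsTestPair M.threshold f Df)
    (hπ : M.IsStationary π) :
    ∫ x, Df x ∂(π : Measure QState)
      + ∫ y, (M.jumpMean f y - f y) ∂M.eventMeasure π = 0 := by
  obtain ⟨C, hC0, hC, hC'⟩ := hf.exists_bound_jumpMean
  have hst := hπ.ae_mem
  have hJm : Measurable fun y => M.jumpMean f y - f y := (M.measurable_jumpMean hf.measurable_fun).sub hf.measurable_fun
  have := M.isFiniteMeasure_eventMeasure hst
  have s1 : HasSum (fun n => ∫ z in staySet 1, f (drift z.2 (1 - z.1)) ∂M.pointLaw π n)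
      (∫ x, f x ∂(π : Measure QState)) := by
    have hi : Integrable f (π : Measure QState) :=
      integrable_of_ae_bound hf.measurable_fun (C := C) (by
        filter_upwards [hst] with x hx
        exact (hC _ (stateSpace_subset _ hx)).1)
    rw [hπ.eq_sum_stay zero_le_one] at hi ⊢
    refine (hasSum_integral_measure hi).congr_fun fun n => ?_
    rw [integral_map (Measurable.aemeasurable (by fun_prop))
      hf.measurable_fun.aestronglyMeasurable]
  have s2 : HasSum (fun n => ∫ z in pastSet 1, increment f z ∂M.pointLaw π n)
      (∫ x, Df x ∂(π : Measure QState)) := by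
    have hi : Integrable Df (π : Measure QState) :=
      integrable_of_ae_bound hf.measurable_deriv (C := C) (by
        filter_upwards [hst] with x hx
        exact (hC _ (stateSpace_subset _ hx)).2)
    rw [hπ.eq_sum_occupation] at hi ⊢
    refine (hasSum_integral_measure hi).congr_fun fun n => ?_
    rw [hf.integral_occupation hst]
  have s3 : HasSum (fun n => ∫ z in jumpSet 1, (M.jumpMean f (preJump z.2) - f (preJump z.2))
      ∂M.pointLaw π n) (∫ y, (M.jumpMean f y - f y) ∂M.eventMeasure π) := by
    have hi : Integrable (fun y => M.jumpMean f y - f y) (M.eventMeasure π) := by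
      refine integrable_of_ae_bound hJm (C := C + C) ?_
      rw [eventMeasure, Measure.ae_sum_iff']
      · intro n
        have hg : Measurable fun z : ℝ × QState => preJump z.2 := by fun_prop
        rw [ae_map_iff hg.aemeasurable (measurableSet_le hJm.abs measurable_const)]
        refine ae_restrict_of_ae ?_
        filter_upwards [M.ae_pointLaw hst n] with z hz
        exact (abs_sub _ _).trans (add_le_add (hC' _ hz.2) (hC _ (preJump_mem_closed hz.2)).1)
      · exact measurableSet_le hJm.abs measurable_const
    rw [eventMeasure] at hi ⊢
    refine (hasSum_integral_measure hi).congr_fun fun n => ?_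
    rw [integral_map (Measurable.aemeasurable (by fun_prop)) hJm.aestronglyMeasurable]
  -- The differences `a n - a (n + 1)` sum in two ways: to the three limits found above, and by
  -- telescoping to `a 0`, the mean of `f` at time `0`. The means of `f` at times `0` and `1` are
  -- equal by stationarity and cancel.
  set a : ℕ → ℝ := fun n => ∫ z in pastSet 1, f z.2 ∂M.pointLaw π n with ha
  have hsum := (s1.sub s2).sub s3
  have hcongr : HasSum (fun n => a n - a (n + 1)) (∫ x, f x ∂(π : Measure QState)
      - ∫ x, Df x ∂(π : Measure QState)
      - ∫ y, (M.jumpMean f y - f y) ∂M.eventMeasure π) :=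
    hsum.congr_fun fun n => (hf.integral_past_sub hst n)
  have ha0 : a 0 = ∫ x, f x ∂(π : Measure QState) := by
    have hmi : Measurable ((pastSet 1).indicator fun z : ℝ × QState => f z.2) :=
      Measurable.indicator (hf.measurable_fun.comp measurable_snd) (measurableSet_pastSet 1)
    simp only [ha]
    rw [← integral_indicator (measurableSet_pastSet 1), pointLaw, Measure.dirac_prod,
      integral_map (Measurable.aemeasurable (by fun_prop))
      hmi.aestronglyMeasurable]
    refine integral_congr_ae (ae_of_all _ fun x => ?_)
    exact Set.indicator_of_mem (show ((0 : ℝ), x) ∈ pastSet 1 from (zero_le_one : (0 : ℝ) ≤ 1)) _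
  -- The boundary term of the telescoping is at most `C` times the probability that event `n + 1`
  -- occurs by time `1`.
  have hlim : Tendsto a atTop (𝓝 0) := by
    rw [← tendsto_add_atTop_iff_nat 1]
    have h0 : Tendsto (fun n => C * (M.pointLaw π n).real (jumpSet 1)) atTop (𝓝 0) := by
      simpa [jumpSet] using ((M.summable_measureReal_jump hst 1).tendsto_atTop_zero).const_mul C
    refine squeeze_zero_norm (fun n => ?_) h0
    have := norm_setIntegral_le_of_norm_le_const_ae (μ := M.pointLaw π (n + 1)) (s := pastSet 1)
      (f := fun z => f z.2) (C := C) (measure_lt_top _ _) (by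
        refine ae_restrict_of_ae ?_
        filter_upwards [M.ae_pointLaw hst (n + 1)] with z hz
        exact (hC _ (stateSpace_subset _ hz.2)).1)
    rwa [measureReal_def, M.pointLaw_succ_pastSet] at this
  have htel : Tendsto (fun N => ∑ n ∈ Finset.range N, (a n - a (n + 1))) atTop (𝓝 (a 0 - 0)) := by
    simp_rw [Finset.sum_range_sub']
    exact tendsto_const_nhds.sub hlim
  have := tendsto_nhds_unique hcongr.tendsto_sum_nat htel
  rw [ha0] at this
  linarith

end IsTestPair

end FiniteQueue

/-! ### Arrival epochs and Palm probabilities in terms of the event measure. -/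

namespace FiniteQueue

lemma arrivals_succ (ℓ : ℕ) (ω : QSample) (n : ℕ) [Decidable (preJump (eventRecord ℓ ω n).state ∈ arrivalSet)] :
    (eventRecord ℓ ω (n + 1)).arrivals = (eventRecord ℓ ω n).arrivals
      + if preJump (eventRecord ℓ ω n).state ∈ arrivalSet then 1 else 0 := by
  by_cases h : preJump (eventRecord ℓ ω n).state ∈ arrivalSet
  · rw [if_pos h]
    simp only [eventRecord, nextEvent]
    rw [if_pos (show (drift _ _).2.1 = 0 from h)]
  · rw [if_neg h]
    simp only [eventRecord, nextEvent]
    rw [if_neg (show ¬ (drift _ _).2.1 = 0 from h)]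

lemma time_succ_of_arrival {ℓ : ℕ} {ω : QSample} {n : ℕ}
    (h : preJump (eventRecord ℓ ω n).state ∈ arrivalSet) :
    (eventRecord ℓ ω (n + 1)).time
      = (eventRecord ℓ ω n).time + (eventRecord ℓ ω n).state.2.1 := by
  have h' : (eventRecord ℓ ω n).state.2.1 - timeToEvent (eventRecord ℓ ω n).state = 0 := h
  rw [time_succ]; linarith

/-- The invariant that ties the two clocks together: present time plus residual inter-arrival time
is the next arrival epoch, and it changes only when an arrival occurs. -/
lemma arrivalTime_arrivals (ℓ : ℕ) (ω : QSample) (n : ℕ) :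
    arrivalTime ω (eventRecord ℓ ω n).arrivals
      = (eventRecord ℓ ω n).time + (eventRecord ℓ ω n).state.2.1 := by
  classical
  induction n with
  | zero => simp [eventRecord, arrivalTime]
  | succ n ih =>
    rw [arrivals_succ]
    by_cases h : preJump (eventRecord ℓ ω n).state ∈ arrivalSet
    · rw [if_pos h, time_succ_of_arrival h, ← ih, arrivalTime, Finset.sum_range_succ, ← add_assoc,
        ← arrivalTime]
      congr 1
      simp only [eventRecord, nextEvent, jump]
      rw [if_pos (show (drift _ _).2.1 = 0 from h)]
    · rw [if_neg h, add_zero, ih, time_succ]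
      have : (eventRecord ℓ ω (n + 1)).state.2.1 = (eventRecord ℓ ω n).state.2.1
          - timeToEvent (eventRecord ℓ ω n).state := by
        simp only [eventRecord, nextEvent, jump]
        rw [if_neg (show ¬ (drift _ _).2.1 = 0 from h)]
        rfl
      rw [this]; ring

namespace IsRegular

variable {ℓ : ℕ} {ω : QSample}

/-- If the arrival count stayed bounded, the next arrival epoch would take finitely many values; yet
it always exceeds the event instant, which tends to infinity. -/
lemma exists_lt_arrivals (h : IsRegular ℓ ω) (m : ℕ) : ∃ n, m < (eventRecord ℓ ω n).arrivals := by
  by_contra! hm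
  set C := ∑ j ∈ Finset.range (m + 1), |arrivalTime ω j|
  obtain ⟨n, hn⟩ := (h.tendsto_time.eventually_gt_atTop C).exists
  have h1 : |arrivalTime ω (eventRecord ℓ ω n).arrivals| ≤ C :=
    Finset.single_le_sum (f := fun j => |arrivalTime ω j|) (fun j _ => abs_nonneg _)
      (Finset.mem_range.2 (Nat.lt_succ_of_le (hm n)))
  have h2 := le_abs_self (arrivalTime ω (eventRecord ℓ ω n).arrivals)
  rw [arrivalTime_arrivals] at h2 h1
  have h3 := (h.state_mem n).2.1
  linarith

/-- The event instants at which a customer arrives are numbered by the arrivals. -/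
lemma bijective_arrivals (h : IsRegular ℓ ω) :
    Function.Bijective fun n : {n | preJump (eventRecord ℓ ω n).state ∈ arrivalSet} =>
      (eventRecord ℓ ω n).arrivals := by
  classical
  have hmono : Monotone fun n => (eventRecord ℓ ω n).arrivals :=
    monotone_nat_of_le_succ fun n => by rw [arrivals_succ]; exact Nat.le_add_right _ _
  have hlt : ∀ {n k : ℕ}, preJump (eventRecord ℓ ω n).state ∈ arrivalSet → n < k →
      (eventRecord ℓ ω n).arrivals < (eventRecord ℓ ω k).arrivals := by
    intro n k hn hk
    have h1 := hmono (Nat.succ_le_of_lt hk)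
    have h2 := arrivals_succ ℓ ω n
    rw [if_pos hn] at h2
    simp only [Nat.succ_eq_add_one] at h1
    omega
  constructor
  · rintro ⟨n, hn⟩ ⟨k, hk⟩ hnk
    simp only at hnk
    rcases lt_trichotomy n k with h' | h' | h'
    · have := hlt hn h'; omega
    · exact Subtype.ext h'
    · have := hlt hk h'; omega
  · intro m
    have hex := h.exists_lt_arrivals m
    have hpos : Nat.find hex ≠ 0 := fun h0 => by
      have := Nat.find_spec hex
      rw [h0] at this
      simp [eventRecord] at this
    obtain ⟨k, hk⟩ := Nat.exists_eq_succ_of_ne_zero hpos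
    have h1 : (eventRecord ℓ ω k).arrivals ≤ m := not_lt.1 (Nat.find_min hex (by omega))
    have h2 := Nat.find_spec hex
    rw [hk, Nat.succ_eq_add_one, arrivals_succ] at h2
    by_cases h' : preJump (eventRecord ℓ ω k).state ∈ arrivalSet
    · rw [if_pos h'] at h2
      exact ⟨⟨k, h'⟩, by simp only; omega⟩
    · rw [if_neg h'] at h2
      omega

/-- The sum over arrivals is reindexed by the events at which an arrival occurs; there the left
limit of the path is the pre-jump state of the preceding point. -/
lemma tsum_arrivals (h : IsRegular ℓ ω) (B : Set QState) :
    ∑' m : ℕ, Set.indicator {ω : QSample | arrivalTime ω m ≤ 1 ∧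
      Function.leftLim (process ℓ ω) (arrivalTime ω m) ∈ B} (1 : QSample → ℝ≥0∞) ω
    = ∑' n : ℕ, Set.indicator ({z | preJump z.2 ∈ B ∩ arrivalSet} ∩ jumpSet 1)
      (1 : ℝ × QState → ℝ≥0∞) (point ℓ n ω) := by
  classical
  set I : Set ℕ := {n | preJump (eventRecord ℓ ω n).state ∈ arrivalSet} with hI
  have hb := h.bijective_arrivals
  rw [← (Equiv.ofBijective _ hb).tsum_eq, ← tsum_subtype_eq_of_support_subset (s := I)]
  · refine tsum_congr fun ⟨n, hn⟩ => ?_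
    have h1 : arrivalTime ω (eventRecord ℓ ω n).arrivals = (eventRecord ℓ ω (n + 1)).time := by
      rw [arrivalTime_arrivals, time_succ_of_arrival hn]
    simp only [Equiv.ofBijective_apply]
    rw [Set.indicator_apply, Set.indicator_apply]
    refine if_congr ?_ rfl rfl
    simp only [Set.mem_ofPred_eq, h1, h.leftLim_process]
    constructor
    · exact fun h' => ⟨⟨h'.2, hn⟩, h'.1⟩
    · exact fun h' => ⟨h'.2, h'.1.1⟩
  · intro n hn
    by_contra h'
    refine hn (Set.indicator_of_notMem (fun h2 => h' h2.1.2) _)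

end IsRegular

lemma lintegral_tsum_arrivals (M : FiniteQueue) {π : ProbabilityMeasure QState}
    (hπ : ∀ᵐ x ∂(π : Measure QState), x ∈ stateSpace M.threshold) {B : Set QState}
    (hB : MeasurableSet B) :
    ∫⁻ ω, ∑' m : ℕ, Set.indicator {ω : QSample | arrivalTime ω m ≤ 1 ∧
      Function.leftLim (process M.threshold ω) (arrivalTime ω m) ∈ B} 1 ω ∂(M.sampleLaw π)
    = M.eventMeasure π (B ∩ arrivalSet) := by
  have hBA : MeasurableSet ({z : ℝ × QState | preJump z.2 ∈ B ∩ arrivalSet} ∩ jumpSet 1) :=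
    ((by fun_prop : Measurable fun z : ℝ × QState => preJump z.2)
      (hB.inter measurableSet_arrivalSet)).inter (measurableSet_jumpSet 1)
  rw [M.eventMeasure_apply π (hB.inter measurableSet_arrivalSet), lintegral_congr_ae
    ((M.ae_isRegular hπ).mono fun ω h => h.tsum_arrivals B), lintegral_tsum]
  · refine tsum_congr fun n => ?_
    rw [← M.map_point, Measure.map_apply (measurable_point _ n) hBA, ← lintegral_indicator_one
      (measurable_point _ n hBA)]
    rfl
  · intro n
    have : Measurable fun ω => Set.indicator ({z : ℝ × QState | preJump z.2 ∈ B ∩ arrivalSet}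
        ∩ jumpSet 1) (1 : ℝ × QState → ℝ≥0∞) (point M.threshold n ω) :=
      (measurable_one.indicator hBA).comp (measurable_point _ n)
    exact this.aemeasurable

lemma arrivalIntensity_eq (M : FiniteQueue) {π : ProbabilityMeasure QState}
    (hπ : ∀ᵐ x ∂(π : Measure QState), x ∈ stateSpace M.threshold) :
    M.arrivalIntensity π = M.eventMeasure π arrivalSet := by
  have := M.lintegral_tsum_arrivals hπ MeasurableSet.univ
  simpa [arrivalIntensity] using this

/-- This is what makes Palm probabilities accessible to the balance identity: they become
conditional probabilities under the event measure. -/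
lemma palmArrivalProb_eq (M : FiniteQueue) {π : ProbabilityMeasure QState}
    (hπ : ∀ᵐ x ∂(π : Measure QState), x ∈ stateSpace M.threshold) {B : Set QState}
    (hB : MeasurableSet B) : M.palmArrivalProb π B
      = (M.eventMeasure π).real (B ∩ arrivalSet) / (M.eventMeasure π).real arrivalSet := by
  rw [palmArrivalProb, M.arrivalIntensity_eq hπ, M.lintegral_tsum_arrivals hπ hB,
    ENNReal.toReal_div]
  rfl

end FiniteQueue

/-! ### Truncated moments under uniform integrability of the squares. -/

/-- Second moment restricted to the values above `K`. -/
noncomputable def sqTail (P : Measure ℝ) (K : ℝ) : ℝ := ∫ x in Set.Ioi K, x ^ 2 ∂P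

lemma sqTail_nonneg (P : Measure ℝ) (K : ℝ) : 0 ≤ sqTail P K :=
  integral_nonneg fun x => sq_nonneg x

lemma sqTail_anti {P : Measure ℝ} (hint : Integrable (fun x => x ^ 2) P) {K K' : ℝ} (h : K ≤ K') :
    sqTail P K' ≤ sqTail P K :=
  setIntegral_mono_set hint.integrableOn (ae_of_all _ fun x => sq_nonneg x)
    (LE.le.eventuallyLE (Set.Ioi_subset_Ioi h))

section SingleLaw

variable {P : Measure ℝ} [IsProbabilityMeasure P]

lemma integrable_of_sq (hint : Integrable (fun x => x ^ 2) P) : Integrable (fun x : ℝ => x) P := by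
  refine ((integrable_const (1 : ℝ)).add hint).mono' (by fun_prop) (ae_of_all _ fun x => ?_)
  simp only [Pi.add_apply, Real.norm_eq_abs]
  rw [abs_le]
  constructor <;> nlinarith [sq_nonneg (x - 1), sq_nonneg (x + 1)]

/-- The common form of the truncation estimates: what happens below `K` is absorbed in a constant,
what happens above is paid for by the second-moment tail. -/
lemma integral_le_const_add_sqTail (hint : Integrable (fun x => x ^ 2) P) {f : ℝ → ℝ} {c d K : ℝ}
    (hf : ∀ᵐ x ∂P, f x ≤ c + d * (Set.Ioi K).indicator (fun x => x ^ 2) x)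
    (hfint : Integrable f P) : ∫ x, f x ∂P ≤ c + d * sqTail P K := by
  have hi : Integrable ((Set.Ioi K).indicator fun x : ℝ => x ^ 2) P :=
    hint.indicator measurableSet_Ioi
  calc ∫ x, f x ∂P ≤ ∫ x, (c + d * (Set.Ioi K).indicator (fun x => x ^ 2) x) ∂P :=
        integral_mono_ae hfint ((integrable_const c).add (hi.const_mul d)) hf
    _ = c + d * sqTail P K := by
        rw [integral_add (integrable_const c) (hi.const_mul d), integral_const_mul,
          integral_indicator measurableSet_Ioi]
        simp [sqTail]

lemma integrable_min_pow (hpos : ∀ᵐ x ∂P, 0 < x) {K : ℝ} (hK : 0 ≤ K) (n : ℕ) :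
    Integrable (fun x => min x K ^ n) P :=
  FiniteQueue.integrable_of_ae_bound (by fun_prop) (C := K ^ n) (by
    filter_upwards [hpos] with x hx
    rw [abs_of_nonneg (pow_nonneg (le_min hx.le hK) n)]
    exact pow_le_pow_left₀ (le_min hx.le hK) (min_le_right _ _) n)

lemma integrable_min (hpos : ∀ᵐ x ∂P, 0 < x) {K : ℝ} (hK : 0 ≤ K) :
    Integrable (fun x => min x K) P := by
  simpa using integrable_min_pow hpos hK 1

lemma integral_sub_min_nonneg (hint : Integrable (fun x => x ^ 2) P) (hpos : ∀ᵐ x ∂P, 0 < x)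
    {K : ℝ} (hK : 0 ≤ K) : 0 ≤ ∫ x, x ∂P - ∫ x, min x K ∂P := by
  rw [← integral_sub (integrable_of_sq hint) (integrable_min hpos hK)]
  exact integral_nonneg fun x => sub_nonneg.2 (min_le_left _ _)

lemma integral_sub_min_le (hint : Integrable (fun x => x ^ 2) P) (hpos : ∀ᵐ x ∂P, 0 < x)
    {K : ℝ} (hK : 0 < K) : ∫ x, x ∂P - ∫ x, min x K ∂P ≤ K⁻¹ * sqTail P K := by
  rw [← integral_sub (integrable_of_sq hint) (integrable_min hpos hK.le)]
  have := integral_le_const_add_sqTail hint (f := fun x => x - min x K) (c := 0) (d := K⁻¹) (K := K)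
    (by
      filter_upwards [hpos] with x hx
      by_cases h : K < x
      · rw [Set.indicator_of_mem (Set.mem_Ioi.2 h), min_eq_right h.le, zero_add, inv_mul_eq_div,
          le_div_iff₀ hK]
        nlinarith
      · rw [min_eq_left (not_lt.1 h), Set.indicator_of_notMem (by simpa using h)]
        simp) ((integrable_of_sq hint).sub (integrable_min hpos hK.le))
  linarith

lemma integral_sq_sub_min_sq_le (hint : Integrable (fun x => x ^ 2) P) (hpos : ∀ᵐ x ∂P, 0 < x)
    {K : ℝ} (hK : 0 ≤ K) : ∫ x, x ^ 2 ∂P - ∫ x, min x K ^ 2 ∂P ≤ sqTail P K := by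
  rw [← integral_sub hint (integrable_min_pow hpos hK 2)]
  have := integral_le_const_add_sqTail hint (f := fun x => x ^ 2 - min x K ^ 2) (c := 0) (d := 1)
    (K := K) (ae_of_all _ fun x => by
      by_cases h : K < x
      · rw [Set.indicator_of_mem (Set.mem_Ioi.2 h), min_eq_right h.le]
        nlinarith
      · rw [min_eq_left (not_lt.1 h), Set.indicator_of_notMem (by simpa using h)]
        simp) (hint.sub (integrable_min_pow hpos hK 2))
  linarith

lemma integral_min_sq_le (hint : Integrable (fun x => x ^ 2) P) (hpos : ∀ᵐ x ∂P, 0 < x)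
    {K : ℝ} (hK : 0 ≤ K) : ∫ x, min x K ^ 2 ∂P ≤ ∫ x, x ^ 2 ∂P := by
  refine integral_mono_ae (integrable_min_pow hpos hK 2) hint ?_
  filter_upwards [hpos] with x hx
  exact pow_le_pow_left₀ (le_min hx.le hK) (min_le_left _ _) 2

lemma integral_min_sq_sub_le (hint : Integrable (fun x => x ^ 2) P) (hpos : ∀ᵐ x ∂P, 0 < x)
    {K M : ℝ} (hK : 0 ≤ K) (hM : K ≤ M) :
    ∫ x, min x M ^ 2 ∂P - ∫ x, min x K ^ 2 ∂P ≤ sqTail P K := by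
  linarith [integral_sq_sub_min_sq_le hint hpos hK, integral_min_sq_le hint hpos (hK.trans hM)]

lemma integral_min_sub_le (hint : Integrable (fun x => x ^ 2) P) (hpos : ∀ᵐ x ∂P, 0 < x)
    {K M : ℝ} (hK : 0 < K) (hM : K ≤ M) :
    ∫ x, min x M ∂P - ∫ x, min x K ∂P ≤ K⁻¹ * sqTail P K := by
  linarith [integral_sub_min_le hint hpos hK, integral_sub_min_nonneg hint hpos (hK.le.trans hM)]

/-- The cube is at most `K ^ 3` below `K`, and at most `M * x ^ 2` above. For `M = 1/r` this makes
`r` times the truncated third moment tend to `0`, although the third moment itself may be infinite.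
-/
lemma integral_min_cube_le (hint : Integrable (fun x => x ^ 2) P) (hpos : ∀ᵐ x ∂P, 0 < x)
    {K M : ℝ} (hK : 0 ≤ K) (hM : 0 ≤ M) :
    ∫ x, min x M ^ 3 ∂P ≤ K ^ 3 + M * sqTail P K := by
  refine integral_le_const_add_sqTail hint ?_ (integrable_min_pow hpos hM 3)
  filter_upwards [hpos] with x hx
  have h0 := le_min hx.le hM
  by_cases h : K < x
  · rw [Set.indicator_of_mem (Set.mem_Ioi.2 h)]
    have h1 : min x M ^ 2 ≤ x ^ 2 := pow_le_pow_left₀ h0 (min_le_left _ _) 2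
    have h2 : min x M ^ 3 ≤ M * x ^ 2 := by
      rw [pow_succ, mul_comm]
      exact mul_le_mul (min_le_right _ _) h1 (sq_nonneg _) hM
    nlinarith [pow_nonneg hK 3]
  · rw [Set.indicator_of_notMem (by simpa using h)]
    have := pow_le_pow_left₀ h0 ((min_le_left x M).trans (not_lt.1 h)) 3
    simpa using this

end SingleLaw

lemma lawMean_pos {P : ProbabilityMeasure ℝ} (hint : Integrable (fun x => x ^ 2) (P : Measure ℝ))
    (hpos : ∀ᵐ x ∂(P : Measure ℝ), 0 < x) : 0 < lawMean P := by
  rw [lawMean, integral_pos_iff_support_of_nonneg_ae]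
  · rw [pos_iff_ne_zero]
    intro h0
    have h1 : ∀ᵐ x ∂(P : Measure ℝ), x = 0 := by
      rw [ae_iff]; exact h0
    obtain ⟨x, hx, hx'⟩ := (h1.and hpos).exists
    exact hx'.ne' hx
  · filter_upwards [hpos] with x hx using hx.le
  · exact integrable_of_sq hint

namespace SqUniformlyIntegrable

variable {R : Set ℝ} {P : ℝ → ProbabilityMeasure ℝ}

lemma exists_lintegral_le (h : SqUniformlyIntegrable R P) {ε : ℝ} (hε : 0 < ε) : ∃ K : ℝ, 1 ≤ K ∧
    ∀ r ∈ R, ∫⁻ x in Set.Ioi K, ENNReal.ofReal (x ^ 2) ∂(P r : Measure ℝ) ≤ ENNReal.ofReal ε := by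
  obtain ⟨K, hK⟩ := h ε hε
  -- Uniform integrability cuts at `K < x ^ 2`. Above `max K 1` one has `x ^ 2 ≥ x > K`, so a cut in
  -- `x` itself is enough.
  refine ⟨max K 1, le_max_right _ _, fun r hr => (lintegral_mono_set fun x hx => ?_).trans (hK r hr)⟩
  have hx' : max K 1 < x := hx
  have h1 : K < x := (le_max_left _ _).trans_lt hx'
  have h2 : 1 < x := (le_max_right _ _).trans_lt hx'
  simp only [Set.mem_ofPred_eq]
  nlinarith

/-- Without integrability the Bochner integrals in `lawMean` and `lawStd` would have the default
value `0`; here it is extracted from uniform integrability. -/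
lemma integrable_sq (h : SqUniformlyIntegrable R P) {r : ℝ}
    (hpos : ∀ᵐ x ∂(P r : Measure ℝ), 0 < x) (hr : r ∈ R) :
    Integrable (fun x : ℝ => x ^ 2) (P r : Measure ℝ) := by
  obtain ⟨K, hK1, hK⟩ := h.exists_lintegral_le one_pos
  have h1 : IntegrableOn (fun x : ℝ => x ^ 2) (Set.Ioi K) (P r : Measure ℝ) := by
    refine ⟨by fun_prop, ?_⟩
    rw [hasFiniteIntegral_iff_ofReal (ae_of_all _ fun x => sq_nonneg x)]
    exact (hK r hr).trans_lt ENNReal.ofReal_lt_top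
  have h2 : IntegrableOn (fun x : ℝ => x ^ 2) (Set.Iic K) (P r : Measure ℝ) := by
    refine FiniteQueue.integrable_of_ae_bound (by fun_prop) (C := K ^ 2) ?_
    filter_upwards [ae_restrict_of_ae hpos, ae_restrict_mem measurableSet_Iic] with x hx hx'
    rw [abs_of_nonneg (sq_nonneg x)]
    exact pow_le_pow_left₀ hx.le hx' 2
  rw [← integrableOn_univ, ← Set.Iic_union_Ioi (a := K)]
  exact h2.union h1

end SqUniformlyIntegrable

/-- Laws of positive times, indexed by `r ∈ R`, with uniformly integrable squares and convergent
means and standard deviations as `r ↓ 0`. -/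
structure IsTimeFamily (R : Set ℝ) (P : ℝ → ProbabilityMeasure ℝ) (m σ : ℝ) : Prop where
  subset : R ⊆ Set.Ioc 0 1
  pos : ∀ r, ∀ᵐ x ∂(P r : Measure ℝ), 0 < x
  uniformlyIntegrable : SqUniformlyIntegrable R P
  mean_pos : 0 < m
  tendsto_mean : Tendsto (fun r => lawMean (P r)) (𝓝[R] 0) (𝓝 m)
  tendsto_std : Tendsto (fun r => lawStd (P r)) (𝓝[R] 0) (𝓝 σ)

namespace IsTimeFamily

variable {R : Set ℝ} {P : ℝ → ProbabilityMeasure ℝ} {m σ : ℝ}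

lemma integrable_sq (h : IsTimeFamily R P m σ) {r : ℝ} (hr : r ∈ R) :
    Integrable (fun x : ℝ => x ^ 2) (P r : Measure ℝ) :=
  h.uniformlyIntegrable.integrable_sq (h.pos r) hr

lemma exists_sqTail_le (h : IsTimeFamily R P m σ) {ε : ℝ} (hε : 0 < ε) : ∃ K₀ : ℝ, 1 ≤ K₀ ∧
    ∀ K, K₀ ≤ K → ∀ r ∈ R, sqTail (P r : Measure ℝ) K ≤ ε := by
  obtain ⟨K, hK1, hK⟩ := h.uniformlyIntegrable.exists_lintegral_le hε
  refine ⟨K, hK1, fun K' hK' r hr => (sqTail_anti (h.integrable_sq hr) hK').trans ?_⟩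
  rw [sqTail, integral_eq_lintegral_of_nonneg_ae (ae_of_all _ fun x => sq_nonneg x) (by fun_prop)]
  exact ENNReal.toReal_le_of_le_ofReal hε.le (hK r hr)

lemma eventually_mem (R : Set ℝ) : ∀ᶠ r in 𝓝[R] (0 : ℝ), r ∈ R := self_mem_nhdsWithin

lemma tendsto_self (R : Set ℝ) : Tendsto (fun r : ℝ => r) (𝓝[R] 0) (𝓝 0) :=
  tendsto_nhdsWithin_of_tendsto_nhds tendsto_id

lemma eventually_le_inv (h : IsTimeFamily R P m σ) (K : ℝ) : ∀ᶠ r in 𝓝[R] (0 : ℝ), K ≤ r⁻¹ := by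
  have h1 : ∀ᶠ r in 𝓝[R] (0 : ℝ), |K| * r < 1 := by
    have : Tendsto (fun r : ℝ => |K| * r) (𝓝[R] 0) (𝓝 (|K| * 0)) := (tendsto_self R).const_mul _
    rw [mul_zero] at this
    exact this.eventually_lt_const one_pos
  filter_upwards [h1, eventually_mem R] with r hr hrR
  have hr0 := (h.subset hrR).1
  refine (le_abs_self K).trans ?_
  rw [← one_div, le_div_iff₀ hr0]
  exact hr.le

lemma tendsto_sqTail (h : IsTimeFamily R P m σ) :
    Tendsto (fun r => sqTail (P r : Measure ℝ) r⁻¹) (𝓝[R] 0) (𝓝 0) := by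
  rw [Metric.tendsto_nhds]
  intro ε hε
  obtain ⟨K, hK1, hK⟩ := h.exists_sqTail_le (half_pos hε)
  filter_upwards [h.eventually_le_inv K, eventually_mem R] with r hr hrR
  rw [Real.dist_eq, sub_zero, abs_of_nonneg (sqTail_nonneg _ _)]
  linarith [hK _ hr r hrR]

lemma tendsto_sq (h : IsTimeFamily R P m σ) :
    Tendsto (fun r => ∫ x, x ^ 2 ∂(P r : Measure ℝ)) (𝓝[R] 0) (𝓝 (σ ^ 2 + m ^ 2)) := by
  refine ((h.tendsto_std.pow 2).add (h.tendsto_mean.pow 2)).congr' ?_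
  filter_upwards [eventually_mem R] with r hr
  have hi := h.integrable_sq hr
  have h1 := integrable_of_sq hi
  rw [lawStd, Real.sq_sqrt (integral_nonneg fun x => sq_nonneg _)]
  have e : ∀ x : ℝ, (x - lawMean (P r)) ^ 2
      = x ^ 2 - 2 * lawMean (P r) * x + lawMean (P r) ^ 2 := fun x => by ring
  simp_rw [e]
  have h2 : Integrable (fun x : ℝ => x ^ 2 - 2 * lawMean (P r) * x) (P r : Measure ℝ) :=
    hi.sub (h1.const_mul _)
  rw [integral_add h2 (integrable_const _), integral_sub hi (h1.const_mul _), integral_const_mul]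
  simp only [integral_const, probReal_univ, one_smul]
  change _ - 2 * lawMean (P r) * lawMean (P r) + _ + _ = _
  ring

lemma tendsto_min_sq (h : IsTimeFamily R P m σ) :
    Tendsto (fun r => ∫ x, min x r⁻¹ ^ 2 ∂(P r : Measure ℝ)) (𝓝[R] 0) (𝓝 (σ ^ 2 + m ^ 2)) := by
  have h1 := h.tendsto_sq.sub h.tendsto_sqTail
  rw [sub_zero] at h1
  refine tendsto_of_tendsto_of_tendsto_of_le_of_le' h1 h.tendsto_sq ?_ ?_
  · filter_upwards [eventually_mem R] with r hr
    linarith [integral_sq_sub_min_sq_le (h.integrable_sq hr) (h.pos r)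
      (inv_nonneg.2 (h.subset hr).1.le)]
  · filter_upwards [eventually_mem R] with r hr
    exact integral_min_sq_le (h.integrable_sq hr) (h.pos r) (inv_nonneg.2 (h.subset hr).1.le)

/-- Truncation at `1/r` lowers the mean by at most `r` times the second-moment tail, hence by
`o(r)`. This is the precision needed, since means enter multiplied by exponents of order `r`. -/
lemma tendsto_sub_min_div (h : IsTimeFamily R P m σ) :
    Tendsto (fun r => (lawMean (P r) - ∫ x, min x r⁻¹ ∂(P r : Measure ℝ)) / r) (𝓝[R] 0) (𝓝 0) := by
  refine tendsto_of_tendsto_of_tendsto_of_le_of_le' tendsto_const_nhds h.tendsto_sqTail ?_ ?_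
  · filter_upwards [eventually_mem R] with r hr
    exact div_nonneg (integral_sub_min_nonneg (h.integrable_sq hr) (h.pos r)
      (inv_nonneg.2 (h.subset hr).1.le)) (h.subset hr).1.le
  · filter_upwards [eventually_mem R] with r hr
    have hr0 := (h.subset hr).1
    have := integral_sub_min_le (h.integrable_sq hr) (h.pos r) (inv_pos.2 hr0)
    rw [inv_inv] at this
    rw [div_le_iff₀ hr0, mul_comm]
    exact this

lemma tendsto_mul_min_cube (h : IsTimeFamily R P m σ) :
    Tendsto (fun r => r * ∫ x, min x r⁻¹ ^ 3 ∂(P r : Measure ℝ)) (𝓝[R] 0) (𝓝 0) := by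
  rw [Metric.tendsto_nhds]
  intro ε hε
  obtain ⟨K, hK1, hK⟩ := h.exists_sqTail_le (half_pos hε)
  have h1 : ∀ᶠ r in 𝓝[R] (0 : ℝ), r * K ^ 3 < ε / 2 := by
    have : Tendsto (fun r : ℝ => r * K ^ 3) (𝓝[R] 0) (𝓝 (0 * K ^ 3)) := (tendsto_self R).mul_const _
    rw [zero_mul] at this
    exact this.eventually_lt_const (half_pos hε)
  filter_upwards [h1, eventually_mem R] with r hr hrR
  have hr0 := (h.subset hrR).1
  have hM := inv_nonneg.2 hr0.le
  have h2 := integral_min_cube_le (h.integrable_sq hrR) (h.pos r) (K := K) (by linarith) hM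
  have h3 : 0 ≤ ∫ x, min x r⁻¹ ^ 3 ∂(P r : Measure ℝ) := integral_nonneg_of_ae (by
    filter_upwards [h.pos r] with x hx
    exact pow_nonneg (le_min hx.le hM) 3)
  rw [Real.dist_eq, sub_zero, abs_of_nonneg (mul_nonneg hr0.le h3)]
  have h4 := mul_le_mul_of_nonneg_left h2 hr0.le
  rw [mul_add, ← mul_assoc, mul_inv_cancel₀ hr0.ne', one_mul] at h4
  linarith [hK K le_rfl r hrR]

end IsTimeFamily

/-! ### Choice of the exponents and expansion of the Laplace transforms. -/

lemma abs_exp_neg_sub_quadratic_le {y C : ℝ} (hy : |y| ≤ C) :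
    |Real.exp (-y) - (1 - y + y ^ 2 / 2)| ≤ Real.exp C * |y| ^ 3 := by
  have h := Complex.norm_exp_sub_sum_le_norm_mul_exp (-y : ℂ) 3
  have e : Complex.exp (-y : ℂ) - ∑ i ∈ Finset.range 3, (-y : ℂ) ^ i / (i.factorial : ℂ)
      = ((Real.exp (-y) - (1 - y + y ^ 2 / 2) : ℝ) : ℂ) := by
    simp [Finset.sum_range_succ, Nat.factorial]
    ring
  rw [e, Complex.norm_real, norm_neg, Complex.norm_real, Real.norm_eq_abs, Real.norm_eq_abs] at h
  refine h.trans ?_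
  rw [mul_comm]
  exact mul_le_mul_of_nonneg_right (Real.exp_le_exp.2 hy) (by positivity)

namespace IsTimeFamily

variable {R : Set ℝ} {P : ℝ → ProbabilityMeasure ℝ} {m σ : ℝ}

/-- Exponent for which the truncated time has Laplace transform `exp (-s r)`, up to `o(r²)`. -/
noncomputable def exponent (P : ℝ → ProbabilityMeasure ℝ) (m σ s r : ℝ) : ℝ :=
  s * r * (lawMean (P r))⁻¹ + s ^ 2 * σ ^ 2 / (2 * m ^ 3) * r ^ 2

lemma tendsto_exponent_div (h : IsTimeFamily R P m σ) (s : ℝ) :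
    Tendsto (fun r => exponent P m σ s r / r) (𝓝[R] 0) (𝓝 (s * m⁻¹)) := by
  have h1 : Tendsto (fun r => s * (lawMean (P r))⁻¹ + s ^ 2 * σ ^ 2 / (2 * m ^ 3) * r) (𝓝[R] 0)
      (𝓝 (s * m⁻¹ + s ^ 2 * σ ^ 2 / (2 * m ^ 3) * 0)) :=
    ((h.tendsto_mean.inv₀ h.mean_pos.ne').const_mul s).add ((tendsto_self R).const_mul _)
  rw [mul_zero, add_zero] at h1
  refine h1.congr' ?_
  filter_upwards [eventually_mem R] with r hr
  have hr0 := (h.subset hr).1.ne'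
  unfold exponent
  field_simp

/-- Laplace transform of the truncated time at `exponent`. -/
noncomputable def laplace (P : ℝ → ProbabilityMeasure ℝ) (m σ s r : ℝ) : ℝ :=
  ∫ x, Real.exp (-(exponent P m σ s r * min x r⁻¹)) ∂(P r : Measure ℝ)

/-- The exponent `η` solves the cumulant equation `η * mean - η ^ 2 * σ ^ 2 / 2 = s * r` up to
`o(r²)`. Its leading term uses the mean at `r` and not the limit `m`, because no rate is assumed for
the convergence of the individual means. As a result the transform agrees with `exp (-s * r)` to
second order. -/
lemma tendsto_laplace_second_order (h : IsTimeFamily R P m σ) (s : ℝ) :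
    Tendsto (fun r => ((laplace P m σ s r - 1) / r + s) / r) (𝓝[R] 0) (𝓝 (s ^ 2 / 2)) := by
  set η := exponent P m σ s with hη
  have hηr := h.tendsto_exponent_div s
  -- As `η r` is of order `r` and times are cut at `1/r`, the argument of the exponential is at most
  -- `D` in absolute value, uniformly in `r`; the cubic Taylor bound then reduces the remainder to
  -- the truncated third moment.
  set D := |s * m⁻¹| + 1 with hD
  have hbound : ∀ᶠ r in 𝓝[R] (0 : ℝ), |η r / r| ≤ D :=
    (hηr.abs.eventually_le_const (by linarith))
  -- remainder
  have hrem : Tendsto (fun r => (laplace P m σ s r - (1 - η r * ∫ x, min x r⁻¹ ∂(P r : Measure ℝ)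
      + η r ^ 2 / 2 * ∫ x, min x r⁻¹ ^ 2 ∂(P r : Measure ℝ))) / r ^ 2) (𝓝[R] 0) (𝓝 0) := by
    have h0 : Tendsto (fun r => Real.exp D * D ^ 3 *
        (r * ∫ x, min x r⁻¹ ^ 3 ∂(P r : Measure ℝ))) (𝓝[R] 0) (𝓝 0) := by
      simpa using h.tendsto_mul_min_cube.const_mul (Real.exp D * D ^ 3)
    refine squeeze_zero_norm' ?_ h0
    filter_upwards [hbound, eventually_mem R] with r hb hr
    have hr0 := (h.subset hr).1
    have hM := inv_nonneg.2 hr0.le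
    have hpos := h.pos r
    have i1 := integrable_min hpos hM
    have i2 := integrable_min_pow hpos hM 2
    have i3 := integrable_min_pow hpos hM 3
    have hηD : |η r| ≤ D * r := by
      rw [abs_div, abs_of_pos hr0, div_le_iff₀ hr0] at hb
      exact hb
    have hy : ∀ x : ℝ, 0 < x → |η r * min x r⁻¹| ≤ D := fun x hx => by
      rw [abs_mul, abs_of_nonneg (le_min hx.le hM)]
      calc |η r| * min x r⁻¹ ≤ D * r * r⁻¹ :=
            mul_le_mul hηD (min_le_right _ _) (le_min hx.le hM) (by positivity)
        _ = D := by field_simp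
    have ie : Integrable (fun x => Real.exp (-(η r * min x r⁻¹))) (P r : Measure ℝ) := by
      refine FiniteQueue.integrable_of_ae_bound (by fun_prop) (C := Real.exp D) ?_
      filter_upwards [hpos] with x hx
      rw [abs_of_pos (Real.exp_pos _)]
      exact Real.exp_le_exp.2 ((neg_le_abs _).trans (hy x hx))
    have e : laplace P m σ s r - (1 - η r * ∫ x, min x r⁻¹ ∂(P r : Measure ℝ)
        + η r ^ 2 / 2 * ∫ x, min x r⁻¹ ^ 2 ∂(P r : Measure ℝ))
        = ∫ x, (Real.exp (-(η r * min x r⁻¹)) - (1 - η r * min x r⁻¹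
          + η r ^ 2 / 2 * min x r⁻¹ ^ 2)) ∂(P r : Measure ℝ) := by
      have j1 : Integrable (fun x => 1 - η r * min x r⁻¹) (P r : Measure ℝ) :=
        (integrable_const 1).sub (i1.const_mul _)
      have j2 : Integrable (fun x => 1 - η r * min x r⁻¹ + η r ^ 2 / 2 * min x r⁻¹ ^ 2)
        (P r : Measure ℝ) := j1.add (i2.const_mul _)
      rw [integral_sub ie j2, integral_add j1 (i2.const_mul _),
        integral_sub (integrable_const 1) (i1.const_mul _), integral_const_mul, integral_const_mul]
      simp [laplace, hη]
    rw [e, Real.norm_eq_abs, abs_div, abs_of_pos (pow_pos hr0 2), div_le_iff₀ (pow_pos hr0 2)]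
    have hle : |∫ x, (Real.exp (-(η r * min x r⁻¹)) - (1 - η r * min x r⁻¹
          + η r ^ 2 / 2 * min x r⁻¹ ^ 2)) ∂(P r : Measure ℝ)|
        ≤ ∫ x, Real.exp D * (D * r) ^ 3 * min x r⁻¹ ^ 3 ∂(P r : Measure ℝ) := by
      rw [← Real.norm_eq_abs]
      refine norm_integral_le_of_norm_le (i3.const_mul _) ?_
      filter_upwards [hpos] with x hx
      have h1 := abs_exp_neg_sub_quadratic_le (hy x hx)
      rw [mul_pow, mul_div_right_comm] at h1
      refine h1.trans ?_
      rw [abs_mul, abs_of_nonneg (le_min hx.le hM), mul_pow, ← mul_assoc]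
      have := pow_le_pow_left₀ (abs_nonneg _) hηD 3
      gcongr
    rw [integral_const_mul] at hle
    calc _ ≤ _ := hle
      _ = _ := by ring
  have hlim := (((h.tendsto_sub_min_div.mul hηr).add
    (((hηr.pow 2).div_const 2).mul h.tendsto_min_sq)).add hrem).sub
    (h.tendsto_mean.const_mul (s ^ 2 * σ ^ 2 / (2 * m ^ 3)))
  have hm := h.mean_pos.ne'
  -- Here the variance cancels: the `σ ^ 2` of the second moment is compensated by the quadratic
  -- correction in the exponent.
  have hval : 0 * (s * m⁻¹) + (s * m⁻¹) ^ 2 / 2 * (σ ^ 2 + m ^ 2) + 0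
      - s ^ 2 * σ ^ 2 / (2 * m ^ 3) * m = s ^ 2 / 2 := by field_simp; ring
  rw [hval] at hlim
  refine hlim.congr' ?_
  filter_upwards [eventually_mem R, h.tendsto_mean.eventually_ne hm] with r hr hmr
  have hr0 := (h.subset hr).1.ne'
  have e : η r * lawMean (P r) = s * r + s ^ 2 * σ ^ 2 / (2 * m ^ 3) * r ^ 2 * lawMean (P r) := by
    simp only [hη, exponent]
    field_simp
  change (lawMean (P r) - ∫ x, min x r⁻¹ ∂(P r : Measure ℝ)) / r * (η r / r) + (η r / r) ^ 2 / 2 * _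
    + _ - _ = _
  have e' : s ^ 2 * σ ^ 2 / (2 * m ^ 3) * lawMean (P r)
      = (η r * lawMean (P r) - s * r) / r ^ 2 := by
    rw [e]; field_simp; ring
  rw [e']
  field_simp
  ring

lemma tendsto_laplace_first_order (h : IsTimeFamily R P m σ) (s : ℝ) :
    Tendsto (fun r => (laplace P m σ s r - 1) / r) (𝓝[R] 0) (𝓝 (-s)) := by
  have h1 := ((h.tendsto_laplace_second_order s).mul (tendsto_self R)).sub_const s
  rw [mul_zero, zero_sub] at h1
  refine h1.congr' ?_
  filter_upwards [eventually_mem R] with r hr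
  have hr0 := (h.subset hr).1.ne'
  field_simp
  ring

lemma tendsto_exp_second_order (h : IsTimeFamily R P m σ) (s : ℝ) :
    Tendsto (fun r => ((Real.exp (s * r) - 1) / r - s) / r) (𝓝[R] 0) (𝓝 (s ^ 2 / 2)) := by
  have h0 : Tendsto (fun r : ℝ => Real.exp |s| * |s| ^ 3 * r) (𝓝[R] 0) (𝓝 0) := by
    simpa using (tendsto_self R).const_mul (Real.exp |s| * |s| ^ 3)
  rw [tendsto_iff_norm_sub_tendsto_zero]
  refine squeeze_zero' (Eventually.of_forall fun _ => norm_nonneg _) ?_ h0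
  filter_upwards [eventually_mem R] with r hr
  have hr0 := (h.subset hr).1
  have hle : |-(s * r)| ≤ |s| := by
    rw [abs_neg, abs_mul, abs_of_pos hr0]
    exact mul_le_of_le_one_right (abs_nonneg _) (h.subset hr).2
  have h1 := abs_exp_neg_sub_quadratic_le hle
  rw [neg_neg] at h1
  have e : ((Real.exp (s * r) - 1) / r - s) / r - s ^ 2 / 2
      = (Real.exp (s * r) - (1 - -(s * r) + (-(s * r)) ^ 2 / 2)) / r ^ 2 := by
    field_simp
    ring
  rw [e, Real.norm_eq_abs, abs_div, abs_of_pos (pow_pos hr0 2), div_le_iff₀ (pow_pos hr0 2)]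
  refine h1.trans_eq ?_
  rw [abs_neg, abs_mul, abs_of_pos hr0]
  ring

/-- The property for which the exponents were designed: moving the queue by one customer and
renewing the corresponding clock leave the exponential test function unchanged in the mean, up to
`o(r²)`. -/
lemma tendsto_exp_mul_laplace (h : IsTimeFamily R P m σ) (s : ℝ) :
    Tendsto (fun r => (Real.exp (s * r) * laplace P m σ s r - 1) / r ^ 2) (𝓝[R] 0) (𝓝 0) := by
  have hp := h.tendsto_exp_second_order s
  have hq := h.tendsto_laplace_second_order s
  have hr' := tendsto_self R
  have hlim := ((((hp.add hq).sub_const (s ^ 2)).add ((hr'.const_mul s).mul hq)).sub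
    ((hr'.const_mul s).mul hp)).add ((hr'.pow 2).mul (hp.mul hq))
  have hval : s ^ 2 / 2 + s ^ 2 / 2 - s ^ 2 + s * 0 * (s ^ 2 / 2) - s * 0 * (s ^ 2 / 2)
      + 0 ^ 2 * (s ^ 2 / 2 * (s ^ 2 / 2)) = 0 := by ring
  rw [hval] at hlim
  refine hlim.congr' ?_
  filter_upwards [eventually_mem R] with r hr
  have hr0 := (h.subset hr).1.ne'
  field_simp
  ring

end IsTimeFamily

/-! ### Product test functions. -/

namespace FiniteQueue

/-- A continuous function that is bounded on `[0, ∞)`, together with its left derivative. -/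
structure IsProfile (k k' : ℝ → ℝ) : Prop where
  continuous : Continuous k
  measurable_deriv : Measurable k'
  bound : ∃ C, ∀ a, 0 ≤ a → |k a| ≤ C ∧ |k' a| ≤ C
  hasDeriv : ∀ a, HasDerivWithinAt k (k' a) (Set.Iic a) a

namespace IsProfile

lemma const (c : ℝ) : IsProfile (fun _ => c) (fun _ => 0) where
  continuous := continuous_const
  measurable_deriv := measurable_const
  bound := ⟨|c|, fun a _ => by simp⟩
  hasDeriv a := hasDerivWithinAt_const _ _ _

lemma sub {k k' h h' : ℝ → ℝ} (hk : IsProfile k k') (hh : IsProfile h h') :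
    IsProfile (fun a => k a - h a) (fun a => k' a - h' a) where
  continuous := hk.continuous.sub hh.continuous
  measurable_deriv := hk.measurable_deriv.sub hh.measurable_deriv
  bound := by
    obtain ⟨C, hC⟩ := hk.bound
    obtain ⟨D, hD⟩ := hh.bound
    exact ⟨C + D, fun a ha => ⟨(abs_sub _ _).trans (add_le_add (hC a ha).1 (hD a ha).1),
      (abs_sub _ _).trans (add_le_add (hC a ha).2 (hD a ha).2)⟩⟩
  hasDeriv a := (hk.hasDeriv a).sub (hh.hasDeriv a)

/-- Truncation creates a kink at `M`, where only the one-sided derivative is prescribed; approached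
from the left it is that of `κ`, hence the non-strict inequality in `a ≤ M`. -/
lemma comp_min {κ κ' : ℝ → ℝ} (hκ : ∀ x, HasDerivAt κ (κ' x) x) (hκ' : Continuous κ') {M : ℝ}
    (hM : 0 ≤ M) : IsProfile (fun a => κ (min a M)) (fun a => if a ≤ M then κ' a else 0) where
  continuous := (continuous_iff_continuousAt.2 fun x => (hκ x).continuousAt).comp (by fun_prop)
  measurable_deriv := Measurable.ite measurableSet_Iic hκ'.measurable measurable_const
  bound := by
    have hc : Continuous κ := continuous_iff_continuousAt.2 fun x => (hκ x).continuousAt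
    obtain ⟨C, hC⟩ := (isCompact_Icc (a := (0 : ℝ)) (b := M)).exists_bound_of_continuousOn
      hc.continuousOn
    obtain ⟨D, hD⟩ := (isCompact_Icc (a := (0 : ℝ)) (b := M)).exists_bound_of_continuousOn
      hκ'.continuousOn
    have hD0 : 0 ≤ D := (norm_nonneg _).trans (hD 0 ⟨le_rfl, hM⟩)
    refine ⟨max C D, fun a ha => ⟨(hC _ ⟨le_min ha hM, min_le_right _ _⟩).trans
      (le_max_left _ _), ?_⟩⟩
    split_ifs with h
    · exact (hD _ ⟨ha, h⟩).trans (le_max_right _ _)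
    · simpa using Or.inr hD0
  hasDeriv a := by
    split_ifs with h
    · refine (hκ a).hasDerivWithinAt.congr (fun x hx => ?_) (by rw [min_eq_left h])
      rw [min_eq_left (le_trans hx h)]
    · refine HasDerivAt.hasDerivWithinAt ((hasDerivAt_const a (κ M)).congr_of_eventuallyEq ?_)
      filter_upwards [Ioi_mem_nhds (not_le.1 h)] with x hx
      rw [min_eq_right (le_of_lt hx)]

lemma min {M : ℝ} (hM : 0 ≤ M) :
    IsProfile (fun a => min a M) (fun a => if a ≤ M then 1 else 0) :=
  comp_min (κ := fun x => x) (fun x => hasDerivAt_id x) continuous_const hM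

lemma min_sq {M : ℝ} (hM : 0 ≤ M) :
    IsProfile (fun a => Min.min a M ^ 2 / 2) (fun a => if a ≤ M then a else 0) :=
  comp_min (κ := fun x => x ^ 2 / 2) (κ' := fun x => x)
    (fun x => by simpa using (hasDerivAt_pow 2 x).div_const 2) continuous_id hM

lemma exp_min (η : ℝ) {M : ℝ} (hM : 0 ≤ M) :
    IsProfile (fun a => Real.exp (-(η * Min.min a M)))
      (fun a => if a ≤ M then -η * Real.exp (-(η * a)) else 0) :=
  comp_min (κ := fun x => Real.exp (-(η * x))) (κ' := fun x => -η * Real.exp (-(η * x)))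
    (fun x => by
      have := ((hasDerivAt_id x).const_mul η).neg.exp
      simpa [mul_comm] using this) (by fun_prop) hM

end IsProfile

/-- Product test function. -/
def prodTest (c : ℕ → ℝ) (k h : ℝ → ℝ) (x : QState) : ℝ := c x.1 * (k x.2.1 * h x.2.2)

/-- Derivative of the product test function along the drift. -/
noncomputable def prodDeriv (c : ℕ → ℝ) (k k' h h' : ℝ → ℝ) (x : QState) : ℝ :=
  -(c x.1 * (k' x.2.1 * h x.2.2 + if x.1 = 0 then 0 else k x.2.1 * h' x.2.2))

lemma isTestPair_prod (ℓ : ℕ) (c : ℕ → ℝ) {k k' h h' : ℝ → ℝ} (hk : IsProfile k k')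
    (hh : IsProfile h h') : IsTestPair ℓ (prodTest c k h) (prodDeriv c k k' h h') where
  measurable_fun := by
    have h1 : Measurable fun x : QState => c x.1 := (measurable_of_countable c).comp measurable_fst
    have h2 : Measurable fun x : QState => k x.2.1 := hk.continuous.measurable.comp (by fun_prop)
    have h3 : Measurable fun x : QState => h x.2.2 := hh.continuous.measurable.comp (by fun_prop)
    exact h1.mul (h2.mul h3)
  measurable_deriv := by
    have h1 : Measurable fun x : QState => c x.1 := (measurable_of_countable c).comp measurable_fst
    have h2 : Measurable fun x : QState => k x.2.1 := hk.continuous.measurable.comp (by fun_prop)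
    have h3 : Measurable fun x : QState => h x.2.2 := hh.continuous.measurable.comp (by fun_prop)
    have h4 : Measurable fun x : QState => k' x.2.1 := hk.measurable_deriv.comp (by fun_prop)
    have h5 : Measurable fun x : QState => h' x.2.2 := hh.measurable_deriv.comp (by fun_prop)
    exact (h1.mul ((h4.mul h3).add
      (Measurable.ite measurableSet_empty measurable_const (h2.mul h5)))).neg
  bound := by
    obtain ⟨C, hC⟩ := hk.bound
    obtain ⟨D, hD⟩ := hh.bound
    have hC0 : 0 ≤ C := (abs_nonneg _).trans (hC 0 le_rfl).1
    have hD0 : 0 ≤ D := (abs_nonneg _).trans (hD 0 le_rfl).1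
    set B := ∑ i ∈ Finset.range (ℓ + 1), |c i|
    have hB : ∀ i, i ≤ ℓ → |c i| ≤ B := fun i hi =>
      Finset.single_le_sum (f := fun i => |c i|) (fun i _ => abs_nonneg _)
        (Finset.mem_range.2 (Nat.lt_succ_of_le hi))
    have hB0 : 0 ≤ B := (abs_nonneg _).trans (hB 0 (Nat.zero_le _))
    refine ⟨B * (C * D + C * D), fun x hx => ⟨?_, ?_⟩⟩
    · rw [prodTest, abs_mul, abs_mul]
      have := mul_le_mul (hC _ hx.2.1).1 (hD _ hx.2.2).1 (abs_nonneg _) hC0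
      exact mul_le_mul (hB _ hx.1) (this.trans (by nlinarith [mul_nonneg hC0 hD0])) (by positivity)
        hB0
    · rw [prodDeriv, abs_neg, abs_mul]
      refine mul_le_mul (hB _ hx.1) ((abs_add_le _ _).trans (add_le_add ?_ ?_)) (by positivity) hB0
      · rw [abs_mul]
        exact mul_le_mul (hC _ hx.2.1).2 (hD _ hx.2.2).1 (abs_nonneg _) hC0
      · split_ifs
        · rw [abs_zero]; positivity
        · rw [abs_mul]
          exact mul_le_mul (hC _ hx.2.1).1 (hD _ hx.2.2).2 (abs_nonneg _) hC0
  integral_eq x hx u hu0 hu := by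
    obtain ⟨C, hC⟩ := hk.bound
    obtain ⟨D, hD⟩ := hh.bound
    have hC0 : 0 ≤ C := (abs_nonneg _).trans (hC 0 le_rfl).1
    have hD0 : 0 ≤ D := (abs_nonneg _).trans (hD 0 le_rfl).1
    -- Residual times decrease, so the left derivative of a profile becomes a right derivative in
    -- the elapsed time, which is what the fundamental theorem of calculus asks for.
    have hcomp : ∀ {g g' : ℝ → ℝ}, IsProfile g g' → ∀ a s : ℝ,
        HasDerivWithinAt (fun s => g (a - s)) (-(g' (a - s))) (Set.Ioi s) s := by
      intro g g' hg a s
      have h1 : HasDerivWithinAt (fun s : ℝ => a - s) (-1) (Set.Ioi s) s := by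
        simpa using ((hasDerivAt_id s).const_sub a).hasDerivWithinAt
      have h2 := (hg.hasDeriv (a - s)).comp s (s' := Set.Iic (a - s)) h1
        (fun y hy => by
          have : s < y := hy
          simp only [Set.mem_Iic]; linarith)
      simpa [Function.comp_def] using h2
    have hk1 : Measurable fun s : ℝ => k' (x.2.1 - s) :=
      hk.measurable_deriv.comp (measurable_const.sub measurable_id)
    have hk0 : Measurable fun s : ℝ => k (x.2.1 - s) :=
      hk.continuous.measurable.comp (measurable_const.sub measurable_id)
    have hh1 : Measurable fun s : ℝ => h' (x.2.2 - s) :=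
      hh.measurable_deriv.comp (measurable_const.sub measurable_id)
    have hh0 : Measurable fun s : ℝ => h (x.2.2 - s) :=
      hh.continuous.measurable.comp (measurable_const.sub measurable_id)
    have hux : u ≤ x.2.1 := hu.trans (timeToEvent_le x)
    have hint : ∀ {G : ℝ → ℝ} {B : ℝ}, Measurable G → (∀ s, 0 ≤ s → s ≤ u → |G s| ≤ B) →
        IntervalIntegrable G volume 0 u := by
      intro G B hG hB
      rw [intervalIntegrable_iff_integrableOn_Ioc_of_le hu0]
      refine integrable_of_ae_bound hG (C := B) ?_
      filter_upwards [ae_restrict_mem measurableSet_Ioc] with s hs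
      exact hB s hs.1.le hs.2
    by_cases h0 : x.1 = 0
    · simp only [prodDeriv, prodTest, drift, h0, if_true, add_zero]
      rw [intervalIntegral.integral_eq_sub_of_hasDeriv_right_of_le
        (f := fun s => c 0 * (k (x.2.1 - s) * h x.2.2)) hu0]
      · simp
      · exact (continuous_const.mul ((hk.continuous.comp (by fun_prop)).mul
          continuous_const)).continuousOn
      · intro s _
        refine (((hcomp hk x.2.1 s).mul_const (h x.2.2)).const_mul (c 0)).congr_deriv ?_
        ring
      · refine hint (B := |c 0| * (C * |h x.2.2|))
          ((measurable_const.mul (hk1.mul measurable_const)).neg) fun s hs hs' => ?_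
        rw [abs_neg, abs_mul, abs_mul]
        gcongr
        exact (hC _ (by linarith)).2
    · have huv : u ≤ x.2.2 := by
        rw [timeToEvent, if_neg h0] at hu
        exact hu.trans (min_le_right _ _)
      simp only [prodDeriv, prodTest, drift, h0, if_false]
      rw [intervalIntegral.integral_eq_sub_of_hasDeriv_right_of_le
        (f := fun s => c x.1 * (k (x.2.1 - s) * h (x.2.2 - s))) hu0]
      · simp
      · exact (continuous_const.mul ((hk.continuous.comp (by fun_prop)).mul
          (hh.continuous.comp (by fun_prop)))).continuousOn
      · intro s _
        refine (((hcomp hk x.2.1 s).mul (hcomp hh x.2.2 s)).const_mul (c x.1)).congr_deriv ?_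
        ring
      · refine hint (B := |c x.1| * (C * D + C * D))
          ((measurable_const.mul ((hk1.mul hh0).add (hk0.mul hh1))).neg) fun s hs hs' => ?_
        rw [abs_neg, abs_mul]
        refine mul_le_mul_of_nonneg_left ((abs_add_le _ _).trans (add_le_add ?_ ?_)) (abs_nonneg _)
        · rw [abs_mul]
          exact mul_le_mul (hC _ (by linarith)).2 (hD _ (by linarith)).1 (abs_nonneg _) hC0
        · rw [abs_mul]
          exact mul_le_mul (hC _ (by linarith)).1 (hD _ (by linarith)).2 (abs_nonneg _) hC0

/-- Number of customers after the event(s) in the state `y`. -/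
noncomputable def queueAfter (ℓ : ℕ) (y : QState) : ℕ := (jump ℓ y 0 0).1

-- The queue length after the event does not depend on the new draws, and the two draws are
-- independent, so the mean over them factorizes.
open Classical in
lemma jumpMean_prod (M : FiniteQueue) (c : ℕ → ℝ) (k h : ℝ → ℝ) (y : QState) :
    M.jumpMean (prodTest c k h) y = c (queueAfter M.threshold y) *
      ((if y ∈ arrivalSet then ∫ x, k x ∂(M.interarrival : Measure ℝ) else k y.2.1) *
        (if y ∈ serviceSet then ∫ x, h x ∂(M.service : Measure ℝ) else h y.2.2)) := by
  have e : ∀ d : ℝ × ℝ, prodTest c k h (jump M.threshold y d.1 d.2)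
      = c (queueAfter M.threshold y) * ((if y ∈ arrivalSet then k d.1 else k y.2.1) *
        (if y ∈ serviceSet then h d.2 else h y.2.2)) := by
    intro d
    have h1 : (jump M.threshold y d.1 d.2).2.1 = if y ∈ arrivalSet then d.1 else y.2.1 := by
      by_cases h : y ∈ arrivalSet
      · rw [if_pos h]
        exact if_pos (show y.2.1 = 0 from h)
      · rw [if_neg h]
        exact if_neg (show ¬ y.2.1 = 0 from h)
    have h2 : (jump M.threshold y d.1 d.2).2.2 = if y ∈ serviceSet then d.2 else y.2.2 := by
      by_cases h : y ∈ serviceSet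
      · rw [if_pos h]
        exact if_pos (show y.1 ≠ 0 ∧ y.2.2 = 0 from h)
      · rw [if_neg h]
        exact if_neg (show ¬ (y.1 ≠ 0 ∧ y.2.2 = 0) from h)
    rw [prodTest, h1, h2, apply_ite k, apply_ite h]
    rfl
  unfold jumpMean
  simp_rw [e]
  rw [integral_const_mul, drawLaw, integral_prod_mul
    (fun x => if y ∈ arrivalSet then k x else k y.2.1)
    (fun x => if y ∈ serviceSet then h x else h y.2.2)]
  congr 2 <;> split_ifs <;> simp

end FiniteQueue

/-! ### Residual times, conservation of rates, and tail bounds. -/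

namespace FiniteQueue

/-- `ν` is `α` times the mean measure of the residual times over one period with law `P`. -/
structure IsResidual (ν P : Measure ℝ) (α : ℝ) : Prop where
  pos : ∀ᵐ x ∂ν, 0 < x
  nonneg : 0 ≤ α
  integral_eq : ∀ {k k' : ℝ → ℝ}, IsProfile k k' → ∫ x, k' x ∂ν = α * (∫ x, k x ∂P - k 0)

namespace IsResidual

variable {ν P : Measure ℝ} {α : ℝ}

/-- The truncated identity `min a N` has derivative `1` up to `N` and `0` beyond. -/
lemma measureReal_Iic (h : IsResidual ν P α) {N : ℝ} (hN : 0 ≤ N) :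
    ν.real (Set.Iic N) = α * ∫ x, min x N ∂P := by
  have := h.integral_eq (IsProfile.min hN)
  rw [min_eq_left hN, sub_zero] at this
  rw [← this, ← integral_indicator_one measurableSet_Iic]
  rfl

lemma measureReal_univ [IsFiniteMeasure ν] [IsProbabilityMeasure P] (h : IsResidual ν P α) (hint : Integrable (fun x => x ^ 2) P)
    (hpos : ∀ᵐ x ∂P, 0 < x) : ν.real Set.univ = α * ∫ x, x ∂P := by
  have h1 : Tendsto (fun n : ℕ => ν.real (Set.Iic (n : ℝ))) atTop (𝓝 (ν.real Set.univ)) := by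
    have hU : (⋃ n : ℕ, Set.Iic (n : ℝ)) = Set.univ := by
      rw [Set.eq_univ_iff_forall]
      intro x
      obtain ⟨n, hn⟩ := exists_nat_ge x
      exact Set.mem_iUnion.2 ⟨n, hn⟩
    have := tendsto_measure_iUnion_atTop (μ := ν) (s := fun n : ℕ => Set.Iic (n : ℝ))
      (fun a b hab => Set.Iic_subset_Iic.2 (Nat.cast_le.2 hab))
    rw [hU] at this
    exact (ENNReal.tendsto_toReal (measure_ne_top _ _)).comp this
  have h2 : Tendsto (fun n : ℕ => α * ∫ x, min x (n : ℝ) ∂P) atTop (𝓝 (α * ∫ x, x ∂P)) := by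
    refine Tendsto.const_mul α ?_
    refine tendsto_integral_of_dominated_convergence (fun x => |x|) (fun n => by fun_prop)
      (integrable_of_sq hint).abs (fun n => ?_) (ae_of_all _ fun x => ?_)
    · filter_upwards [hpos] with x hx
      rw [Real.norm_eq_abs, abs_of_nonneg (le_min hx.le (Nat.cast_nonneg n)), abs_of_pos hx]
      exact min_le_left _ _
    · refine tendsto_const_nhds.congr' ?_
      filter_upwards [eventually_ge_atTop ⌈x⌉₊] with n hn
      exact (min_eq_left (Nat.ceil_le.1 hn)).symm
  refine tendsto_nhds_unique h1 (h2.congr fun n => ?_)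
  rw [h.measureReal_Iic (Nat.cast_nonneg n)]

lemma measureReal_Ioi_le [IsFiniteMeasure ν] [IsProbabilityMeasure P] (h : IsResidual ν P α) (hint : Integrable (fun x => x ^ 2) P)
    (hpos : ∀ᵐ x ∂P, 0 < x) {N : ℝ} (hN : 0 < N) :
    ν.real (Set.Ioi N) ≤ α * (N⁻¹ * sqTail P N) := by
  have h1 := measureReal_add_measureReal_compl (μ := ν) (measurableSet_Iic (a := N))
  rw [Set.compl_Iic, h.measureReal_univ hint hpos, h.measureReal_Iic hN.le] at h1
  have := mul_le_mul_of_nonneg_left (integral_sub_min_le hint hpos hN) h.nonneg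
  linarith

lemma integrable_min_sub [IsFiniteMeasure ν] (h : IsResidual ν P α) {K N : ℝ} (hK : 0 ≤ K) (hKN : K ≤ N) :
    Integrable (fun x => min x N - min x K) ν := by
  refine integrable_of_ae_bound (by fun_prop) (C := N) ?_
  filter_upwards [h.pos] with x hx
  have h1 : min x K ≤ min x N := min_le_min_left x hKN
  have h2 : 0 ≤ min x K := le_min hx.le hK
  rw [abs_of_nonneg (by linarith)]
  linarith [min_le_right x N]

/-- The integrand is at most `x` on `(K, N]` plus `N` on `(N, ∞)`. The profile `min x N ^ 2 / 2`
bounds the first part by half of `α * sqTail P K`, and the tail bound at `N` bounds the second by a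
full one; this is the `3 / 2`. A second-moment tail of the period thus controls the first-moment
tail of the residual time, uniformly in `N`. -/
lemma integral_min_sub_le [IsFiniteMeasure ν] [IsProbabilityMeasure P] (h : IsResidual ν P α) (hint : Integrable (fun x => x ^ 2) P)
    (hpos : ∀ᵐ x ∂P, 0 < x) {K N : ℝ} (hK : 0 < K) (hKN : K ≤ N) :
    ∫ x, (min x N - min x K) ∂ν ≤ 3 / 2 * α * sqTail P K := by
  have hN := hK.trans_le hKN
  have i1 : ∀ {L : ℝ}, 0 ≤ L → Integrable (fun x : ℝ => if x ≤ L then x else 0) ν := fun {L} hL => by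
    refine integrable_of_ae_bound (Measurable.ite measurableSet_Iic measurable_id measurable_const)
      (C := L) ?_
    filter_upwards [h.pos] with x hx
    split_ifs with h'
    · rwa [abs_of_pos hx]
    · simpa using hL
  have i2 : Integrable ((Set.Ioi N).indicator fun _ : ℝ => N) ν :=
    (integrable_const N).indicator measurableSet_Ioi
  have i3 : Integrable (fun x : ℝ => (if x ≤ N then x else 0) - (if x ≤ K then x else 0)) ν :=
    (i1 hN.le).sub (i1 hK.le)
  have h1 : ∫ x, (min x N - min x K) ∂ν ≤ ∫ x, (((if x ≤ N then x else 0) - (if x ≤ K then x else 0))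
      + (Set.Ioi N).indicator (fun _ : ℝ => N) x) ∂ν := by
    refine integral_mono_ae (h.integrable_min_sub hK.le hKN) (i3.add i2) ?_
    filter_upwards [h.pos] with x hx
    by_cases hN' : x ≤ N
    · rw [Set.indicator_of_notMem (by simpa using hN'), min_eq_left hN', if_pos hN']
      by_cases hK' : x ≤ K
      · simp [hK']
      · rw [if_neg hK', min_eq_right (not_le.1 hK').le]; linarith
    · have hK' : ¬ x ≤ K := fun h' => hN' (h'.trans hKN)
      rw [Set.indicator_of_mem (by simpa using hN'), if_neg hN', if_neg hK',
        min_eq_right (not_le.1 hN').le, min_eq_right (not_le.1 hK').le]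
      linarith
  rw [integral_add i3 i2, integral_sub (i1 hN.le) (i1 hK.le), h.integral_eq (IsProfile.min_sq hN.le),
    h.integral_eq (IsProfile.min_sq hK.le), integral_indicator_const _ measurableSet_Ioi,
    integral_div, integral_div, min_eq_left hN.le, min_eq_left hK.le, smul_eq_mul] at h1
  have h2 := mul_le_mul_of_nonneg_left (integral_min_sq_sub_le hint hpos hK.le hKN) h.nonneg
  have h3 := mul_le_mul_of_nonneg_right (h.measureReal_Ioi_le hint hpos hN) hN.le
  have h4 := mul_le_mul_of_nonneg_left (sqTail_anti hint hKN) h.nonneg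
  have h5 : α * (N⁻¹ * sqTail P N) * N = α * sqTail P N := by field_simp
  rw [h5] at h3
  linarith

end IsResidual

section Queue

variable (M : FiniteQueue) (π : ProbabilityMeasure QState)

/-- Mean number of arrivals per unit of time. -/
noncomputable def arrivalRate : ℝ := (M.eventMeasure π).real arrivalSet

/-- Mean number of service completions per unit of time. -/
noncomputable def serviceRate : ℝ := (M.eventMeasure π).real serviceSet

/-- States with a full system. -/
def fullSet : Set QState := {x | x.1 = M.threshold}

/-- Mean number of lost customers per unit of time. -/
noncomputable def lossRate : ℝ := (M.eventMeasure π).real (M.fullSet ∩ arrivalSet)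

/-- Probability of an empty system. -/
noncomputable def idleProb : ℝ := (π : Measure QState).real {x | x.1 = 0}

/-- Law of the residual inter-arrival time. -/
noncomputable def residualArrival : Measure ℝ :=
  Measure.map (fun x : QState => x.2.1) (π : Measure QState)

/-- Law of the residual service time on the event that the server is busy. -/
noncomputable def residualService : Measure ℝ :=
  Measure.map (fun x : QState => x.2.2) ((π : Measure QState).restrict {x | x.1 = 0}ᶜ)

instance : IsFiniteMeasure (residualArrival π) := by unfold residualArrival; infer_instance

instance : IsFiniteMeasure (residualService π) := by unfold residualService; infer_instance

end Queue

lemma measurableSet_fullSet (M : FiniteQueue) : MeasurableSet M.fullSet :=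
  measurable_fst (measurableSet_singleton M.threshold)

lemma integral_residualArrival (π : ProbabilityMeasure QState) {g : ℝ → ℝ} (hg : Measurable g) :
    ∫ x, g x ∂residualArrival π = ∫ x, g x.2.1 ∂(π : Measure QState) := by
  rw [residualArrival, integral_map (Measurable.aemeasurable (by fun_prop))
    hg.aestronglyMeasurable]

lemma integral_residualService (π : ProbabilityMeasure QState) {g : ℝ → ℝ} (hg : Measurable g) :
    ∫ x, g x ∂residualService π
      = ∫ x, (if x.1 = 0 then 0 else g x.2.2) ∂(π : Measure QState) := by
  rw [residualService, integral_map (Measurable.aemeasurable (by fun_prop))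
    hg.aestronglyMeasurable, ← integral_indicator measurableSet_empty.compl]
  refine integral_congr_ae (ae_of_all _ fun x => ?_)
  by_cases h : x.1 = 0
  · simp [h]
  · simp [h]

/-- A service completion requires a nonempty system, so the truncated subtraction on `ℕ` never
truncates. -/
lemma queueAfter_cast {ℓ : ℕ} {y : QState} [Decidable (y ∈ arrivalSet)] [Decidable (y ∈ serviceSet)] :
    (queueAfter ℓ y : ℝ) = y.1 + (if y ∈ arrivalSet ∧ y.1 < ℓ then 1 else 0)
      - (if y ∈ serviceSet then 1 else 0) := by
  have h : ∀ n m : ℕ, (y.1 ≠ 0 ∨ m = 0) → m ≤ 1 → ((y.1 + n - m : ℕ) : ℝ) = y.1 + n - m := by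
    intro n m hm hm'
    rw [Nat.cast_sub (by omega)]
    push_cast; ring
  have e : queueAfter ℓ y = y.1 + (if y ∈ arrivalSet ∧ y.1 < ℓ then 1 else 0)
      - (if y ∈ serviceSet then 1 else 0) := by
    simp only [queueAfter, jump]
    congr 2
    by_cases h' : y ∈ arrivalSet ∧ y.1 < ℓ
    · rw [if_pos h']; exact if_pos h'
    · rw [if_neg h']; exact if_neg h'
  rw [e, h]
  · push_cast; rfl
  · by_cases h' : y ∈ serviceSet
    · exact Or.inl h'.1
    · simp [h']
  · split_ifs <;> simp

namespace IsStationary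

variable {M : FiniteQueue} {π : ProbabilityMeasure QState}

lemma balance (hπ : M.IsStationary π) (c : ℕ → ℝ) {k k' h h' : ℝ → ℝ} (hk : IsProfile k k')
    (hh : IsProfile h h') :
    ∫ x, c x.1 * (k' x.2.1 * h x.2.2 + if x.1 = 0 then 0 else k x.2.1 * h' x.2.2)
        ∂(π : Measure QState)
      = ∫ y, (M.jumpMean (prodTest c k h) y - prodTest c k h y) ∂M.eventMeasure π := by
  have := (isTestPair_prod M.threshold c hk hh).integral_deriv_add_integral_jump hπ
  unfold prodDeriv at this
  rw [integral_neg] at this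
  linarith

/-- The balance equation with an explicit form of the mean jump. -/
lemma balance' (hπ : M.IsStationary π) (c : ℕ → ℝ) {k k' h h' : ℝ → ℝ} (hk : IsProfile k k')
    (hh : IsProfile h h') {g : QState → ℝ}
    (hg : ∀ y ∈ closedStateSpace M.threshold, y ∈ arrivalSet ∪ serviceSet →
      M.jumpMean (prodTest c k h) y - prodTest c k h y = g y) :
    ∫ x, c x.1 * (k' x.2.1 * h x.2.2 + if x.1 = 0 then 0 else k x.2.1 * h' x.2.2)
        ∂(π : Measure QState) = ∫ y, g y ∂M.eventMeasure π := by
  rw [hπ.balance c hk hh]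
  refine integral_congr_ae ?_
  filter_upwards [M.ae_eventMeasure hπ.ae_mem] with y hy
  exact hg y hy.1 hy.2

/-- Balance for a function of the residual inter-arrival time alone: it jumps from its value at `0`
to a fresh mean at arrivals and nowhere else. -/
lemma isResidual_arrival (hπ : M.IsStationary π) :
    IsResidual (residualArrival π) (M.interarrival : Measure ℝ) (M.arrivalRate π) where
  pos := by
    rw [residualArrival, ae_map_iff (Measurable.aemeasurable (by fun_prop)) measurableSet_Ioi]
    filter_upwards [hπ.ae_mem] with x hx
    exact hx.2.1
  nonneg := measureReal_nonneg
  integral_eq {k k'} hk := by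
    classical
    have := hπ.balance' (fun _ => 1) hk (IsProfile.const 1)
      (g := arrivalSet.indicator fun _ => ∫ x, k x ∂(M.interarrival : Measure ℝ) - k 0) (by
        intro y _ _
        rw [jumpMean_prod]
        by_cases h : y ∈ arrivalSet
        · have h0 : y.2.1 = 0 := h
          simp [prodTest, h, h0]
        · simp [prodTest, h])
    rw [integral_indicator_const _ measurableSet_arrivalSet, smul_eq_mul] at this
    rw [integral_residualArrival _ hk.measurable_deriv, arrivalRate, ← this]
    simp

/-- As for arrivals, except that the service clock runs only while the server is busy; the measure
is therefore restricted to nonempty states. -/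
lemma isResidual_service (hπ : M.IsStationary π) :
    IsResidual (residualService π) (M.service : Measure ℝ) (M.serviceRate π) where
  pos := by
    rw [residualService, ae_map_iff (Measurable.aemeasurable (by fun_prop)) measurableSet_Ioi]
    refine ae_restrict_of_ae ?_
    filter_upwards [hπ.ae_mem] with x hx
    exact hx.2.2
  nonneg := measureReal_nonneg
  integral_eq {h h'} hh := by
    classical
    have := hπ.balance' (fun _ => 1) (IsProfile.const 1) hh
      (g := serviceSet.indicator fun _ => ∫ x, h x ∂(M.service : Measure ℝ) - h 0) (by
        intro y _ _
        rw [jumpMean_prod]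
        by_cases hy : y ∈ serviceSet
        · have h0 : y.2.2 = 0 := hy.2
          simp [prodTest, hy, h0]
        · simp [prodTest, hy])
    rw [integral_indicator_const _ measurableSet_serviceSet, smul_eq_mul] at this
    rw [integral_residualService _ hh.measurable_deriv, serviceRate, ← this]
    simp

/-- Balance for the queue length itself, which does not drift: in the mean, accepted customers enter
as often as customers leave. -/
lemma serviceRate_eq (hπ : M.IsStationary π) :
    M.serviceRate π = M.arrivalRate π - M.lossRate π := by
  classical
  have := M.isFiniteMeasure_eventMeasure hπ.ae_mem
  have hb := hπ.balance' (fun n => (n : ℝ)) (IsProfile.const 1) (IsProfile.const 1)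
    (g := fun y => arrivalSet.indicator (fun _ => (1 : ℝ)) y
      - (M.fullSet ∩ arrivalSet).indicator (fun _ => (1 : ℝ)) y
      - serviceSet.indicator (fun _ => (1 : ℝ)) y) (by
      intro y hy _
      rw [jumpMean_prod, queueAfter_cast]
      have hl := hy.1
      rcases eq_or_lt_of_le hl with h2 | h2
      · by_cases h : y ∈ arrivalSet <;> by_cases h' : y ∈ serviceSet <;>
          simp [prodTest, h, h', fullSet, h2]
      · by_cases h : y ∈ arrivalSet <;> by_cases h' : y ∈ serviceSet <;>
          simp [prodTest, h, h', fullSet, h2, h2.ne])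
  have hA := (integrable_const (μ := M.eventMeasure π) (1 : ℝ)).indicator measurableSet_arrivalSet
  have hF := (integrable_const (μ := M.eventMeasure π) (1 : ℝ)).indicator
    (M.measurableSet_fullSet.inter measurableSet_arrivalSet)
  have hS := (integrable_const (μ := M.eventMeasure π) (1 : ℝ)).indicator measurableSet_serviceSet
  have hAF : Integrable (fun y => arrivalSet.indicator (fun _ => (1 : ℝ)) y
      - (M.fullSet ∩ arrivalSet).indicator (fun _ => (1 : ℝ)) y) (M.eventMeasure π) := hA.sub hF
  rw [integral_sub hAF hS, integral_sub hA hF,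
    integral_indicator_const _ measurableSet_arrivalSet,
    integral_indicator_const _ (M.measurableSet_fullSet.inter measurableSet_arrivalSet),
    integral_indicator_const _ measurableSet_serviceSet] at hb
  simp only [smul_eq_mul, mul_one, mul_zero, ite_self, add_zero, integral_zero] at hb
  unfold serviceRate arrivalRate lossRate
  linarith

lemma arrivalRate_mul_mean (hπ : M.IsStationary π)
    (he : Integrable (fun x => x ^ 2) (M.interarrival : Measure ℝ)) :
    M.arrivalRate π * lawMean M.interarrival = 1 := by
  rw [lawMean, ← hπ.isResidual_arrival.measureReal_univ he M.interarrival_pos, residualArrival,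
    map_measureReal_apply (by fun_prop) MeasurableSet.univ]
  simp

/-- The total mass of the residual service law is the probability that the server is busy. -/
lemma serviceRate_mul_mean (hπ : M.IsStationary π)
    (hs : Integrable (fun x => x ^ 2) (M.service : Measure ℝ)) :
    M.serviceRate π * lawMean M.service = 1 - idleProb π := by
  rw [lawMean, ← hπ.isResidual_service.measureReal_univ hs M.service_pos, residualService,
    map_measureReal_apply (by fun_prop) MeasurableSet.univ, Set.preimage_univ,
    measureReal_restrict_apply MeasurableSet.univ, Set.univ_inter, idleProb,
    probReal_compl_eq_one_sub measurableSet_empty]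

/-- While the system is empty, the service time of the next customer has the service law. -/
lemma integral_idle (hπ : M.IsStationary π) {h h' : ℝ → ℝ} (hh : IsProfile h h') :
    ∫ x, (if x.1 = 0 then h x.2.2 else 0) ∂(π : Measure QState)
      = idleProb π * ∫ x, h x ∂(M.service : Measure ℝ) := by
  classical
  set hbar := ∫ x, h x ∂(M.service : Measure ℝ) with hbar_def
  have hm : Measurable fun x : QState => h x.2.2 := hh.continuous.measurable.comp (by fun_prop)
  obtain ⟨C, hC⟩ := hh.bound
  have hint_h : Integrable h (M.service : Measure ℝ) :=
    integrable_of_ae_bound hh.continuous.measurable (C := C) (by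
      filter_upwards [M.service_pos] with x hx
      exact (hC x hx.le).1)
  have hint : Integrable (fun x : QState => if x.1 = 0 then h x.2.2 else 0) (π : Measure QState) := by
    refine integrable_of_ae_bound (Measurable.ite measurableSet_empty hm measurable_const)
      (C := max C 0) ?_
    filter_upwards [hπ.ae_mem] with x hx
    split_ifs
    · exact (hC _ hx.2.2.le).1.trans (le_max_left _ _)
    · simp
  have hint1 : Integrable (fun x : QState => if x.1 = 0 then hbar else 0) (π : Measure QState) := by
    refine integrable_of_ae_bound (Measurable.ite measurableSet_empty measurable_const
      measurable_const) (C := |hbar|) (ae_of_all _ fun x => ?_)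
    split_ifs <;> simp
  have hF : Integrable (fun x : QState => (if x.1 = 0 then h x.2.2 else 0)
    - (if x.1 = 0 then hbar else 0)) (π : Measure QState) := hint.sub hint1
  have hzero : ∀ n : ℕ, ∫ x : QState, (if x.2.1 ≤ n then (if x.1 = 0 then h x.2.2 else 0)
      - (if x.1 = 0 then hbar else 0) else 0) ∂(π : Measure QState) = 0 := by
    intro n
    -- The test function `1(l = 0) * (a ∧ n) * (h v - hbar)` has no mean jump. Before an arrival `a
    -- = 0`, and before a service completion `l ≠ 0`; after a completion the fresh service time
    -- averages `h - hbar` to zero, and after an arrival alone `l ≠ 0`. Its drift lives on the empty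
    -- states with `a ≤ n`.
    have hb := hπ.balance' (fun l => if l = 0 then 1 else 0) (IsProfile.min (Nat.cast_nonneg n))
      (hh.sub (IsProfile.const hbar)) (g := fun _ => 0) (by
        intro y hy hyu
        have hj : ∫ x, (h x - hbar) ∂(M.service : Measure ℝ) = 0 := by
          rw [integral_sub hint_h (integrable_const _)]; simp [hbar_def]
        rw [jumpMean_prod]
        by_cases hS : y ∈ serviceSet
        · simp [prodTest, hS, hj, hS.1]
        · have hA : y ∈ arrivalSet := hyu.resolve_right hS
          have hA0 : y.2.1 = 0 := hA
          have hq : queueAfter M.threshold y ≠ 0 := by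
            have h1 := queueAfter_cast (ℓ := M.threshold) (y := y)
            rw [if_neg hS, sub_zero] at h1
            intro h0
            rw [h0] at h1
            by_cases hlt : y.1 < M.threshold
            · rw [if_pos ⟨hA, hlt⟩] at h1
              have : (0 : ℝ) ≤ y.1 := Nat.cast_nonneg _
              push_cast at h1; linarith
            · rw [if_neg (fun h' => hlt h'.2), add_zero] at h1
              have h2 : y.1 = 0 := by exact_mod_cast h1.symm
              -- An arrival at an empty system is accepted because the threshold is at least `1`.
              have := M.threshold_pos
              omega
          simp [prodTest, hq, hA0])
    rw [integral_zero] at hb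
    refine Eq.trans (integral_congr_ae (ae_of_all _ fun x => ?_)) hb
    by_cases h0 : x.1 = 0 <;> by_cases h1 : x.2.1 ≤ n <;> simp [h0, h1]
  have hlim : Tendsto (fun n : ℕ => ∫ x : QState, (if x.2.1 ≤ n then
      (if x.1 = 0 then h x.2.2 else 0) - (if x.1 = 0 then hbar else 0) else 0) ∂(π : Measure QState))
      atTop (𝓝 (∫ x : QState, ((if x.1 = 0 then h x.2.2 else 0)
      - (if x.1 = 0 then hbar else 0)) ∂(π : Measure QState))) := by
    refine tendsto_integral_of_dominated_convergence _ (fun n => ?_) hF.norm (fun n => ?_)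
      (ae_of_all _ fun x => ?_)
    · refine Measurable.aestronglyMeasurable (Measurable.ite
        ((measurable_fst.comp measurable_snd) (measurableSet_Iic (a := (n : ℝ)))) ?_ measurable_const)
      exact (Measurable.ite measurableSet_empty hm measurable_const).sub
        (Measurable.ite measurableSet_empty measurable_const measurable_const)
    · refine ae_of_all _ fun x => ?_
      split_ifs <;> simp
    · refine tendsto_const_nhds.congr' ?_
      filter_upwards [eventually_ge_atTop ⌈x.2.1⌉₊] with n hn
      rw [if_pos (Nat.ceil_le.1 hn)]
  simp_rw [hzero] at hlim
  have := tendsto_nhds_unique hlim tendsto_const_nhds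
  rw [integral_sub hint hint1] at this
  have e : ∫ x : QState, (if x.1 = 0 then hbar else 0) ∂(π : Measure QState) = idleProb π * hbar := by
    rw [idleProb, ← smul_eq_mul, ← integral_indicator_const _ measurableSet_empty]
    refine integral_congr_ae (ae_of_all _ fun x => ?_)
    by_cases h0 : x.1 = 0 <;> simp [h0]
  rw [e] at this
  linarith

/-- Bound on the residual service time seen by an arriving customer. -/
lemma mul_integral_arrival_le (hπ : M.IsStationary π)
    (hs : Integrable (fun x => x ^ 2) (M.service : Measure ℝ)) {K N : ℝ} (hK : 1 ≤ K) (hKN : K ≤ N) :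
    (∫ x, min x K ∂(M.interarrival : Measure ℝ))
        * ∫ y in arrivalSet, (min y.2.2 N - min y.2.2 K) ∂M.eventMeasure π
      ≤ (5 / 2 * M.serviceRate π + 1) * sqTail (M.service : Measure ℝ) K := by
  classical
  have hK0 : 0 < K := by linarith
  have hN0 : 0 < N := by linarith
  have := M.isFiniteMeasure_eventMeasure hπ.ae_mem
  set κ := ∫ x, min x K ∂(M.interarrival : Measure ℝ) with hκ
  set h : ℝ → ℝ := fun v => min v N - min v K with hh_def
  have hh := (IsProfile.min hN0.le).sub (IsProfile.min hK0.le)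
  have hnn : ∀ v, 0 ≤ h v := fun v => sub_nonneg.2 (min_le_min_left v hKN)
  -- The test function is `(a ∧ K) * h v`. At an arrival the first factor jumps from `0` to the mean
  -- `κ`, which produces the integral to be bounded; since `h 0 = 0` and `h ≥ 0`, the remaining
  -- jumps only help. The drift side is bounded by residual service tails under `π`: one `sqTail`
  -- from the empty states, `3 / 2` of the service rate from `h` in busy states, and one more
  -- service rate from the derivative of `h`.
  have hb := hπ.balance (fun _ => 1) (IsProfile.min hK0.le) hh
  have hhm : Measurable h := by fun_prop
  have hbd : ∀ v, 0 ≤ v → |h v| ≤ N := fun v hv => by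
    rw [abs_of_nonneg (hnn v)]
    simp only [hh_def]
    linarith [min_le_right v N, le_min hv hK0.le]
  have hκ0 : 0 ≤ κ := integral_nonneg_of_ae (by
    filter_upwards [M.interarrival_pos] with x hx using le_min hx.le hK0.le)
  have hbar0 : 0 ≤ ∫ x, h x ∂(M.service : Measure ℝ) := integral_nonneg hnn
  -- lower bound of the jumps
  have hlow : κ * ∫ y in arrivalSet, h y.2.2 ∂M.eventMeasure π
      ≤ ∫ y, (M.jumpMean (prodTest (fun _ => 1) (fun a => min a K) h) y
        - prodTest (fun _ => 1) (fun a => min a K) h y) ∂M.eventMeasure π := by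
    rw [← integral_indicator measurableSet_arrivalSet, ← integral_const_mul]
    have hpt : ∀ y ∈ closedStateSpace M.threshold, 
        M.jumpMean (prodTest (fun _ => 1) (fun a => min a K) h) y
          - prodTest (fun _ => 1) (fun a => min a K) h y
        = (if y ∈ arrivalSet then κ else min y.2.1 K)
          * (if y ∈ serviceSet then ∫ x, h x ∂(M.service : Measure ℝ) else h y.2.2)
          - min y.2.1 K * h y.2.2 := fun y _ => by
      rw [jumpMean_prod]; simp [prodTest, hκ]
    have hmY : Measurable fun y : QState => h y.2.2 := hhm.comp (by fun_prop)
    refine integral_mono_ae ?_ ?_ ?_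
    · refine Integrable.const_mul (integrable_of_ae_bound
        (hmY.indicator measurableSet_arrivalSet) (C := N) ?_) _
      filter_upwards [M.ae_eventMeasure hπ.ae_mem] with y hy
      by_cases hA : y ∈ arrivalSet
      · rw [Set.indicator_of_mem hA]; exact hbd _ hy.1.2.2
      · rw [Set.indicator_of_notMem hA]; simpa using hN0.le
    · have hf := isTestPair_prod M.threshold (fun _ => 1) (IsProfile.min hK0.le) hh
      refine integrable_of_ae_bound ((M.measurable_jumpMean hf.measurable_fun).sub
        hf.measurable_fun) (C := (κ + K) * (∫ x, h x ∂(M.service : Measure ℝ) + N) + K * N) ?_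
      filter_upwards [M.ae_eventMeasure hπ.ae_mem] with y hy
      change |M.jumpMean (prodTest (fun _ => 1) (fun a => min a K) h) y
          - prodTest (fun _ => 1) (fun a => min a K) h y| ≤ _
      rw [hpt y hy.1]
      have h1 : 0 ≤ min y.2.1 K := le_min hy.1.2.1 hK0.le
      have h2 : min y.2.1 K ≤ K := min_le_right _ _
      have h3 := hnn y.2.2
      have h4 := (le_abs_self _).trans (hbd y.2.2 hy.1.2.2)
      refine (abs_sub _ _).trans (add_le_add ?_ ?_)
      · rw [abs_mul]
        refine mul_le_mul ?_ ?_ (abs_nonneg _) (by linarith)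
        · split_ifs
          · rw [abs_of_nonneg hκ0]; linarith
          · rw [abs_of_nonneg h1]; linarith
        · split_ifs
          · rw [abs_of_nonneg hbar0]; linarith
          · rw [abs_of_nonneg h3]; linarith
      · rw [abs_of_nonneg (mul_nonneg h1 h3)]
        exact mul_le_mul h2 h4 h3 hK0.le
    · filter_upwards [M.ae_eventMeasure hπ.ae_mem] with y hy
      rw [hpt y hy.1]
      have h1 : 0 ≤ min y.2.1 K := le_min hy.1.2.1 hK0.le
      have hS0 : y ∈ serviceSet → h y.2.2 = 0 := fun hS => by
        simp only [hh_def, hS.2, min_eq_left hN0.le, min_eq_left hK0.le, sub_zero]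
      have hA0 : y ∈ arrivalSet → min y.2.1 K = 0 := fun hA => by
        rw [show y.2.1 = 0 from hA, min_eq_left hK0.le]
      by_cases hA : y ∈ arrivalSet <;> by_cases hS : y ∈ serviceSet
      · simp only [Set.indicator_of_mem hA, hS0 hS, if_pos hA, if_pos hS, mul_zero, sub_zero]
        positivity
      · simp [hA, hS, hA0 hA]
      · simp only [Set.indicator_of_notMem hA, hS0 hS, if_neg hA, if_pos hS, mul_zero, sub_zero]
        positivity
      · simp [hA, hS]
  -- upper bound of the drift
  have hmv : Measurable fun x : QState => h x.2.2 := hhm.comp (by fun_prop)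
  have j1 : Integrable (fun x : QState => if x.1 = 0 then h x.2.2 else 0) (π : Measure QState) := by
    refine integrable_of_ae_bound (Measurable.ite measurableSet_empty hmv measurable_const)
      (C := N) ?_
    filter_upwards [hπ.ae_mem] with x hx
    split_ifs
    · exact hbd _ hx.2.2.le
    · simpa using hN0.le
  have j2 : Integrable (fun x : QState => if x.1 = 0 then 0 else h x.2.2) (π : Measure QState) := by
    refine integrable_of_ae_bound (Measurable.ite measurableSet_empty measurable_const hmv)
      (C := N) ?_
    filter_upwards [hπ.ae_mem] with x hx
    split_ifs
    · simpa using hN0.le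
    · exact hbd _ hx.2.2.le
  have hmI : Measurable ((Set.Ioi K).indicator fun _ : ℝ => (1 : ℝ)) :=
    measurable_const.indicator measurableSet_Ioi
  have j3 : Integrable (fun x : QState => if x.1 = 0 then 0 else
      (Set.Ioi K).indicator (fun _ : ℝ => (1 : ℝ)) x.2.2) (π : Measure QState) := by
    refine integrable_of_ae_bound (Measurable.ite measurableSet_empty measurable_const
      (hmI.comp (by fun_prop))) (C := 1) (ae_of_all _ fun x => ?_)
    by_cases h0 : x.1 = 0 <;> by_cases h1 : K < x.2.2 <;> simp [h0, h1]
  have j12 : Integrable (fun x : QState => (if x.1 = 0 then h x.2.2 else 0)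
    + (if x.1 = 0 then 0 else h x.2.2)) (π : Measure QState) := j1.add j2
  have hup : ∫ x : QState, 1 * ((if x.2.1 ≤ K then 1 else 0) * h x.2.2 + if x.1 = 0 then 0 else
        min x.2.1 K * ((if x.2.2 ≤ N then 1 else 0) - (if x.2.2 ≤ K then 1 else 0)))
        ∂(π : Measure QState)
      ≤ ∫ x : QState, ((if x.1 = 0 then h x.2.2 else 0) + (if x.1 = 0 then 0 else h x.2.2)
        + K * (if x.1 = 0 then 0 else (Set.Ioi K).indicator (fun _ : ℝ => (1 : ℝ)) x.2.2))
        ∂(π : Measure QState) := by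
    refine integral_mono_of_nonneg ?_ (j12.add (j3.const_mul K)) ?_
    · filter_upwards [hπ.ae_mem] with x hx
      have h1 : 0 ≤ min x.2.1 K := le_min hx.2.1.le hK0.le
      have h2 : (0 : ℝ) ≤ (if x.2.2 ≤ N then 1 else 0) - (if x.2.2 ≤ K then 1 else 0) := by
        by_cases hxK : x.2.2 ≤ K
        · simp [hxK, hxK.trans hKN]
        · split_ifs <;> simp
      have h3 := hnn x.2.2
      have h4 : (0 : ℝ) ≤ if x.2.1 ≤ K then 1 else 0 := by split_ifs <;> simp
      simp only [one_mul, Pi.zero_apply]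
      refine add_nonneg (mul_nonneg h4 h3) ?_
      split_ifs <;> first | exact le_rfl | positivity | skip
      all_goals exact mul_nonneg h1 (by simp_all)
    · filter_upwards [hπ.ae_mem] with x hx
      have h1 : 0 ≤ min x.2.1 K := le_min hx.2.1.le hK0.le
      have h1' : min x.2.1 K ≤ K := min_le_right _ _
      have h3 := hnn x.2.2
      have h5 : (if x.2.1 ≤ K then (1 : ℝ) else 0) * h x.2.2 ≤ h x.2.2 := by
        split_ifs <;> simp [h3]
      rw [one_mul]
      refine add_le_add ?_ ?_
      · refine h5.trans ?_
        split_ifs <;> simp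
      · by_cases h0 : x.1 = 0
        · simp [h0]
        · rw [if_neg h0, if_neg h0]
          by_cases hxK : x.2.2 ≤ K
          · simp [hxK, hxK.trans hKN]
          · rw [Set.indicator_of_mem (by simpa using hxK), if_neg hxK]
            split_ifs <;> (simp; try linarith)
  rw [← hb] at hlow
  have hall := hlow.trans hup
  rw [integral_add j12 (j3.const_mul K), integral_add j1 j2, integral_const_mul,
    hπ.integral_idle hh, ← integral_residualService π hhm, ← integral_residualService π hmI,
    integral_indicator_const _ measurableSet_Ioi, smul_eq_mul, mul_one] at hall
  have hres := hπ.isResidual_service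
  have b1 := hres.integral_min_sub_le hs M.service_pos hK0 hKN
  have b2 := mul_le_mul_of_nonneg_left (hres.measureReal_Ioi_le hs M.service_pos hK0) hK0.le
  have b3 : ∫ x, h x ∂(M.service : Measure ℝ) ≤ K⁻¹ * sqTail (M.service : Measure ℝ) K := by
    have := _root_.integral_min_sub_le hs M.service_pos hK0 hKN
    rwa [← integral_sub (integrable_min M.service_pos hN0.le)
      (integrable_min M.service_pos hK0.le)] at this
  have hT := sqTail_nonneg (M.service : Measure ℝ) K
  have b4 : idleProb π * ∫ x, h x ∂(M.service : Measure ℝ) ≤ sqTail (M.service : Measure ℝ) K := by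
    have h1 : idleProb π ≤ 1 := measureReal_le_one
    have h2 : K⁻¹ * sqTail (M.service : Measure ℝ) K ≤ sqTail (M.service : Measure ℝ) K :=
      mul_le_of_le_one_left hT (inv_le_one_of_one_le₀ hK)
    calc _ ≤ 1 * ∫ x, h x ∂(M.service : Measure ℝ) := mul_le_mul_of_nonneg_right h1 hbar0
      _ ≤ _ := by linarith
  have b5 : K * (M.serviceRate π * (K⁻¹ * sqTail (M.service : Measure ℝ) K))
      = M.serviceRate π * sqTail (M.service : Measure ℝ) K := by field_simp
  rw [b5] at b2
  linarith

end IsStationary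

end FiniteQueue

/-! ### Exponential test functions: the jumps. -/

lemma abs_exp_neg_sub_one_le {y C : ℝ} (hy : |y| ≤ C) :
    |Real.exp (-y) - 1| ≤ Real.exp C * |y| := by
  have h := Complex.norm_exp_sub_sum_le_norm_mul_exp (-y : ℂ) 1
  have e : Complex.exp (-y : ℂ) - ∑ i ∈ Finset.range 1, (-y : ℂ) ^ i / (i.factorial : ℂ)
      = ((Real.exp (-y) - 1 : ℝ) : ℂ) := by
    simp
  rw [e, Complex.norm_real, norm_neg, Complex.norm_real, Real.norm_eq_abs, Real.norm_eq_abs,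
    pow_one] at h
  refine h.trans ?_
  rw [mul_comm]
  exact mul_le_mul_of_nonneg_right (Real.exp_le_exp.2 hy) (abs_nonneg _)

namespace FiniteQueue

/-- Bounds on the parameters of an exponential test function
`exp (t l) * exp (-η (a ∧ N)) * exp (-ξ (v ∧ N))`. -/
structure ExpBound (ℓ : ℕ) (t η ξ N B D : ℝ) : Prop where
  pos : 0 < N
  arrival : |η| * N ≤ D
  service : |ξ| * N ≤ D
  queue : ∀ l : ℕ, l ≤ ℓ → Real.exp (t * l) ≤ B

namespace ExpBound

variable {ℓ : ℕ} {t η ξ N B D : ℝ}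

lemma nonneg (h : ExpBound ℓ t η ξ N B D) : 0 ≤ D :=
  (mul_nonneg (abs_nonneg _) h.pos.le).trans h.arrival

lemma one_le (h : ExpBound ℓ t η ξ N B D) : 1 ≤ B := by
  simpa using h.queue 0 (Nat.zero_le _)

lemma abs_mul_min_le {η N D a : ℝ} (hN : 0 < N) (h : |η| * N ≤ D) (ha : 0 ≤ a) :
    |η * min a N| ≤ D := by
  rw [abs_mul, abs_of_nonneg (le_min ha hN.le)]
  exact (mul_le_mul_of_nonneg_left (min_le_right _ _) (abs_nonneg _)).trans h

lemma exp_le {η N D a : ℝ} (hN : 0 < N) (h : |η| * N ≤ D) (ha : 0 ≤ a) :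
    Real.exp (-(η * min a N)) ≤ Real.exp D :=
  Real.exp_le_exp.2 ((neg_le_abs _).trans (abs_mul_min_le hN h ha))

lemma abs_exp_sub_one_le {η N D a : ℝ} (hN : 0 < N) (h : |η| * N ≤ D) (ha : 0 ≤ a) :
    |Real.exp (-(η * min a N)) - 1| ≤ Real.exp D * (|η| * min a N) := by
  have := abs_exp_neg_sub_one_le (abs_mul_min_le hN h ha)
  rwa [abs_mul, abs_of_nonneg (le_min ha hN.le)] at this

lemma abs_mul_exp_sub_one_le (h : ExpBound ℓ t η ξ N B D) {a v : ℝ} (ha : 0 ≤ a) (hv : 0 ≤ v) :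
    |Real.exp (-(η * min a N)) * Real.exp (-(ξ * min v N)) - 1|
      ≤ Real.exp (2 * D) * (|η| * min a N + |ξ| * min v N) := by
  have h1 := abs_mul_min_le h.pos h.arrival ha
  have h2 := abs_mul_min_le h.pos h.service hv
  have h3 : |η * min a N + ξ * min v N| ≤ 2 * D := (abs_add_le _ _).trans (by linarith)
  have h4 := abs_exp_neg_sub_one_le h3
  rw [← Real.exp_add, ← neg_add]
  refine h4.trans (mul_le_mul_of_nonneg_left ((abs_add_le _ _).trans_eq ?_) (Real.exp_pos _).le)
  rw [abs_mul, abs_mul, abs_of_nonneg (le_min ha h.pos.le), abs_of_nonneg (le_min hv h.pos.le)]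

lemma integral_exp_le {P : Measure ℝ} [IsProbabilityMeasure P] (hP : ∀ᵐ x ∂P, 0 < x)
    {η N D : ℝ} (hN : 0 < N) (h : |η| * N ≤ D) :
    |∫ x, Real.exp (-(η * min x N)) ∂P| ≤ Real.exp D := by
  have := norm_integral_le_of_norm_le_const (μ := P) (f := fun x => Real.exp (-(η * min x N)))
    (C := Real.exp D) (by
      filter_upwards [hP] with x hx
      rw [Real.norm_eq_abs, abs_of_pos (Real.exp_pos _)]
      exact exp_le hN h hx.le)
  simpa using this

end ExpBound

/-- The exponential test function. -/
noncomputable def expTest (t η ξ N : ℝ) : QState → ℝ :=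
  prodTest (fun l => Real.exp (t * l)) (fun a => Real.exp (-(η * min a N)))
    (fun v => Real.exp (-(ξ * min v N)))

namespace IsStationary

variable {M : FiniteQueue} {π : ProbabilityMeasure QState} {t η ξ N B D : ℝ}

/-- An accepted arrival multiplies the test function in the mean by `1 + εe` and a completion by `1
+ εs`; if both occur at once, the factor is `(1 + εe) * (1 + εs)`, hence the product term in the
bound. A lost arrival renews its clock without changing the queue and contributes the subtracted
indicator term. -/
lemma abs_jumpMean_expTest_sub_le (h : ExpBound M.threshold t η ξ N B D)
    {E₁ V₁ : ℝ} (hE : E₁ = ∫ x, Real.exp (-(η * min x N)) ∂(M.interarrival : Measure ℝ))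
    (hV : V₁ = ∫ x, Real.exp (-(ξ * min x N)) ∂(M.service : Measure ℝ)) {y : QState}
    (hy : y ∈ closedStateSpace M.threshold) (hyu : y ∈ arrivalSet ∪ serviceSet) :
    |M.jumpMean (expTest t η ξ N) y - expTest t η ξ N y
        - (M.fullSet ∩ arrivalSet).indicator (fun y => (E₁ - 1) * Real.exp (t * M.threshold)
          * Real.exp (-(ξ * min y.2.2 N))) y|
      ≤ B * Real.exp (2 * D) * (|Real.exp t * E₁ - 1| + |Real.exp (-t) * V₁ - 1|
        + |Real.exp t * E₁ - 1| * |Real.exp (-t) * V₁ - 1|) := by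
  classical
  set εe := Real.exp t * E₁ - 1 with hεe
  set εs := Real.exp (-t) * V₁ - 1 with hεs
  have hD := h.nonneg
  have hB1 := h.one_le
  have hq := h.queue y.1 hy.1
  have heD : 1 ≤ Real.exp D := Real.one_le_exp hD
  have he2 : Real.exp (2 * D) = Real.exp D * Real.exp D := by rw [← Real.exp_add]; ring_nf
  have hEb : |E₁| ≤ Real.exp D := by
    rw [hE]; exact ExpBound.integral_exp_le M.interarrival_pos h.pos h.arrival
  have hAb := ExpBound.exp_le h.pos h.arrival hy.2.1
  have hVb := ExpBound.exp_le h.pos h.service hy.2.2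
  have hA0 := Real.exp_pos (-(η * min y.2.1 N))
  have hV0 := Real.exp_pos (-(ξ * min y.2.2 N))
  have hq0 := Real.exp_pos (t * y.1)
  -- a product bound
  have hbound : ∀ {X Z δ : ℝ}, |X| ≤ Real.exp D → |Z| ≤ |εe| + |εs| + |εe| * |εs| →
      δ = Real.exp (t * y.1) * X * Z →
      |δ| ≤ B * Real.exp (2 * D) * (|εe| + |εs| + |εe| * |εs|) := by
    intro X Z δ hX hZ hδ
    rw [hδ, abs_mul, abs_mul, abs_of_pos hq0]
    refine mul_le_mul (mul_le_mul hq (hX.trans ?_) (abs_nonneg _) (by linarith)) hZ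
      (abs_nonneg _) (by positivity)
    rw [he2]; nlinarith
  have hz1 : |εe| ≤ |εe| + |εs| + |εe| * |εs| := by
    have := abs_nonneg εs; have := mul_nonneg (abs_nonneg εe) (abs_nonneg εs); linarith
  have hz2 : |εs| ≤ |εe| + |εs| + |εe| * |εs| := by
    have := abs_nonneg εe; have := mul_nonneg (abs_nonneg εe) (abs_nonneg εs); linarith
  have hz3 : |εe + εs + εe * εs| ≤ |εe| + |εs| + |εe| * |εs| := by
    refine (abs_add_le _ _).trans (add_le_add (abs_add_le _ _) (abs_mul _ _).le)
  rw [expTest, jumpMean_prod, queueAfter_cast, ← hE, ← hV, prodTest]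
  by_cases hA : y ∈ arrivalSet
  · have hA1 : y.2.1 = 0 := hA
    by_cases hS : y ∈ serviceSet
    · have hS1 : y.2.2 = 0 := hS.2
      rcases eq_or_lt_of_le hy.1 with hl | hl
      -- A full system with simultaneous arrival and completion: the arrival is still lost, as
      -- acceptance looks at the state before the departure. Beyond the loss term there remains the
      -- completion error `εs`, multiplied by `E₁`.
      · rw [Set.indicator_of_mem (show y ∈ M.fullSet ∩ arrivalSet from ⟨hl, hA⟩)]
        refine hbound (X := E₁) (Z := εs) hEb hz2 ?_
        simp only [hA, hS, hl, hA1, hS1, min_eq_left h.pos.le, if_true, lt_irrefl, and_false,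
          if_false, add_zero, mul_zero, neg_zero, Real.exp_zero, mul_one, hεs,
          sub_eq_add_neg, mul_add, Real.exp_add, mul_neg]
        ring
      · rw [Set.indicator_of_notMem (show y ∉ M.fullSet ∩ arrivalSet from fun h' => hl.ne h'.1)]
        refine hbound (X := 1) (Z := εe + εs + εe * εs) (by simpa using heD) hz3 ?_
        have : Real.exp t * Real.exp (-t) = 1 := by rw [← Real.exp_add]; simp
        simp only [hA, hS, hl, hA1, hS1, min_eq_left h.pos.le, if_true, and_self,
          mul_zero, neg_zero, Real.exp_zero, mul_one, add_sub_cancel_right, hεs, hεe]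
        linear_combination Real.exp (t * y.1) * (-E₁ * V₁) * this
    · rcases eq_or_lt_of_le hy.1 with hl | hl
      · rw [Set.indicator_of_mem (show y ∈ M.fullSet ∩ arrivalSet from ⟨hl, hA⟩)]
        have : (0 : ℝ) ≤ B * Real.exp (2 * D) * (|εe| + |εs| + |εe| * |εs|) := by positivity
        refine le_trans (le_of_eq ?_) this
        rw [abs_eq_zero]
        simp only [hA, hS, hl, hA1, min_eq_left h.pos.le, if_true, lt_irrefl, and_false,
          if_false, add_zero, sub_zero, mul_zero, neg_zero, Real.exp_zero]
        ring
      · rw [Set.indicator_of_notMem (show y ∉ M.fullSet ∩ arrivalSet from fun h' => hl.ne h'.1)]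
        refine hbound (X := Real.exp (-(ξ * min y.2.2 N))) (Z := εe)
          (by rwa [abs_of_pos hV0]) hz1 ?_
        simp only [hA, hS, hl, hA1, min_eq_left h.pos.le, if_true, and_self, if_false,
          mul_zero, neg_zero, Real.exp_zero, sub_zero, mul_add, mul_one, Real.exp_add, hεe]
        ring
  · have hS : y ∈ serviceSet := hyu.resolve_left hA
    have hS1 : y.2.2 = 0 := hS.2
    rw [Set.indicator_of_notMem (show y ∉ M.fullSet ∩ arrivalSet from fun h' => hA h'.2)]
    refine hbound (X := Real.exp (-(η * min y.2.1 N))) (Z := εs) (by rwa [abs_of_pos hA0]) hz2 ?_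
    simp only [hA, hS, hS1, min_eq_left h.pos.le, if_true, false_and, if_false, add_zero, mul_zero,
      neg_zero, Real.exp_zero, sub_zero, mul_sub, mul_one, Real.exp_sub, hεs, Real.exp_neg]
    ring

lemma measureReal_univ_le (hπ : M.IsStationary π) :
    (M.eventMeasure π).real Set.univ ≤ M.arrivalRate π + M.serviceRate π := by
  have := M.isFiniteMeasure_eventMeasure hπ.ae_mem
  have h1 : (M.eventMeasure π).real Set.univ = (M.eventMeasure π).real (arrivalSet ∪ serviceSet) := by
    refine measureReal_congr ?_
    filter_upwards [M.ae_eventMeasure hπ.ae_mem] with y hy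
    exact propext ⟨fun _ => hy.2, fun _ => trivial⟩
  rw [h1]
  exact measureReal_union_le _ _

lemma abs_integral_jump_sub_le (hπ : M.IsStationary π) (h : ExpBound M.threshold t η ξ N B D)
    {E₁ V₁ : ℝ} (hE : E₁ = ∫ x, Real.exp (-(η * min x N)) ∂(M.interarrival : Measure ℝ))
    (hV : V₁ = ∫ x, Real.exp (-(ξ * min x N)) ∂(M.service : Measure ℝ)) :
    |∫ y, (M.jumpMean (expTest t η ξ N) y - expTest t η ξ N y) ∂M.eventMeasure π
        - (E₁ - 1) * Real.exp (t * M.threshold) *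
          ∫ y in M.fullSet ∩ arrivalSet, Real.exp (-(ξ * min y.2.2 N)) ∂M.eventMeasure π|
      ≤ B * Real.exp (2 * D) * (|Real.exp t * E₁ - 1| + |Real.exp (-t) * V₁ - 1|
        + |Real.exp t * E₁ - 1| * |Real.exp (-t) * V₁ - 1|)
        * (M.arrivalRate π + M.serviceRate π) := by
  have := M.isFiniteMeasure_eventMeasure hπ.ae_mem
  have hFA := M.measurableSet_fullSet.inter measurableSet_arrivalSet
  have htest := isTestPair_prod M.threshold (fun l => Real.exp (t * l)) (IsProfile.exp_min η h.pos.le)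
    (IsProfile.exp_min ξ h.pos.le)
  have hm : Measurable (expTest t η ξ N) := htest.measurable_fun
  have hmj := M.measurable_jumpMean hm
  set Γ := B * Real.exp (2 * D) * (|Real.exp t * E₁ - 1| + |Real.exp (-t) * V₁ - 1|
        + |Real.exp t * E₁ - 1| * |Real.exp (-t) * V₁ - 1|) with hΓ
  have hΓ0 : 0 ≤ Γ := by have := h.one_le; positivity
  set W : QState → ℝ := (M.fullSet ∩ arrivalSet).indicator (fun y => (E₁ - 1) *
    Real.exp (t * M.threshold) * Real.exp (-(ξ * min y.2.2 N))) with hW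
  have hWm : Measurable W := Measurable.indicator (by fun_prop) hFA
  have hpt : ∀ᵐ y ∂M.eventMeasure π,
      |M.jumpMean (expTest t η ξ N) y - expTest t η ξ N y - W y| ≤ Γ := by
    filter_upwards [M.ae_eventMeasure hπ.ae_mem] with y hy
    exact abs_jumpMean_expTest_sub_le h hE hV hy.1 hy.2
  have hiW : Integrable W (M.eventMeasure π) := by
    refine integrable_of_ae_bound hWm (C := |(E₁ - 1) * Real.exp (t * M.threshold)| * Real.exp D) ?_
    filter_upwards [M.ae_eventMeasure hπ.ae_mem] with y hy
    by_cases hy' : y ∈ M.fullSet ∩ arrivalSet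
    · rw [hW, Set.indicator_of_mem hy', abs_mul, abs_of_pos (Real.exp_pos (-(ξ * min y.2.2 N)))]
      exact mul_le_mul_of_nonneg_left (ExpBound.exp_le h.pos h.service hy.1.2.2) (abs_nonneg _)
    · rw [hW, Set.indicator_of_notMem hy', abs_zero]
      positivity
  have hi : Integrable (fun y => M.jumpMean (expTest t η ξ N) y - expTest t η ξ N y - W y)
      (M.eventMeasure π) := integrable_of_ae_bound ((hmj.sub hm).sub hWm) hpt
  have hi' : Integrable (fun y => M.jumpMean (expTest t η ξ N) y - expTest t η ξ N y)
      (M.eventMeasure π) := (hi.add hiW).congr (ae_of_all _ fun y => by simp)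
  have e : ∫ y, W y ∂M.eventMeasure π = (E₁ - 1) * Real.exp (t * M.threshold) *
      ∫ y in M.fullSet ∩ arrivalSet, Real.exp (-(ξ * min y.2.2 N)) ∂M.eventMeasure π := by
    rw [hW, integral_indicator hFA, integral_const_mul]
  rw [← e, ← integral_sub hi' hiW]
  refine (norm_integral_le_of_norm_le_const (μ := M.eventMeasure π) (C := Γ)
    (f := fun y => M.jumpMean (expTest t η ξ N) y - expTest t η ξ N y - W y) hpt).trans ?_
  exact mul_le_mul_of_nonneg_left hπ.measureReal_univ_le hΓ0

/-- Replaces the residual service factor at lost arrivals by `1`. The part of the residual time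
below `K` costs `K` times the loss rate; the part above is extended to all arrivals, where
`mul_integral_arrival_le` applies. -/
lemma abs_integral_full_sub_le (hπ : M.IsStationary π) (h : ExpBound M.threshold t η ξ N B D)
    {K : ℝ} (hK : 0 < K) (hKN : K ≤ N) :
    |∫ y in M.fullSet ∩ arrivalSet, Real.exp (-(ξ * min y.2.2 N)) ∂M.eventMeasure π
        - M.lossRate π|
      ≤ Real.exp D * |ξ| * (K * M.lossRate π
        + ∫ y in arrivalSet, (min y.2.2 N - min y.2.2 K) ∂M.eventMeasure π) := by
  have := M.isFiniteMeasure_eventMeasure hπ.ae_mem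
  have hFA := M.measurableSet_fullSet.inter measurableSet_arrivalSet
  have hae := M.ae_eventMeasure hπ.ae_mem
  have i1 : IntegrableOn (fun y : QState => Real.exp (-(ξ * min y.2.2 N))) (M.fullSet ∩ arrivalSet)
      (M.eventMeasure π) := by
    refine integrable_of_ae_bound (by fun_prop) (C := Real.exp D) (ae_restrict_of_ae ?_)
    filter_upwards [hae] with y hy
    rw [abs_of_pos (Real.exp_pos _)]
    exact ExpBound.exp_le h.pos h.service hy.1.2.2
  have i2 : Integrable (fun y : QState => min y.2.2 N - min y.2.2 K) (M.eventMeasure π) := by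
    refine integrable_of_ae_bound (by fun_prop) (C := N) ?_
    filter_upwards [hae] with y hy
    have h1 : min y.2.2 K ≤ min y.2.2 N := min_le_min_left _ hKN
    have h2 : 0 ≤ min y.2.2 K := le_min hy.1.2.2 hK.le
    rw [abs_of_nonneg (by linarith)]
    linarith [min_le_right y.2.2 N]
  have e : M.lossRate π = ∫ y in M.fullSet ∩ arrivalSet, (1 : ℝ) ∂M.eventMeasure π := by
    simp [lossRate]
  have h3 : |∫ y in M.fullSet ∩ arrivalSet, Real.exp (-(ξ * min y.2.2 N)) ∂M.eventMeasure π
        - M.lossRate π| ≤ ∫ y in M.fullSet ∩ arrivalSet, Real.exp D * |ξ| *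
          (K + (min y.2.2 N - min y.2.2 K)) ∂M.eventMeasure π := by
    rw [e, ← integral_sub i1 (integrable_const _), ← Real.norm_eq_abs]
    refine norm_integral_le_of_norm_le
      (Integrable.const_mul ((integrable_const K).add i2.integrableOn) _) (ae_restrict_of_ae ?_)
    filter_upwards [hae] with y hy
    have h4 := ExpBound.abs_exp_sub_one_le h.pos h.service hy.1.2.2
    rw [Real.norm_eq_abs, mul_assoc]
    refine h4.trans (mul_le_mul_of_nonneg_left (mul_le_mul_of_nonneg_left ?_ (abs_nonneg _))
      (Real.exp_pos _).le)
    linarith [min_le_right y.2.2 K]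
  refine h3.trans ?_
  rw [integral_const_mul, integral_add (integrable_const K) i2.integrableOn]
  refine mul_le_mul_of_nonneg_left (add_le_add (le_of_eq ?_) ?_) (by positivity)
  · simp [lossRate, mul_comm]
  · refine setIntegral_mono_set i2.integrableOn (ae_restrict_of_ae ?_)
      (LE.le.eventuallyLE Set.inter_subset_right)
    exact ae_of_all _ fun y => sub_nonneg.2 (min_le_min_left _ hKN)

end IsStationary

end FiniteQueue

/-! ### Exponential test functions: the drift. -/

namespace FiniteQueue

namespace IsStationary

variable {M : FiniteQueue} {π : ProbabilityMeasure QState} {t η ξ N B D : ℝ}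

/-- Laplace transform of the queue length. -/
noncomputable def queueTransform (π : ProbabilityMeasure QState) (t : ℝ) : ℝ :=
  ∫ x, Real.exp (t * x.1) ∂(π : Measure QState)

lemma integrable_min_arrival (hπ : M.IsStationary π) (hN : 0 < N) :
    Integrable (fun x : QState => min x.2.1 N) (π : Measure QState) :=
  integrable_of_ae_bound (by fun_prop) (C := N) (by
    filter_upwards [hπ.ae_mem] with x hx
    rw [abs_of_nonneg (le_min hx.2.1.le hN.le)]
    exact min_le_right _ _)

lemma integrable_min_service (hπ : M.IsStationary π) (hN : 0 < N) :
    Integrable (fun x : QState => min x.2.2 N) (π : Measure QState) :=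
  integrable_of_ae_bound (by fun_prop) (C := N) (by
    filter_upwards [hπ.ae_mem] with x hx
    rw [abs_of_nonneg (le_min hx.2.2.le hN.le)]
    exact min_le_right _ _)

lemma integral_min_arrival_sub_le (hπ : M.IsStationary π)
    (he : Integrable (fun x => x ^ 2) (M.interarrival : Measure ℝ)) {K : ℝ} (hK : 0 < K)
    (hKN : K ≤ N) : ∫ x, (min x.2.1 N - min x.2.1 K) ∂(π : Measure QState)
      ≤ 3 / 2 * M.arrivalRate π * sqTail (M.interarrival : Measure ℝ) K := by
  rw [← integral_residualArrival π (g := fun a => min a N - min a K) (by fun_prop)]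
  exact hπ.isResidual_arrival.integral_min_sub_le he M.interarrival_pos hK hKN

/-- Separates the size of the set from the tail, so that on a set of small probability the integral
is small uniformly in `N`; it is used for the empty states. -/
lemma setIntegral_min_arrival_le (hπ : M.IsStationary π)
    (he : Integrable (fun x => x ^ 2) (M.interarrival : Measure ℝ)) {K : ℝ} (hK : 0 < K)
    (hKN : K ≤ N) (s : Set QState) : ∫ x in s, min x.2.1 N ∂(π : Measure QState)
      ≤ K * (π : Measure QState).real s
        + 3 / 2 * M.arrivalRate π * sqTail (M.interarrival : Measure ℝ) K := by
  have i1 := hπ.integrable_min_arrival hK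
  have i2 := hπ.integrable_min_arrival (hK.trans_le hKN)
  have h1 : ∫ x in s, min x.2.1 K ∂(π : Measure QState) ≤ K * (π : Measure QState).real s := by
    refine (integral_mono i1.integrableOn (integrable_const K) fun x => min_le_right _ _).trans_eq ?_
    simp [mul_comm]
  have h2 : ∫ x in s, (min x.2.1 N - min x.2.1 K) ∂(π : Measure QState)
      ≤ ∫ x, (min x.2.1 N - min x.2.1 K) ∂(π : Measure QState) :=
    setIntegral_le_integral (i2.sub i1) (ae_of_all _ fun x => sub_nonneg.2 (min_le_min_left _ hKN))
  rw [integral_sub i2.integrableOn i1.integrableOn] at h2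
  linarith [hπ.integral_min_arrival_sub_le he hK hKN]

/-- In an empty system the stored service time has the fresh service law, so the mean factorizes
without any tail estimate. -/
lemma setIntegral_idle_min_service_le (hπ : M.IsStationary π)
    (hs : Integrable (fun x => x ^ 2) (M.service : Measure ℝ)) (hN : 0 < N) :
    ∫ x in {x | x.1 = 0}, min x.2.2 N ∂(π : Measure QState) ≤ idleProb π * lawMean M.service := by
  rw [← integral_indicator measurableSet_empty]
  have h1 := hπ.integral_idle (IsProfile.min hN.le)
  have h2 := integral_sub_min_nonneg hs M.service_pos hN.le
  have h0 : 0 ≤ idleProb π := measureReal_nonneg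
  calc _ = ∫ x, (if x.1 = 0 then min x.2.2 N else 0) ∂(π : Measure QState) :=
        integral_congr_ae (ae_of_all _ fun x => by by_cases h : x.1 = 0 <;> simp [h])
    _ ≤ _ := by
      rw [h1]
      exact mul_le_mul_of_nonneg_left (by rw [lawMean]; linarith) h0

lemma integral_min_service_le (hπ : M.IsStationary π)
    (hs : Integrable (fun x => x ^ 2) (M.service : Measure ℝ)) {K : ℝ} (hK : 0 < K)
    (hKN : K ≤ N) : ∫ x, min x.2.2 N ∂(π : Measure QState)
      ≤ K + 3 / 2 * M.serviceRate π * sqTail (M.service : Measure ℝ) K + lawMean M.service := by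
  have hN := hK.trans_le hKN
  have i1 := hπ.integrable_min_service hK
  have i2 := hπ.integrable_min_service hN
  rw [← integral_add_compl measurableSet_empty i2]
  have h1 := hπ.setIntegral_idle_min_service_le hs hN
  have h2 : idleProb π * lawMean M.service ≤ lawMean M.service := by
    refine mul_le_of_le_one_left (integral_nonneg_of_ae ?_) measureReal_le_one
    filter_upwards [M.service_pos] with x hx using hx.le
  have hres := hπ.isResidual_service.integral_min_sub_le hs M.service_pos hK hKN
  have h3 : ∫ x in {x | x.1 = 0}ᶜ, (min x.2.2 N - min x.2.2 K) ∂(π : Measure QState)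
      ≤ 3 / 2 * M.serviceRate π * sqTail (M.service : Measure ℝ) K := by
    refine le_trans (le_of_eq ?_) hres
    rw [residualService, integral_map (Measurable.aemeasurable (by fun_prop)) (by fun_prop)]
  rw [integral_sub i2.integrableOn i1.integrableOn] at h3
  have h4 : ∫ x in {x | x.1 = 0}ᶜ, min x.2.2 K ∂(π : Measure QState) ≤ K := by
    refine (integral_mono i1.integrableOn (integrable_const K) fun x => min_le_right _ _).trans ?_
    simp only [integral_const, measureReal_restrict_apply MeasurableSet.univ, Set.univ_inter,
      smul_eq_mul]
    exact mul_le_of_le_one_left hK.le measureReal_le_one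
  linarith

lemma measureReal_arrival_gt_le (hπ : M.IsStationary π)
    (he : Integrable (fun x => x ^ 2) (M.interarrival : Measure ℝ)) (hN : 0 < N) :
    (π : Measure QState).real {x | N < x.2.1}
      ≤ M.arrivalRate π * (N⁻¹ * sqTail (M.interarrival : Measure ℝ) N) := by
  refine le_trans (le_of_eq ?_)
    (hπ.isResidual_arrival.measureReal_Ioi_le he M.interarrival_pos hN)
  rw [residualArrival, map_measureReal_apply (by fun_prop) measurableSet_Ioi]
  rfl

lemma measureReal_service_gt_le (hπ : M.IsStationary π)
    (hs : Integrable (fun x => x ^ 2) (M.service : Measure ℝ)) (hN : 0 < N) :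
    (π : Measure QState).real ({x | N < x.2.2} ∩ {x | x.1 = 0}ᶜ)
      ≤ M.serviceRate π * (N⁻¹ * sqTail (M.service : Measure ℝ) N) := by
  refine le_trans (le_of_eq ?_)
    (hπ.isResidual_service.measureReal_Ioi_le hs M.service_pos hN)
  have hm : MeasurableSet {x : QState | N < x.2.2} :=
    measurableSet_lt measurable_const (by fun_prop)
  rw [residualService, map_measureReal_apply (by fun_prop) measurableSet_Ioi,
    measureReal_restrict_apply ((by fun_prop : Measurable fun x : QState => x.2.2) measurableSet_Ioi)]
  rfl

/-- By balance the jump integral equals the drift integral, in which the residual factors are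
replaced by `1`. The full drift coefficient is `-(η + ξ)`, and `ξ` is given back on the empty
states, where the service clock stands still. The last two error terms arise because beyond `N` a
truncated factor has derivative zero. -/
lemma abs_integral_drift_sub_le (hπ : M.IsStationary π) (h : ExpBound M.threshold t η ξ N B D) :
    |∫ y, (M.jumpMean (expTest t η ξ N) y - expTest t η ξ N y) ∂M.eventMeasure π
        + (η + ξ) * queueTransform π t - ξ * idleProb π|
      ≤ B * Real.exp (2 * D) *
        (|η + ξ| * (|η| * ∫ x, min x.2.1 N ∂(π : Measure QState)
            + |ξ| * ∫ x, min x.2.2 N ∂(π : Measure QState))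
          + |ξ| * (|η| * ∫ x in {x | x.1 = 0}, min x.2.1 N ∂(π : Measure QState)
            + |ξ| * ∫ x in {x | x.1 = 0}, min x.2.2 N ∂(π : Measure QState))
          + |η| * (π : Measure QState).real {x | N < x.2.1}
          + |ξ| * (π : Measure QState).real ({x | N < x.2.2} ∩ {x | x.1 = 0}ᶜ)) := by
  classical
  have hpA := IsProfile.exp_min η h.pos.le
  have hpV := IsProfile.exp_min ξ h.pos.le
  have hb := hπ.balance (fun l => Real.exp (t * l)) hpA hpV
  have htest := isTestPair_prod M.threshold (fun l => Real.exp (t * l)) hpA hpV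
  obtain ⟨C, hC⟩ := htest.bound
  set X : QState → ℝ := fun x => Real.exp (t * x.1) *
    ((if x.2.1 ≤ N then -η * Real.exp (-(η * x.2.1)) else 0) * Real.exp (-(ξ * min x.2.2 N))
      + if x.1 = 0 then 0 else Real.exp (-(η * min x.2.1 N)) *
        (if x.2.2 ≤ N then -ξ * Real.exp (-(ξ * x.2.2)) else 0)) with hX
  have hB1 := h.one_le
  have hqm : Measurable fun x : QState => Real.exp (t * x.1) :=
    (measurable_of_countable fun l : ℕ => Real.exp (t * l)).comp measurable_fst
  have iX : Integrable X (π : Measure QState) := by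
    have : Integrable (prodDeriv (fun l => Real.exp (t * l)) (fun a => Real.exp (-(η * min a N)))
        (fun a => if a ≤ N then -η * Real.exp (-(η * a)) else 0)
        (fun a => Real.exp (-(ξ * min a N)))
        (fun a => if a ≤ N then -ξ * Real.exp (-(ξ * a)) else 0)) (π : Measure QState) := by
      refine integrable_of_ae_bound htest.measurable_deriv (C := C) ?_
      filter_upwards [hπ.ae_mem] with x hx
      exact (hC _ (stateSpace_subset _ hx)).2
    exact this.neg.congr (ae_of_all _ fun x => by simp [prodDeriv, hX])
  have iq : Integrable (fun x : QState => Real.exp (t * x.1)) (π : Measure QState) := by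
    refine integrable_of_ae_bound hqm (C := B) ?_
    filter_upwards [hπ.ae_mem] with x hx
    rw [abs_of_pos (Real.exp_pos _)]
    exact h.queue _ hx.1
  have i0 : Integrable ({x : QState | x.1 = 0}.indicator fun _ => (1 : ℝ)) (π : Measure QState) :=
    (integrable_const 1).indicator measurableSet_empty
  have hGm : MeasurableSet {x : QState | N < x.2.1} :=
    measurableSet_lt measurable_const (by fun_prop)
  have hHm : MeasurableSet ({x : QState | N < x.2.2} ∩ {x | x.1 = 0}ᶜ) :=
    (measurableSet_lt measurable_const (by fun_prop)).inter measurableSet_empty.compl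
  have ia := hπ.integrable_min_arrival h.pos
  have iv := hπ.integrable_min_service h.pos
  have iG : Integrable ({x : QState | N < x.2.1}.indicator fun _ => (1 : ℝ)) (π : Measure QState) :=
    (integrable_const 1).indicator hGm
  have iH : Integrable (({x : QState | N < x.2.2} ∩ {x | x.1 = 0}ᶜ).indicator fun _ => (1 : ℝ))
    (π : Measure QState) := (integrable_const 1).indicator hHm
  set φ : QState → ℝ := fun x => |η| * min x.2.1 N + |ξ| * min x.2.2 N with hφ
  have iφ : Integrable φ (π : Measure QState) := (ia.const_mul _).add (iv.const_mul _)
  have iφ0 : Integrable ({x : QState | x.1 = 0}.indicator φ) (π : Measure QState) :=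
    iφ.indicator measurableSet_empty
  have iR1 : Integrable (fun x => |η + ξ| * φ x + |ξ| * {x : QState | x.1 = 0}.indicator φ x)
    (π : Measure QState) := (iφ.const_mul _).add (iφ0.const_mul _)
  have iR2 : Integrable (fun x => |η + ξ| * φ x + |ξ| * {x : QState | x.1 = 0}.indicator φ x
    + |η| * {x : QState | N < x.2.1}.indicator (fun _ => (1 : ℝ)) x) (π : Measure QState) :=
    iR1.add (iG.const_mul _)
  have iR3 : Integrable (fun x => |η + ξ| * φ x + |ξ| * {x : QState | x.1 = 0}.indicator φ x
    + |η| * {x : QState | N < x.2.1}.indicator (fun _ => (1 : ℝ)) x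
    + |ξ| * ({x : QState | N < x.2.2} ∩ {x | x.1 = 0}ᶜ).indicator (fun _ => (1 : ℝ)) x)
    (π : Measure QState) := iR2.add (iH.const_mul _)
  have hpt : ∀ᵐ x ∂(π : Measure QState), ‖X x + (η + ξ) * Real.exp (t * x.1)
      - ξ * {x : QState | x.1 = 0}.indicator (fun _ => (1 : ℝ)) x‖
      ≤ B * Real.exp (2 * D) * (|η + ξ| * φ x + |ξ| * {x : QState | x.1 = 0}.indicator φ x
        + |η| * {x : QState | N < x.2.1}.indicator (fun _ => (1 : ℝ)) x
        + |ξ| * ({x : QState | N < x.2.2} ∩ {x | x.1 = 0}ᶜ).indicator (fun _ => (1 : ℝ)) x) := by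
    filter_upwards [hπ.ae_mem] with x hx
    set AV := Real.exp (-(η * min x.2.1 N)) * Real.exp (-(ξ * min x.2.2 N)) with hAV
    have hq := h.queue x.1 hx.1
    have hq0 := Real.exp_pos (t * x.1)
    have hAV0 : 0 < AV := by positivity
    have hAVb : AV ≤ Real.exp (2 * D) := by
      have := mul_le_mul (ExpBound.exp_le h.pos h.arrival hx.2.1.le)
        (ExpBound.exp_le h.pos h.service hx.2.2.le) (Real.exp_pos _).le (Real.exp_pos _).le
      rwa [← Real.exp_add D D, ← two_mul] at this
    have hAV1 := h.abs_mul_exp_sub_one_le hx.2.1.le hx.2.2.le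
    rw [← hAV] at hAV1
    -- An exact pointwise decomposition into the four sources of error. On empty states `exp (t * l)
    -- = 1`, so the queue factor disappears there.
    have e : X x + (η + ξ) * Real.exp (t * x.1)
        - ξ * {x : QState | x.1 = 0}.indicator (fun _ => (1 : ℝ)) x
        = -((η + ξ) * (Real.exp (t * x.1) * (AV - 1)))
          + ξ * {x : QState | x.1 = 0}.indicator (fun _ => AV - 1) x
          + η * {x : QState | N < x.2.1}.indicator (fun _ => Real.exp (t * x.1) * AV) x
          + ξ * ({x : QState | N < x.2.2} ∩ {x | x.1 = 0}ᶜ).indicator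
            (fun _ => Real.exp (t * x.1) * AV) x := by
      have e1 : Real.exp (t * x.1) * ((if x.2.1 ≤ N then -η * Real.exp (-(η * x.2.1)) else 0)
          * Real.exp (-(ξ * min x.2.2 N))) = -(η * (Real.exp (t * x.1) * AV))
          + η * {x : QState | N < x.2.1}.indicator (fun _ => Real.exp (t * x.1) * AV) x := by
        by_cases h1 : x.2.1 ≤ N
        · rw [Set.indicator_of_notMem (by simpa using h1), if_pos h1, hAV, min_eq_left h1]; ring
        · rw [Set.indicator_of_mem (by simpa using h1), if_neg h1]; ring
      have e2 : Real.exp (t * x.1) * (if x.1 = 0 then 0 else Real.exp (-(η * min x.2.1 N)) *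
          (if x.2.2 ≤ N then -ξ * Real.exp (-(ξ * x.2.2)) else 0))
          = -(ξ * (Real.exp (t * x.1) * AV))
          + ξ * {x : QState | x.1 = 0}.indicator (fun _ => AV) x
          + ξ * ({x : QState | N < x.2.2} ∩ {x | x.1 = 0}ᶜ).indicator
            (fun _ => Real.exp (t * x.1) * AV) x := by
        by_cases h0 : x.1 = 0
        · simp [h0]
        · by_cases h1 : x.2.2 ≤ N
          · rw [Set.indicator_of_notMem (by simpa using h0), Set.indicator_of_notMem
              (by simp [h1]), if_neg h0, if_pos h1, hAV, min_eq_left h1]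
            ring
          · rw [Set.indicator_of_notMem (by simpa using h0), Set.indicator_of_mem
              (by simpa [h0] using h1), if_neg h0, if_neg h1]
            ring
      rw [hX]
      simp only
      rw [mul_add (Real.exp (t * x.1)), e1, e2]
      by_cases h0 : x.1 = 0
      · simp only [Set.indicator_of_mem (show x ∈ {x : QState | x.1 = 0} from h0)]
        ring
      · simp only [Set.indicator_of_notMem (show x ∉ {x : QState | x.1 = 0} from h0)]
        ring
    have hG0 : 0 ≤ B * Real.exp (2 * D) := by positivity
    have hg : |Real.exp (t * x.1) * (AV - 1)| ≤ B * Real.exp (2 * D) * φ x := by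
      rw [abs_mul, abs_of_pos hq0, mul_assoc]
      exact mul_le_mul hq hAV1 (abs_nonneg _) (by linarith)
    have hg' : |Real.exp (t * x.1) * AV| ≤ B * Real.exp (2 * D) := by
      rw [abs_of_pos (by positivity)]
      exact mul_le_mul hq hAVb hAV0.le (by linarith)
    have hg0 : |AV - 1| ≤ B * Real.exp (2 * D) * φ x := by
      rw [mul_assoc]
      exact hAV1.trans (le_mul_of_one_le_left ((abs_nonneg _).trans hAV1) hB1)
    have habs : ∀ (s : Set QState) (c d : ℝ), |c| ≤ d → |s.indicator (fun _ => c) x|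
        ≤ s.indicator (fun _ => d) x := by
      intro s c d hcd
      by_cases hx' : x ∈ s <;> simp [hx', hcd]
    have hscale : ∀ (s : Set QState) (d : ℝ), s.indicator (fun _ => d) x
        = d * s.indicator (fun _ => (1 : ℝ)) x := by
      intro s d
      by_cases hx' : x ∈ s <;> simp [hx']
    rw [Real.norm_eq_abs, e]
    refine (abs_add_le _ _).trans ((add_le_add ((abs_add_le _ _).trans (add_le_add
      ((abs_add_le _ _).trans (add_le_add ?_ ?_)) ?_)) ?_).trans_eq
      (show B * Real.exp (2 * D) * (|η + ξ| * φ x)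
        + B * Real.exp (2 * D) * (|ξ| * {x : QState | x.1 = 0}.indicator φ x)
        + B * Real.exp (2 * D) * (|η| * {x : QState | N < x.2.1}.indicator (fun _ => (1 : ℝ)) x)
        + B * Real.exp (2 * D) * (|ξ| * ({x : QState | N < x.2.2} ∩ {x | x.1 = 0}ᶜ).indicator
          (fun _ => (1 : ℝ)) x) = _ by ring))
    · rw [abs_neg, abs_mul]
      calc _ ≤ |η + ξ| * (B * Real.exp (2 * D) * φ x) :=
            mul_le_mul_of_nonneg_left hg (abs_nonneg _)
        _ = _ := by ring
    · rw [abs_mul]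
      calc _ ≤ |ξ| * {x : QState | x.1 = 0}.indicator (fun _ => B * Real.exp (2 * D) * φ x) x :=
            mul_le_mul_of_nonneg_left (habs _ _ _ hg0) (abs_nonneg _)
        _ = _ := by by_cases h0 : x.1 = 0 <;> simp [h0]; ring
    · rw [abs_mul]
      calc _ ≤ |η| * {x : QState | N < x.2.1}.indicator (fun _ => B * Real.exp (2 * D)) x :=
            mul_le_mul_of_nonneg_left (habs _ _ _ hg') (abs_nonneg _)
        _ = _ := by rw [hscale]; ring
    · rw [abs_mul]
      calc _ ≤ |ξ| * ({x : QState | N < x.2.2} ∩ {x | x.1 = 0}ᶜ).indicator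
              (fun _ => B * Real.exp (2 * D)) x :=
            mul_le_mul_of_nonneg_left (habs _ _ _ hg') (abs_nonneg _)
        _ = _ := by rw [hscale]; ring
  have iXq : Integrable (fun x => X x + (η + ξ) * Real.exp (t * x.1)) (π : Measure QState) :=
    iX.add (iq.const_mul _)
  have hle := norm_integral_le_of_norm_le (iR3.const_mul (B * Real.exp (2 * D))) hpt
  have hid : ∫ x, {x : QState | x.1 = 0}.indicator (fun _ => (1 : ℝ)) x ∂(π : Measure QState)
      = idleProb π := by
    rw [integral_indicator_const _ measurableSet_empty]; simp [idleProb]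
  have hXint : ∫ x, X x ∂(π : Measure QState)
      = ∫ y, (M.jumpMean (expTest t η ξ N) y - expTest t η ξ N y) ∂M.eventMeasure π := hb
  rw [integral_sub iXq (i0.const_mul ξ), integral_add iX (iq.const_mul _), integral_const_mul,
    integral_const_mul, hid, hXint, Real.norm_eq_abs, integral_const_mul,
    integral_add iR2 (iH.const_mul _), integral_add iR1 (iG.const_mul _),
    integral_add (iφ.const_mul _) (iφ0.const_mul _), integral_const_mul, integral_const_mul,
    integral_const_mul, integral_const_mul, integral_indicator measurableSet_empty,
    integral_indicator_const _ hGm, integral_indicator_const _ hHm, hφ,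
    integral_add (ia.const_mul _) (iv.const_mul _),
    integral_add (ia.const_mul _).integrableOn (iv.const_mul _).integrableOn, integral_const_mul,
    integral_const_mul, integral_const_mul, integral_const_mul, smul_eq_mul, smul_eq_mul, mul_one,
    mul_one] at hle
  exact hle

end IsStationary

end FiniteQueue

/-! ### The heavy traffic regime: smallness of the individual error terms. -/

namespace FiniteQueue


/-- Stationary queues in heavy traffic: the inter-arrival and service times have the same limit
mean `m`, and the thresholds are of the order `ℓ₀ / r`. -/
structure IsHeavyTraffic (R : Set ℝ) (M : ℝ → FiniteQueue) (π : ℝ → ProbabilityMeasure QState)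
    (m σ_e σ_s b ℓ₀ : ℝ) : Prop where
  arrival : IsTimeFamily R (fun r => (M r).interarrival) m σ_e
  service : IsTimeFamily R (fun r => (M r).service) m σ_s
  stationary : ∀ r ∈ R, (M r).IsStationary (π r)
  drift : Tendsto (fun r => ((lawMean (M r).service)⁻¹ - (lawMean (M r).interarrival)⁻¹) / r)
    (𝓝[R] 0) (𝓝 (m⁻¹ * b))
  level_pos : 0 < ℓ₀
  tendsto_level : Tendsto (fun r => r * ((M r).threshold : ℝ)) (𝓝[R] 0) (𝓝 ℓ₀)

namespace IsHeavyTraffic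

open FiniteQueue.IsStationary

variable {R : Set ℝ} {M : ℝ → FiniteQueue} {π : ℝ → ProbabilityMeasure QState}
  {m σ_e σ_s b ℓ₀ : ℝ}

/-- Scaled probability of an empty system. -/
noncomputable def idle (π : ℝ → ProbabilityMeasure QState) (r : ℝ) : ℝ := idleProb (π r) / r

/-- Scaled rate of lost customers. -/
noncomputable def loss (M : ℝ → FiniteQueue) (π : ℝ → ProbabilityMeasure QState) (r : ℝ) : ℝ :=
  (M r).lossRate (π r) / r

/-- Scaled Palm probability of a loss. -/
noncomputable def palmLoss (M : ℝ → FiniteQueue) (π : ℝ → ProbabilityMeasure QState) (r : ℝ) : ℝ :=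
  lawMean (M r).interarrival * loss M π r

/-- Scale of the unknown boundary probabilities. -/
noncomputable def weight (M : ℝ → FiniteQueue) (π : ℝ → ProbabilityMeasure QState) (r : ℝ) : ℝ :=
  1 + idle π r + palmLoss M π r

lemma mean_arrival_nonneg (M : ℝ → FiniteQueue) (r : ℝ) : 0 ≤ lawMean (M r).interarrival :=
  integral_nonneg_of_ae (by
    filter_upwards [(M r).interarrival_pos] with x hx using hx.le)

/-- Lets `r → 0` before `δ → 0`: the truncation level, and with it `K`, may depend on `δ`, while `C`
may not. -/
lemma tendsto_zero_of_tail {R : Set ℝ} {e : ℝ → ℝ} (C : ℝ)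
    (h : ∀ δ, 0 < δ → ∃ K, ∀ᶠ r in 𝓝[R] (0 : ℝ), |e r| ≤ K * r + C * δ) :
    Tendsto e (𝓝[R] 0) (𝓝 0) := by
  rw [Metric.tendsto_nhds]
  intro ε hε
  obtain ⟨K, hK⟩ := h (ε / (2 * (|C| + 1))) (by positivity)
  have h1 : ∀ᶠ r in 𝓝[R] (0 : ℝ), K * r < ε / 2 := by
    have : Tendsto (fun r : ℝ => K * r) (𝓝[R] 0) (𝓝 (K * 0)) :=
      (IsTimeFamily.tendsto_self R).const_mul _
    rw [mul_zero] at this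
    exact this.eventually_lt_const (half_pos hε)
  have h2 : C * (ε / (2 * (|C| + 1))) ≤ ε / 2 := by
    have : C * (ε / (2 * (|C| + 1))) = (C / (|C| + 1)) * (ε / 2) := by field_simp
    rw [this]
    refine mul_le_of_le_one_left (by linarith) ?_
    rw [div_le_one (by positivity)]
    linarith [le_abs_self C]
  filter_upwards [hK, h1] with r hr hr1
  rw [Real.dist_eq, sub_zero]
  linarith

lemma mem_pos (H : IsHeavyTraffic R M π m σ_e σ_s b ℓ₀) {r : ℝ} (hr : r ∈ R) : 0 < r :=
  (H.arrival.subset hr).1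

lemma idle_nonneg (H : IsHeavyTraffic R M π m σ_e σ_s b ℓ₀) {r : ℝ} (hr : r ∈ R) : 0 ≤ idle π r :=
  div_nonneg measureReal_nonneg (H.mem_pos hr).le

lemma loss_nonneg (H : IsHeavyTraffic R M π m σ_e σ_s b ℓ₀) {r : ℝ} (hr : r ∈ R) : 0 ≤ loss M π r :=
  div_nonneg measureReal_nonneg (H.mem_pos hr).le

lemma palmLoss_nonneg (H : IsHeavyTraffic R M π m σ_e σ_s b ℓ₀) {r : ℝ} (hr : r ∈ R) :
    0 ≤ palmLoss M π r :=
  mul_nonneg (mean_arrival_nonneg M r) (H.loss_nonneg hr)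

lemma one_le_weight (H : IsHeavyTraffic R M π m σ_e σ_s b ℓ₀) {r : ℝ} (hr : r ∈ R) :
    1 ≤ weight M π r := by
  unfold weight; linarith [H.idle_nonneg hr, H.palmLoss_nonneg hr]

lemma idle_le_weight (H : IsHeavyTraffic R M π m σ_e σ_s b ℓ₀) {r : ℝ} (hr : r ∈ R) :
    idle π r ≤ weight M π r := by
  unfold weight; linarith [H.palmLoss_nonneg hr]

lemma palmLoss_le_weight (H : IsHeavyTraffic R M π m σ_e σ_s b ℓ₀) {r : ℝ} (hr : r ∈ R) :
    palmLoss M π r ≤ weight M π r := by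
  unfold weight; linarith [H.idle_nonneg hr]

lemma arrivalRate_eq (H : IsHeavyTraffic R M π m σ_e σ_s b ℓ₀) {r : ℝ} (hr : r ∈ R) :
    (M r).arrivalRate (π r) = (lawMean (M r).interarrival)⁻¹ :=
  eq_inv_of_mul_eq_one_left ((H.stationary r hr).arrivalRate_mul_mean (H.arrival.integrable_sq hr))

lemma tendsto_arrivalRate (H : IsHeavyTraffic R M π m σ_e σ_s b ℓ₀) :
    Tendsto (fun r => (M r).arrivalRate (π r)) (𝓝[R] 0) (𝓝 m⁻¹) := by
  refine (H.arrival.tendsto_mean.inv₀ H.arrival.mean_pos.ne').congr' ?_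
  filter_upwards [IsTimeFamily.eventually_mem R] with r hr
  exact (H.arrivalRate_eq hr).symm

lemma serviceRate_le (H : IsHeavyTraffic R M π m σ_e σ_s b ℓ₀) {r : ℝ} (hr : r ∈ R) :
    (M r).serviceRate (π r) ≤ (M r).arrivalRate (π r) := by
  rw [(H.stationary r hr).serviceRate_eq]
  linarith [measureReal_nonneg (μ := (M r).eventMeasure (π r)) (s := (M r).fullSet ∩ arrivalSet),
    show (M r).lossRate (π r)
      = ((M r).eventMeasure (π r)).real ((M r).fullSet ∩ arrivalSet) from rfl]

lemma eventually_arrivalRate_le (H : IsHeavyTraffic R M π m σ_e σ_s b ℓ₀) :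
    ∀ᶠ r in 𝓝[R] (0 : ℝ), (M r).arrivalRate (π r) ≤ m⁻¹ + 1 :=
  H.tendsto_arrivalRate.eventually_le_const (by linarith)

lemma loss_eq (H : IsHeavyTraffic R M π m σ_e σ_s b ℓ₀) {r : ℝ} (hr : r ∈ R) :
    loss M π r = (M r).arrivalRate (π r) * palmLoss M π r := by
  have h := (H.stationary r hr).arrivalRate_mul_mean (H.arrival.integrable_sq hr)
  rw [palmLoss, ← mul_assoc, h, one_mul]

/-- Uniform smallness of the tails at a level that is eventually below `1 / r`. -/
lemma exists_level (H : IsHeavyTraffic R M π m σ_e σ_s b ℓ₀) {δ : ℝ} (hδ : 0 < δ) : ∃ K : ℝ, 1 ≤ K ∧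
    (∀ r ∈ R, sqTail ((M r).interarrival : Measure ℝ) K ≤ δ) ∧
    (∀ r ∈ R, sqTail ((M r).service : Measure ℝ) K ≤ δ) ∧ ∀ᶠ r in 𝓝[R] (0 : ℝ), K ≤ r⁻¹ := by
  obtain ⟨K₁, h1, hK₁⟩ := H.arrival.exists_sqTail_le hδ
  obtain ⟨K₂, h2, hK₂⟩ := H.service.exists_sqTail_le hδ
  exact ⟨max K₁ K₂, h1.trans (le_max_left _ _), hK₁ _ (le_max_left _ _), hK₂ _ (le_max_right _ _),
    H.arrival.eventually_le_inv _⟩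

lemma tendsto_mul_min_arrival (H : IsHeavyTraffic R M π m σ_e σ_s b ℓ₀) :
    Tendsto (fun r => r * ∫ x, min x.2.1 r⁻¹ ∂(π r : Measure QState)) (𝓝[R] 0) (𝓝 0) := by
  refine tendsto_zero_of_tail 0 fun δ hδ => ?_
  obtain ⟨K, hK1, hKe, -, hKr⟩ := H.exists_level hδ
  refine ⟨K + 3 / 2 * (m⁻¹ + 1) * δ, ?_⟩
  filter_upwards [hKr, IsTimeFamily.eventually_mem R, H.eventually_arrivalRate_le] with r hr hrR hΛ
  have hr0 := H.mem_pos hrR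
  have hst := H.stationary r hrR
  have h1 := hst.setIntegral_min_arrival_le (H.arrival.integrable_sq hrR) (by linarith) hr Set.univ
  rw [setIntegral_univ, probReal_univ, mul_one] at h1
  have h0 : 0 ≤ ∫ x, min x.2.1 r⁻¹ ∂(π r : Measure QState) := integral_nonneg_of_ae (by
    filter_upwards [hst.ae_mem] with x hx
    exact le_min hx.2.1.le (inv_nonneg.2 hr0.le))
  rw [abs_of_nonneg (mul_nonneg hr0.le h0), zero_mul, add_zero, mul_comm]
  refine mul_le_mul_of_nonneg_right (h1.trans ?_) hr0.le
  have hT := sqTail_nonneg ((M r).interarrival : Measure ℝ) K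
  have := mul_le_mul hΛ (hKe r hrR) hT (by have := H.arrival.mean_pos; positivity)
  nlinarith

lemma eventually_mean_service_le (H : IsHeavyTraffic R M π m σ_e σ_s b ℓ₀) :
    ∀ᶠ r in 𝓝[R] (0 : ℝ), lawMean (M r).service ≤ m + 1 :=
  H.service.tendsto_mean.eventually_le_const (by linarith)

lemma tendsto_mul_min_service (H : IsHeavyTraffic R M π m σ_e σ_s b ℓ₀) :
    Tendsto (fun r => r * ∫ x, min x.2.2 r⁻¹ ∂(π r : Measure QState)) (𝓝[R] 0) (𝓝 0) := by
  refine tendsto_zero_of_tail 0 fun δ hδ => ?_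
  obtain ⟨K, hK1, -, hKs, hKr⟩ := H.exists_level hδ
  refine ⟨K + 3 / 2 * (m⁻¹ + 1) * δ + (m + 1), ?_⟩
  filter_upwards [hKr, IsTimeFamily.eventually_mem R, H.eventually_arrivalRate_le,
    H.eventually_mean_service_le] with r hr hrR hΛ hms
  have hr0 := H.mem_pos hrR
  have hst := H.stationary r hrR
  have h1 := hst.integral_min_service_le (H.service.integrable_sq hrR) (by linarith) hr
  have h0 : 0 ≤ ∫ x, min x.2.2 r⁻¹ ∂(π r : Measure QState) := integral_nonneg_of_ae (by
    filter_upwards [hst.ae_mem] with x hx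
    exact le_min hx.2.2.le (inv_nonneg.2 hr0.le))
  rw [abs_of_nonneg (mul_nonneg hr0.le h0), zero_mul, add_zero, mul_comm]
  refine mul_le_mul_of_nonneg_right (h1.trans ?_) hr0.le
  have hT := sqTail_nonneg ((M r).service : Measure ℝ) K
  have := mul_le_mul ((H.serviceRate_le hrR).trans hΛ) (hKs r hrR) hT
    (by have := H.arrival.mean_pos; positivity)
  nlinarith

lemma idleProb_le_weight (H : IsHeavyTraffic R M π m σ_e σ_s b ℓ₀) {r : ℝ} (hr : r ∈ R) :
    idleProb (π r) ≤ r * weight M π r := by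
  have h1 := H.idle_le_weight hr
  rw [idle, div_le_iff₀ (H.mem_pos hr)] at h1
  linarith

/-- By definition of `weight` the probability of an empty system is at most `r * weight`, so below
the level `K` the integral is `O(r)` relative to `weight`; above `K` it is a tail. -/
lemma tendsto_idle_min_arrival (H : IsHeavyTraffic R M π m σ_e σ_s b ℓ₀) :
    Tendsto (fun r => (∫ x in {x | x.1 = 0}, min x.2.1 r⁻¹ ∂(π r : Measure QState)) / weight M π r)
      (𝓝[R] 0) (𝓝 0) := by
  refine tendsto_zero_of_tail (3 / 2 * (m⁻¹ + 1)) fun δ hδ => ?_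
  obtain ⟨K, hK1, hKe, -, hKr⟩ := H.exists_level hδ
  refine ⟨K, ?_⟩
  filter_upwards [hKr, IsTimeFamily.eventually_mem R, H.eventually_arrivalRate_le] with r hr hrR hΛ
  have hr0 := H.mem_pos hrR
  have hst := H.stationary r hrR
  have hw := H.one_le_weight hrR
  have h1 := hst.setIntegral_min_arrival_le (H.arrival.integrable_sq hrR) (by linarith) hr
    {x | x.1 = 0}
  have h0 : 0 ≤ ∫ x in {x | x.1 = 0}, min x.2.1 r⁻¹ ∂(π r : Measure QState) :=
    integral_nonneg_of_ae (by
      filter_upwards [ae_restrict_of_ae hst.ae_mem] with x hx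
      exact le_min hx.2.1.le (inv_nonneg.2 hr0.le))
  have hT := sqTail_nonneg ((M r).interarrival : Measure ℝ) K
  have hm := H.arrival.mean_pos
  have h2 := mul_le_mul hΛ (hKe r hrR) hT (by positivity)
  have h3 : K * (π r : Measure QState).real {x | x.1 = 0} ≤ K * (r * weight M π r) :=
    mul_le_mul_of_nonneg_left (H.idleProb_le_weight hrR) (by linarith)
  have h4 : 3 / 2 * (m⁻¹ + 1) * δ ≤ 3 / 2 * (m⁻¹ + 1) * δ * weight M π r :=
    le_mul_of_one_le_right (by positivity) hw
  rw [abs_of_nonneg (div_nonneg h0 (by linarith)), div_le_iff₀ (by linarith)]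
  nlinarith

lemma tendsto_idle_min_service (H : IsHeavyTraffic R M π m σ_e σ_s b ℓ₀) :
    Tendsto (fun r => (∫ x in {x | x.1 = 0}, min x.2.2 r⁻¹ ∂(π r : Measure QState)) / weight M π r)
      (𝓝[R] 0) (𝓝 0) := by
  refine tendsto_zero_of_tail 0 fun δ hδ => ⟨m + 1, ?_⟩
  filter_upwards [IsTimeFamily.eventually_mem R, H.eventually_mean_service_le] with r hrR hms
  have hr0 := H.mem_pos hrR
  have hst := H.stationary r hrR
  have hw := H.one_le_weight hrR
  have h1 := hst.setIntegral_idle_min_service_le (H.service.integrable_sq hrR) (inv_pos.2 hr0)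
  have h0 : 0 ≤ ∫ x in {x | x.1 = 0}, min x.2.2 r⁻¹ ∂(π r : Measure QState) :=
    integral_nonneg_of_ae (by
      filter_upwards [ae_restrict_of_ae hst.ae_mem] with x hx
      exact le_min hx.2.2.le (inv_nonneg.2 hr0.le))
  rw [abs_of_nonneg (div_nonneg h0 (by linarith)), div_le_iff₀ (by linarith), zero_mul, add_zero]
  have hp0 : 0 ≤ idleProb (π r) := measureReal_nonneg
  have hm := H.arrival.mean_pos
  calc _ ≤ idleProb (π r) * lawMean (M r).service := h1
    _ ≤ (r * weight M π r) * (m + 1) := by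
      refine (mul_le_mul_of_nonneg_left hms hp0).trans
        (mul_le_mul_of_nonneg_right (H.idleProb_le_weight hrR) (by linarith))
    _ = _ := by ring

lemma tendsto_arrival_gt (H : IsHeavyTraffic R M π m σ_e σ_s b ℓ₀) :
    Tendsto (fun r => (π r : Measure QState).real {x | r⁻¹ < x.2.1} / r) (𝓝[R] 0) (𝓝 0) := by
  have hlim := H.tendsto_arrivalRate.mul H.arrival.tendsto_sqTail
  rw [mul_zero] at hlim
  refine tendsto_of_tendsto_of_tendsto_of_le_of_le' tendsto_const_nhds hlim ?_ ?_
  · filter_upwards [IsTimeFamily.eventually_mem R] with r hr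
    exact div_nonneg measureReal_nonneg (H.mem_pos hr).le
  · filter_upwards [IsTimeFamily.eventually_mem R] with r hr
    have hr0 := H.mem_pos hr
    have := (H.stationary r hr).measureReal_arrival_gt_le (H.arrival.integrable_sq hr)
      (inv_pos.2 hr0)
    rw [inv_inv] at this
    rw [div_le_iff₀ hr0]
    linarith

lemma tendsto_service_gt (H : IsHeavyTraffic R M π m σ_e σ_s b ℓ₀) :
    Tendsto (fun r => (π r : Measure QState).real ({x | r⁻¹ < x.2.2} ∩ {x | x.1 = 0}ᶜ) / r)
      (𝓝[R] 0) (𝓝 0) := by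
  have hlim := H.tendsto_arrivalRate.mul H.service.tendsto_sqTail
  rw [mul_zero] at hlim
  refine tendsto_of_tendsto_of_tendsto_of_le_of_le' tendsto_const_nhds hlim ?_ ?_
  · filter_upwards [IsTimeFamily.eventually_mem R] with r hr
    exact div_nonneg measureReal_nonneg (H.mem_pos hr).le
  · filter_upwards [IsTimeFamily.eventually_mem R] with r hr
    have hr0 := H.mem_pos hr
    have h1 := (H.stationary r hr).measureReal_service_gt_le (H.service.integrable_sq hr)
      (inv_pos.2 hr0)
    rw [inv_inv] at h1
    have h2 := mul_le_mul_of_nonneg_right (H.serviceRate_le hr)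
      (mul_nonneg hr0.le (sqTail_nonneg ((M r).service : Measure ℝ) r⁻¹))
    rw [div_le_iff₀ hr0]
    linarith

lemma lossRate_le_weight (H : IsHeavyTraffic R M π m σ_e σ_s b ℓ₀) {r : ℝ} (hr : r ∈ R) :
    (M r).lossRate (π r) ≤ (M r).arrivalRate (π r) * (r * weight M π r) := by
  have hr0 := H.mem_pos hr
  have h1 := H.loss_eq hr
  have h2 : (M r).lossRate (π r) = loss M π r * r := by
    rw [loss, div_mul_cancel₀ _ hr0.ne']
  have h3 : 0 ≤ (M r).arrivalRate (π r) := measureReal_nonneg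
  rw [h2, h1]
  have := mul_le_mul_of_nonneg_left (H.palmLoss_le_weight hr) h3
  nlinarith

/-- The residual service time at lost arrivals has no influence in the limit. -/
lemma tendsto_full_sub (H : IsHeavyTraffic R M π m σ_e σ_s b ℓ₀)
    {ξ : ℝ → ℝ} {D : ℝ} (hξ : ∀ᶠ r in 𝓝[R] (0 : ℝ), |ξ r / r| ≤ D) :
    Tendsto (fun r => ((∫ y in (M r).fullSet ∩ arrivalSet, Real.exp (-(ξ r * min y.2.2 r⁻¹))
      ∂(M r).eventMeasure (π r)) - (M r).lossRate (π r)) / (r * weight M π r)) (𝓝[R] 0) (𝓝 0) := by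
  have hm := H.arrival.mean_pos
  by_cases hD : 0 ≤ D
  swap
  · refine tendsto_const_nhds.congr' ?_
    filter_upwards [hξ] with r hr
    exact absurd ((abs_nonneg _).trans hr) hD
  refine tendsto_zero_of_tail (Real.exp D * D * ((5 / 2 * (m⁻¹ + 1) + 1) * (4 / m)))
    fun δ hδ => ?_
  -- The second bound `m / 4` keeps the truncated mean inter-arrival time away from zero: it is at
  -- least `m / 2 - m / 4`, and `mul_integral_arrival_le` is divided by it.
  obtain ⟨K, hK1, hKe, hKs, hKr⟩ := H.exists_level (δ := min δ (m / 4)) (lt_min hδ (by linarith))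
  refine ⟨Real.exp D * D * (K * (m⁻¹ + 1)), ?_⟩
  filter_upwards [hKr, IsTimeFamily.eventually_mem R, H.eventually_arrivalRate_le, hξ,
    H.arrival.tendsto_mean.eventually_const_le (show m / 2 < m by linarith)]
    with r hr hrR hΛ hξr hme
  have hr0 := H.mem_pos hrR
  have hst := H.stationary r hrR
  have hw := H.one_le_weight hrR
  have hξD : |ξ r| ≤ D * r := by
    rwa [abs_div, abs_of_pos hr0, div_le_iff₀ hr0] at hξr
  have hK0 : 0 < K := by linarith
  have hδ' : min δ (m / 4) ≤ δ := min_le_left _ _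
  have hδ'' : min δ (m / 4) ≤ m / 4 := min_le_right _ _
  set Z := ∫ y in arrivalSet, (min y.2.2 r⁻¹ - min y.2.2 K) ∂(M r).eventMeasure (π r)
  have hZ0 : 0 ≤ Z := integral_nonneg fun y => sub_nonneg.2 (min_le_min_left _ hr)
  -- Only the service factor matters at this point, so the queue and arrival exponents are set to
  -- zero.
  have hbd : ExpBound (M r).threshold 0 0 (ξ r) r⁻¹ 1 D :=
    { pos := inv_pos.2 hr0
      arrival := by simpa using hD
      service := by rwa [← div_eq_mul_inv, div_le_iff₀ hr0]
      queue := fun l _ => by simp }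
  have h1 := hst.abs_integral_full_sub_le hbd hK0 hr
  have h2 := hst.mul_integral_arrival_le (H.service.integrable_sq hrR) hK1 hr
  have h3 := integral_sub_min_le (H.arrival.integrable_sq hrR) (M r).interarrival_pos hK0
  have h4 : K⁻¹ * sqTail ((M r).interarrival : Measure ℝ) K ≤ m / 4 :=
    (mul_le_of_le_one_left (sqTail_nonneg _ _) (inv_le_one_of_one_le₀ hK1)).trans
      ((hKe r hrR).trans hδ'')
  have h5 : m / 4 ≤ ∫ x, min x K ∂((M r).interarrival : Measure ℝ) := by
    have : m / 2 ≤ ∫ x, x ∂((M r).interarrival : Measure ℝ) := hme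
    linarith
  have h6 : m / 4 * Z ≤ (5 / 2 * (m⁻¹ + 1) + 1) * δ := by
    refine (mul_le_mul_of_nonneg_right h5 hZ0).trans (h2.trans ?_)
    refine mul_le_mul ?_ ((hKs r hrR).trans hδ') (sqTail_nonneg _ _) (by positivity)
    linarith [H.serviceRate_le hrR]
  have h7 : Z ≤ (5 / 2 * (m⁻¹ + 1) + 1) * (4 / m) * δ := by
    have : Z = 4 / m * (m / 4 * Z) := by field_simp
    rw [this]
    calc _ ≤ 4 / m * ((5 / 2 * (m⁻¹ + 1) + 1) * δ) :=
          mul_le_mul_of_nonneg_left h6 (by positivity)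
      _ = _ := by ring
  have hJ0 : 0 ≤ (M r).lossRate (π r) := measureReal_nonneg
  have h8 : (M r).lossRate (π r) ≤ (m⁻¹ + 1) * (r * weight M π r) :=
    (H.lossRate_le_weight hrR).trans (mul_le_mul_of_nonneg_right hΛ (by positivity))
  have h9 : Z ≤ (5 / 2 * (m⁻¹ + 1) + 1) * (4 / m) * δ * weight M π r :=
    h7.trans (le_mul_of_one_le_right (by positivity) hw)
  rw [abs_div, abs_of_pos (show 0 < r * weight M π r by positivity),
    div_le_iff₀ (by positivity)]
  refine h1.trans ?_
  calc Real.exp D * |ξ r| * (K * (M r).lossRate (π r) + Z)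
      ≤ Real.exp D * (D * r) * (K * ((m⁻¹ + 1) * (r * weight M π r))
        + (5 / 2 * (m⁻¹ + 1) + 1) * (4 / m) * δ * weight M π r) := by
        gcongr
    _ = _ := by ring

/-- The exponents for `θ` and `-θ` cancel to first order up to the difference of the rates, which is
of order `r` and produces `-θ * b`; the quadratic corrections add up to the variance term. -/
lemma tendsto_drift (H : IsHeavyTraffic R M π m σ_e σ_s b ℓ₀) (θ : ℝ) :
    Tendsto (fun r => (IsTimeFamily.exponent (fun r => (M r).interarrival) m σ_e θ r
      + IsTimeFamily.exponent (fun r => (M r).service) m σ_s (-θ) r) / r ^ 2) (𝓝[R] 0)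
      (𝓝 (m⁻¹ * (θ ^ 2 * ((σ_e ^ 2 + σ_s ^ 2) / m ^ 2) / 2 - θ * b))) := by
  have h1 := (H.drift.const_mul (-θ)).add_const (θ ^ 2 * (σ_e ^ 2 + σ_s ^ 2) / (2 * m ^ 3))
  have hm := H.arrival.mean_pos
  have e : -θ * (m⁻¹ * b) + θ ^ 2 * (σ_e ^ 2 + σ_s ^ 2) / (2 * m ^ 3)
      = m⁻¹ * (θ ^ 2 * ((σ_e ^ 2 + σ_s ^ 2) / m ^ 2) / 2 - θ * b) := by
    field_simp; ring
  rw [e] at h1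
  refine h1.congr' ?_
  filter_upwards [IsTimeFamily.eventually_mem R] with r hr
  have hr0 := (H.mem_pos hr).ne'
  unfold IsTimeFamily.exponent
  field_simp
  ring

lemma tendsto_exp_level (H : IsHeavyTraffic R M π m σ_e σ_s b ℓ₀) (θ : ℝ) :
    Tendsto (fun r => Real.exp (θ * r * (M r).threshold)) (𝓝[R] 0) (𝓝 (Real.exp (θ * ℓ₀))) := by
  have := (H.tendsto_level.const_mul θ).rexp
  refine this.congr fun r => ?_
  rw [mul_assoc]

lemma eventually_exp_le (H : IsHeavyTraffic R M π m σ_e σ_s b ℓ₀) (θ : ℝ) :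
    ∀ᶠ r in 𝓝[R] (0 : ℝ), ∀ l : ℕ, l ≤ (M r).threshold →
    Real.exp (θ * r * l) ≤ Real.exp (|θ| * (ℓ₀ + 1)) := by
  filter_upwards [IsTimeFamily.eventually_mem R,
    H.tendsto_level.eventually_le_const (show ℓ₀ < ℓ₀ + 1 by linarith)] with r hr hl l hlM
  have hr0 := H.mem_pos hr
  rw [Real.exp_le_exp, mul_assoc]
  have h1 : r * (l : ℝ) ≤ ℓ₀ + 1 :=
    (mul_le_mul_of_nonneg_left (Nat.cast_le.2 hlM) hr0.le).trans hl
  have h2 : 0 ≤ r * (l : ℝ) := by positivity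
  exact mul_le_mul (le_abs_self θ) h1 h2 (abs_nonneg _)

lemma eventually_queueTransform_le (H : IsHeavyTraffic R M π m σ_e σ_s b ℓ₀) (θ : ℝ) :
    ∀ᶠ r in 𝓝[R] (0 : ℝ),
    |queueTransform (π r) (θ * r)| ≤ Real.exp (|θ| * (ℓ₀ + 1)) := by
  filter_upwards [IsTimeFamily.eventually_mem R, H.eventually_exp_le θ] with r hr hl
  have := norm_integral_le_of_norm_le_const (μ := (π r : Measure QState))
    (f := fun x : QState => Real.exp (θ * r * x.1)) (C := Real.exp (|θ| * (ℓ₀ + 1))) (by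
      filter_upwards [(H.stationary r hr).ae_mem] with x hx
      rw [Real.norm_eq_abs, abs_of_pos (Real.exp_pos _)]
      exact hl _ hx.1)
  simpa [queueTransform] using this

end IsHeavyTraffic

end FiniteQueue

/-! ### The asymptotic boundary equation and the bound on `weight`. -/

namespace FiniteQueue.IsHeavyTraffic

open FiniteQueue.IsStationary

variable {R : Set ℝ} {M : ℝ → FiniteQueue} {π : ℝ → ProbabilityMeasure QState}
  {m σ_e σ_s b ℓ₀ : ℝ}

/-- Exponent of the residual inter-arrival time in the test function. -/
noncomputable def arrivalExponent (M : ℝ → FiniteQueue) (m σ_e θ r : ℝ) : ℝ :=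
  IsTimeFamily.exponent (fun r => (M r).interarrival) m σ_e θ r

/-- Exponent of the residual service time in the test function. -/
noncomputable def serviceExponent (M : ℝ → FiniteQueue) (m σ_s θ r : ℝ) : ℝ :=
  IsTimeFamily.exponent (fun r => (M r).service) m σ_s (-θ) r

/-- Integral of the jumps of the test function. -/
noncomputable def jumpIntegral (M : ℝ → FiniteQueue) (π : ℝ → ProbabilityMeasure QState)
    (m σ_e σ_s θ r : ℝ) : ℝ :=
  ∫ y, ((M r).jumpMean (expTest (θ * r) (arrivalExponent M m σ_e θ r)
      (serviceExponent M m σ_s θ r) r⁻¹) y - expTest (θ * r) (arrivalExponent M m σ_e θ r)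
      (serviceExponent M m σ_s θ r) r⁻¹ y) ∂(M r).eventMeasure (π r)

lemma eventually_expBound (H : IsHeavyTraffic R M π m σ_e σ_s b ℓ₀) (θ : ℝ) :
    ∀ᶠ r in 𝓝[R] (0 : ℝ), ExpBound (M r).threshold (θ * r) (arrivalExponent M m σ_e θ r)
      (serviceExponent M m σ_s θ r) r⁻¹ (Real.exp (|θ| * (ℓ₀ + 1))) (|θ * m⁻¹| + 1) := by
  have h1 := (H.arrival.tendsto_exponent_div θ).abs.eventually_le_const
    (show |θ * m⁻¹| < |θ * m⁻¹| + 1 by linarith)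
  have h2 := (H.service.tendsto_exponent_div (-θ)).abs.eventually_le_const
    (show |-θ * m⁻¹| < |θ * m⁻¹| + 1 by rw [neg_mul, abs_neg]; linarith)
  filter_upwards [h1, h2, IsTimeFamily.eventually_mem R, H.eventually_exp_le θ] with r h1 h2 hr hl
  have hr0 := H.mem_pos hr
  rw [abs_div, abs_of_pos hr0, div_eq_mul_inv] at h1 h2
  exact ⟨inv_pos.2 hr0, h1, h2, hl⟩

/-- Drift side of the balance, to precision `o(r² weight)`. As `η + ξ` is of order `r²`, bounded
truncated residual times suffice in its error term; the error on empty states carries only a product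
of two exponents and must gain its `o(weight)` from the integral over these states. -/
lemma tendsto_jumpIntegral_add_drift (H : IsHeavyTraffic R M π m σ_e σ_s b ℓ₀) (θ : ℝ) :
    Tendsto (fun r => (jumpIntegral M π m σ_e σ_s θ r
      + (arrivalExponent M m σ_e θ r + serviceExponent M m σ_s θ r)
        * queueTransform (π r) (θ * r)
      - serviceExponent M m σ_s θ r * idleProb (π r)) / (r ^ 2 * weight M π r)) (𝓝[R] 0) (𝓝 0) := by
  set η := arrivalExponent M m σ_e θ with hη
  set ξ := serviceExponent M m σ_s θ with hξ
  set C := Real.exp (|θ| * (ℓ₀ + 1)) * Real.exp (2 * (|θ * m⁻¹| + 1)) with hC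
  have hηr : Tendsto (fun r => |η r / r|) (𝓝[R] 0) (𝓝 |θ * m⁻¹|) :=
    (H.arrival.tendsto_exponent_div θ).abs
  have hξr : Tendsto (fun r => |ξ r / r|) (𝓝[R] 0) (𝓝 |-θ * m⁻¹|) :=
    (H.service.tendsto_exponent_div (-θ)).abs
  have hd := (H.tendsto_drift θ).abs
  have hlim := ((((hd.mul ((hηr.mul H.tendsto_mul_min_arrival).add
    (hξr.mul H.tendsto_mul_min_service))).add (hξr.mul ((hηr.mul H.tendsto_idle_min_arrival).add
    (hξr.mul H.tendsto_idle_min_service)))).add (hηr.mul H.tendsto_arrival_gt)).add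
    (hξr.mul H.tendsto_service_gt)).const_mul C
  simp only [mul_zero, add_zero] at hlim
  refine squeeze_zero_norm' ?_ hlim
  filter_upwards [H.eventually_expBound θ, IsTimeFamily.eventually_mem R] with r hB hr
  have hr0 := H.mem_pos hr
  have hst := H.stationary r hr
  have hw := H.one_le_weight hr
  have hmain := hst.abs_integral_drift_sub_le hB
  have n1 : 0 ≤ ∫ x, min x.2.1 r⁻¹ ∂(π r : Measure QState) := integral_nonneg_of_ae (by
    filter_upwards [hst.ae_mem] with x hx using le_min hx.2.1.le (inv_nonneg.2 hr0.le))
  have n2 : 0 ≤ ∫ x, min x.2.2 r⁻¹ ∂(π r : Measure QState) := integral_nonneg_of_ae (by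
    filter_upwards [hst.ae_mem] with x hx using le_min hx.2.2.le (inv_nonneg.2 hr0.le))
  rw [Real.norm_eq_abs, abs_div, abs_of_pos (show 0 < r ^ 2 * weight M π r by positivity),
    div_le_iff₀ (by positivity)]
  refine hmain.trans ?_
  have hw0 : weight M π r ≠ 0 := by positivity
  have eη : |η r| = |η r / r| * r := by rw [abs_div, abs_of_pos hr0, div_mul_cancel₀ _ hr0.ne']
  have eξ : |ξ r| = |ξ r / r| * r := by rw [abs_div, abs_of_pos hr0, div_mul_cancel₀ _ hr0.ne']
  have ed : |η r + ξ r| = |(η r + ξ r) / r ^ 2| * r ^ 2 := by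
    rw [abs_div, abs_of_pos (pow_pos hr0 2), div_mul_cancel₀ _ (pow_pos hr0 2).ne']
  change C * (|η r + ξ r| * (|η r| * _ + |ξ r| * _) + |ξ r| * (|η r| * _ + |ξ r| * _)
    + |η r| * _ + |ξ r| * _) ≤ C * (|(η r + ξ r) / r ^ 2| * _ + _ + _ + _) * _
  rw [eη, eξ, ed]
  set ρ := |η r / r|
  set τ := |ξ r / r|
  set κ := |(η r + ξ r) / r ^ 2|
  set W := weight M π r
  have hρ : 0 ≤ ρ := abs_nonneg _
  have hτ : 0 ≤ τ := abs_nonneg _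
  have hκ : 0 ≤ κ := abs_nonneg _
  have hC0 : 0 ≤ C := by positivity
  generalize (∫ x, min x.2.1 r⁻¹ ∂(π r : Measure QState)) = a at n1 ⊢
  generalize (∫ x, min x.2.2 r⁻¹ ∂(π r : Measure QState)) = v at n2 ⊢
  generalize (∫ x in {x | x.1 = 0}, min x.2.1 r⁻¹ ∂(π r : Measure QState)) = a₀
  generalize (∫ x in {x | x.1 = 0}, min x.2.2 r⁻¹ ∂(π r : Measure QState)) = v₀
  have n3 : 0 ≤ (π r : Measure QState).real {x | r⁻¹ < x.2.1} := measureReal_nonneg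
  have n4 : 0 ≤ (π r : Measure QState).real ({x | r⁻¹ < x.2.2} ∩ {x | x.1 = 0}ᶜ) :=
    measureReal_nonneg
  generalize (π r : Measure QState).real {x | r⁻¹ < x.2.1} = p at n3 ⊢
  generalize (π r : Measure QState).real ({x | r⁻¹ < x.2.2} ∩ {x | x.1 = 0}ᶜ) = q at n4 ⊢
  have key : κ * r ^ 2 * (ρ * r * a + τ * r * v) + ρ * r * p + τ * r * q
      ≤ (κ * r ^ 2 * (ρ * r * a + τ * r * v) + ρ * r * p + τ * r * q) * W :=
    le_mul_of_one_le_right (by positivity) hw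
  calc _ = C * ((κ * r ^ 2 * (ρ * r * a + τ * r * v) + ρ * r * p + τ * r * q)
        + τ * r * (ρ * r * a₀ + τ * r * v₀)) := by ring
    _ ≤ C * ((κ * r ^ 2 * (ρ * r * a + τ * r * v) + ρ * r * p + τ * r * q) * W
        + τ * r * (ρ * r * a₀ + τ * r * v₀)) := by gcongr
    _ = _ := by field_simp; ring

/-- Jump side of the balance: the event rates are bounded, and the choice of exponents makes every
event other than a lost arrival contribute `o(r²)`. -/
lemma tendsto_jumpIntegral_sub_full (H : IsHeavyTraffic R M π m σ_e σ_s b ℓ₀) (θ : ℝ) :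
    Tendsto (fun r => (jumpIntegral M π m σ_e σ_s θ r
      - (IsTimeFamily.laplace (fun r => (M r).interarrival) m σ_e θ r - 1)
        * Real.exp (θ * r * (M r).threshold) * ∫ y in (M r).fullSet ∩ arrivalSet,
          Real.exp (-(serviceExponent M m σ_s θ r * min y.2.2 r⁻¹)) ∂(M r).eventMeasure (π r))
        / (r ^ 2 * weight M π r)) (𝓝[R] 0) (𝓝 0) := by
  set C := Real.exp (|θ| * (ℓ₀ + 1)) * Real.exp (2 * (|θ * m⁻¹| + 1)) with hC
  have he := (H.arrival.tendsto_exp_mul_laplace θ).abs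
  have hs := (H.service.tendsto_exp_mul_laplace (-θ)).abs
  have hr' := (IsTimeFamily.tendsto_self R).pow 2
  have hlim := (((he.add hs).add ((he.mul hs).mul hr')).const_mul C).mul_const (2 * (m⁻¹ + 1))
  simp only [abs_zero, mul_zero, add_zero, zero_mul] at hlim
  refine squeeze_zero_norm' ?_ hlim
  filter_upwards [H.eventually_expBound θ, IsTimeFamily.eventually_mem R,
    H.eventually_arrivalRate_le] with r hB hr hΛ
  have hr0 := H.mem_pos hr
  have hw := H.one_le_weight hr
  have hmain := (H.stationary r hr).abs_integral_jump_sub_le hB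
    (E₁ := IsTimeFamily.laplace (fun r => (M r).interarrival) m σ_e θ r)
    (V₁ := IsTimeFamily.laplace (fun r => (M r).service) m σ_s (-θ) r) rfl rfl
  rw [← neg_mul] at hmain
  rw [Real.norm_eq_abs, abs_div, abs_of_pos (show 0 < r ^ 2 * weight M π r by positivity),
    div_le_iff₀ (by positivity)]
  refine hmain.trans ?_
  set X := Real.exp (θ * r) * IsTimeFamily.laplace (fun r => (M r).interarrival) m σ_e θ r - 1
  set Y := Real.exp (-θ * r) * IsTimeFamily.laplace (fun r => (M r).service) m σ_s (-θ) r - 1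
  have eX : |X| = |X / r ^ 2| * r ^ 2 := by
    rw [abs_div, abs_of_pos (pow_pos hr0 2), div_mul_cancel₀ _ (pow_pos hr0 2).ne']
  have eY : |Y| = |Y / r ^ 2| * r ^ 2 := by
    rw [abs_div, abs_of_pos (pow_pos hr0 2), div_mul_cancel₀ _ (pow_pos hr0 2).ne']
  rw [eX, eY]
  have hX : 0 ≤ |X / r ^ 2| := abs_nonneg _
  have hY : 0 ≤ |Y / r ^ 2| := abs_nonneg _
  set x := |X / r ^ 2|
  set y := |Y / r ^ 2|
  have hC0 : 0 ≤ C := by positivity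
  have hm := inv_pos.2 H.arrival.mean_pos
  calc C * (x * r ^ 2 + y * r ^ 2 + x * r ^ 2 * (y * r ^ 2))
        * ((M r).arrivalRate (π r) + (M r).serviceRate (π r))
      ≤ C * (x * r ^ 2 + y * r ^ 2 + x * r ^ 2 * (y * r ^ 2)) * (2 * (m⁻¹ + 1)) := by
        refine mul_le_mul_of_nonneg_left ?_ (by positivity)
        linarith [H.serviceRate_le hr]
    _ ≤ C * (x * r ^ 2 + y * r ^ 2 + x * r ^ 2 * (y * r ^ 2)) * (2 * (m⁻¹ + 1)) * weight M π r :=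
        le_mul_of_one_le_right (by positivity) hw
    _ = _ := by ring

/-- Eliminates the jump integral between the two sides and replaces the integral over lost arrivals
by the loss rate; `tendsto_full_sub` has precision `o(r weight)`, and the prefactor supplies the
other `r`. -/
lemma tendsto_boundary_with_coefficients (H : IsHeavyTraffic R M π m σ_e σ_s b ℓ₀) (θ : ℝ) :
    Tendsto (fun r =>
      ((arrivalExponent M m σ_e θ r + serviceExponent M m σ_s θ r) / r ^ 2
        * queueTransform (π r) (θ * r)
      - serviceExponent M m σ_s θ r / r * idle π r
      + (IsTimeFamily.laplace (fun r => (M r).interarrival) m σ_e θ r - 1) / r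
        * Real.exp (θ * r * (M r).threshold) * loss M π r) / weight M π r) (𝓝[R] 0) (𝓝 0) := by
  have hξ := (H.service.tendsto_exponent_div (-θ)).abs.eventually_le_const
    (show |-θ * m⁻¹| < |-θ * m⁻¹| + 1 by linarith)
  have h3 := ((H.arrival.tendsto_laplace_first_order θ).mul (H.tendsto_exp_level θ)).mul
    (H.tendsto_full_sub (ξ := serviceExponent M m σ_s θ) hξ)
  have h := ((H.tendsto_jumpIntegral_add_drift θ).sub (H.tendsto_jumpIntegral_sub_full θ)).sub h3
  simp only [mul_zero, sub_zero] at h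
  refine h.congr' ?_
  filter_upwards [IsTimeFamily.eventually_mem R] with r hr
  have hr0 := (H.mem_pos hr).ne'
  have hw : weight M π r ≠ 0 := by linarith [H.one_le_weight hr]
  rw [idle, loss]
  field_simp
  ring

end FiniteQueue.IsHeavyTraffic

lemma Filter.Tendsto.sub_mul_bounded {α : Type*} {l : Filter α} {c X : α → ℝ} {a C : ℝ}
    (hc : Tendsto c l (𝓝 a)) (hX : ∀ᶠ r in l, |X r| ≤ C) :
    Tendsto (fun r => (c r - a) * X r) l (𝓝 0) := by
  have h : Tendsto (fun r => |c r - a| * C) l (𝓝 0) := by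
    simpa using (hc.sub_const a).abs.mul_const C
  refine squeeze_zero_norm' ?_ h
  filter_upwards [hX] with r hr
  rw [Real.norm_eq_abs, abs_mul]
  exact mul_le_mul_of_nonneg_left hr (abs_nonneg _)

namespace FiniteQueue.IsHeavyTraffic

open FiniteQueue.IsStationary

variable {R : Set ℝ} {M : ℝ → FiniteQueue} {π : ℝ → ProbabilityMeasure QState}
  {m σ_e σ_s b ℓ₀ : ℝ}

lemma abs_div_weight_le (H : IsHeavyTraffic R M π m σ_e σ_s b ℓ₀) {r X C : ℝ} (hr : r ∈ R)
    (hX : |X| ≤ C) : |X / weight M π r| ≤ C := by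
  have hw := H.one_le_weight hr
  rw [abs_div, abs_of_pos (show 0 < weight M π r by linarith)]
  exact (div_le_self (abs_nonneg _) hw).trans hX

lemma eventually_idle_div_weight_le (H : IsHeavyTraffic R M π m σ_e σ_s b ℓ₀) :
    ∀ᶠ r in 𝓝[R] (0 : ℝ), |idle π r / weight M π r| ≤ 1 := by
  filter_upwards [IsTimeFamily.eventually_mem R] with r hr
  have hw := H.one_le_weight hr
  rw [abs_of_nonneg (div_nonneg (H.idle_nonneg hr) (by linarith)), div_le_one (by linarith)]
  exact H.idle_le_weight hr

lemma eventually_palmLoss_div_weight_le (H : IsHeavyTraffic R M π m σ_e σ_s b ℓ₀) :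
    ∀ᶠ r in 𝓝[R] (0 : ℝ), |palmLoss M π r / weight M π r| ≤ 1 := by
  filter_upwards [IsTimeFamily.eventually_mem R] with r hr
  have hw := H.one_le_weight hr
  rw [abs_of_nonneg (div_nonneg (H.palmLoss_nonneg hr) (by linarith)), div_le_one (by linarith)]
  exact H.palmLoss_le_weight hr

/-- Coefficients are replaced by their limits; this is legitimate because the transform, `idle` and
`palmLoss`, all divided by `weight`, are bounded. The factor `m` clears the common `m⁻¹`. -/
lemma tendsto_boundary_div_weight (H : IsHeavyTraffic R M π m σ_e σ_s b ℓ₀) (θ : ℝ) :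
    Tendsto (fun r => ((θ ^ 2 * ((σ_e ^ 2 + σ_s ^ 2) / m ^ 2) / 2 - θ * b)
        * queueTransform (π r) (θ * r)
        + θ * (idle π r - Real.exp (θ * ℓ₀) * palmLoss M π r)) / weight M π r)
      (𝓝[R] 0) (𝓝 0) := by
  have hm := H.arrival.mean_pos
  have hL : ∀ᶠ r in 𝓝[R] (0 : ℝ), |queueTransform (π r) (θ * r) / weight M π r|
      ≤ Real.exp (|θ| * (ℓ₀ + 1)) := by
    filter_upwards [IsTimeFamily.eventually_mem R, H.eventually_queueTransform_le θ] with r hr h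
    exact H.abs_div_weight_le hr h
  have c1 := (H.tendsto_drift θ).sub_mul_bounded hL
  have c2 := (H.service.tendsto_exponent_div (-θ)).sub_mul_bounded H.eventually_idle_div_weight_le
  have c3 := (((H.arrival.tendsto_laplace_first_order θ).mul (H.tendsto_exp_level θ)).mul
    H.tendsto_arrivalRate).sub_mul_bounded H.eventually_palmLoss_div_weight_le
  have h := ((((H.tendsto_boundary_with_coefficients θ).sub c1).add c2).sub c3).const_mul m
  simp only [sub_zero, add_zero, mul_zero] at h
  refine h.congr' ?_
  filter_upwards [IsTimeFamily.eventually_mem R] with r hr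
  have hw : weight M π r ≠ 0 := by linarith [H.one_le_weight hr]
  have hr0 := (H.mem_pos hr).ne'
  rw [H.loss_eq hr, arrivalExponent, serviceExponent]
  field_simp
  ring

/-- For each `r` there is an exact identity behind this: the service rate times the mean service
time is the busy probability, and the service rate is the arrival rate minus the loss rate. Only the
replacement of the means by their limits is asymptotic. -/
lemma tendsto_flow_div_weight (H : IsHeavyTraffic R M π m σ_e σ_s b ℓ₀) :
    Tendsto (fun r => (idle π r - palmLoss M π r - b) / weight M π r) (𝓝[R] 0) (𝓝 0) := by
  have hm := H.arrival.mean_pos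
  have hflow : ∀ r ∈ R, (lawMean (M r).service)⁻¹ * idle π r
      - (lawMean (M r).interarrival)⁻¹ * palmLoss M π r
      = ((lawMean (M r).service)⁻¹ - (lawMean (M r).interarrival)⁻¹) / r := by
    intro r hr
    have hr0 := (H.mem_pos hr).ne'
    have h1 := (H.stationary r hr).serviceRate_eq
    have h2 := (H.stationary r hr).arrivalRate_mul_mean (H.arrival.integrable_sq hr)
    have h3 := (H.stationary r hr).serviceRate_mul_mean (H.service.integrable_sq hr)
    have hme : lawMean (M r).interarrival ≠ 0 := fun h => by simp [h] at h2
    have hms : lawMean (M r).service ≠ 0 :=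
      (lawMean_pos (H.service.integrable_sq hr) (M r).service_pos).ne'
    rw [palmLoss, idle, loss]
    rw [h1] at h3
    have h6 : idleProb (π r) = 1 - ((M r).arrivalRate (π r) - (M r).lossRate (π r))
      * lawMean (M r).service := by linarith
    have h7 := H.arrivalRate_eq hr
    rw [h6, h7]
    field_simp
    ring
  have hone : ∀ᶠ r in 𝓝[R] (0 : ℝ), |1 / weight M π r| ≤ 1 := by
    filter_upwards [IsTimeFamily.eventually_mem R] with r hr
    exact H.abs_div_weight_le hr (by simp)
  have c1 := (H.service.tendsto_mean.inv₀ hm.ne').sub_mul_bounded H.eventually_idle_div_weight_le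
  have c2 := (H.arrival.tendsto_mean.inv₀ hm.ne').sub_mul_bounded H.eventually_palmLoss_div_weight_le
  have c3 := H.drift.sub_mul_bounded hone
  have h := ((c3.sub c1).add c2).const_mul m
  simp only [sub_zero, add_zero, mul_zero] at h
  refine h.congr' ?_
  filter_upwards [IsTimeFamily.eventually_mem R] with r hr
  have hw : weight M π r ≠ 0 := by linarith [H.one_le_weight hr]
  rw [← hflow r hr]
  field_simp
  ring

/-- The scaled boundary probabilities are bounded. -/
lemma exists_weight_le (H : IsHeavyTraffic R M π m σ_e σ_s b ℓ₀) :
    ∃ C : ℝ, ∀ᶠ r in 𝓝[R] (0 : ℝ), weight M π r ≤ C := by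
  -- At `θ = 1` the difference of the two equations eliminates `idle` and leaves `(exp ℓ₀ - 1) *
  -- palmLoss`, a bounded quantity and an error proportional to `weight`.
  have h1 := H.tendsto_boundary_div_weight 1
  have h2 := H.tendsto_flow_div_weight
  have h := h2.sub h1
  rw [sub_zero] at h
  set c := (1 : ℝ) ^ 2 * ((σ_e ^ 2 + σ_s ^ 2) / m ^ 2) / 2 - 1 * b
  set K := |c| * Real.exp (|1| * (ℓ₀ + 1)) with hK
  have hℓ := H.level_pos
  set e := Real.exp (1 * ℓ₀) - 1 with he
  have he0 : 0 < e := by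
    have := Real.add_one_lt_exp (show 1 * ℓ₀ ≠ 0 by simpa using hℓ.ne')
    linarith
  -- `e * y ≤ b + K + ε w`, `x ≤ y + b + ε w`, hence `w ≤ 1 + 2 y + |b| + ε w`
  set ε := min (1 / 4) (e / 16) with hε
  have hε0 : 0 < ε := by positivity
  have hlt : ∀ᶠ r in 𝓝[R] (0 : ℝ), |(idle π r - palmLoss M π r - b) / weight M π r| ≤ ε := by
    have := h2.abs
    rw [abs_zero] at this
    exact this.eventually_le_const hε0
  have hlt' := h.abs
  rw [abs_zero] at hlt'
  refine ⟨4 * (1 + |b| + 2 * ((|b| + K) / e)), ?_⟩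
  filter_upwards [hlt, hlt'.eventually_le_const hε0, IsTimeFamily.eventually_mem R,
    H.eventually_queueTransform_le 1] with r h3 h4 hr hq
  have hw := H.one_le_weight hr
  have hw0 : 0 < weight M π r := by linarith
  have hww : weight M π r = 1 + idle π r + palmLoss M π r := rfl
  rw [← sub_div, abs_div, abs_of_pos hw0, div_le_iff₀ hw0] at h4
  rw [abs_div, abs_of_pos hw0, div_le_iff₀ hw0] at h3
  set W := weight M π r
  set x := idle π r
  set y := palmLoss M π r
  have hcq : |c * queueTransform (π r) (1 * r)| ≤ K := by
    rw [abs_mul]; exact mul_le_mul_of_nonneg_left hq (abs_nonneg _)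
  have h5 : e * y ≤ |b| + K + ε * W := by
    have h6 := (abs_le.1 h4).2
    have h7 := (abs_le.1 hcq).2
    have h8 := le_abs_self b
    have : e * y = (x - y - b - (c * queueTransform (π r) (1 * r)
      + 1 * (x - Real.exp (1 * ℓ₀) * y))) + b + c * queueTransform (π r) (1 * r) := by
      rw [he]; ring
    linarith
  have h9 := (abs_le.1 h3).2
  have h10 := le_abs_self b
  have h11 : y ≤ (|b| + K) / e + ε / e * W := by
    have := div_le_div_of_nonneg_right h5 he0.le
    rwa [mul_div_cancel_left₀ _ he0.ne', add_div, ← div_mul_eq_mul_div] at this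
  have h12 : ε / e ≤ 1 / 16 := by
    rw [div_le_iff₀ he0]
    linarith [min_le_right (1 / 4 : ℝ) (e / 16)]
  have h13 : ε ≤ 1 / 4 := min_le_left _ _
  have h14 : ε / e * W ≤ 1 / 16 * W := mul_le_mul_of_nonneg_right h12 hw0.le
  have h15 : ε * W ≤ 1 / 4 * W := mul_le_mul_of_nonneg_right h13 hw0.le
  linarith

lemma tendsto_zero_of_div_weight (H : IsHeavyTraffic R M π m σ_e σ_s b ℓ₀) {X : ℝ → ℝ}
    (h : Tendsto (fun r => X r / weight M π r) (𝓝[R] 0) (𝓝 0)) : Tendsto X (𝓝[R] 0) (𝓝 0) := by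
  obtain ⟨C, hC⟩ := H.exists_weight_le
  have h1 := h.sub_mul_bounded (X := fun r => weight M π r) (C := C) (by
    filter_upwards [hC, IsTimeFamily.eventually_mem R] with r hr hrR
    rwa [abs_of_pos (by linarith [H.one_le_weight hrR])])
  refine h1.congr' ?_
  filter_upwards [IsTimeFamily.eventually_mem R] with r hr
  have hw : weight M π r ≠ 0 := by linarith [H.one_le_weight hr]
  field_simp
  ring

lemma tendsto_boundary (H : IsHeavyTraffic R M π m σ_e σ_s b ℓ₀) (θ : ℝ) :
    Tendsto (fun r => (θ ^ 2 * ((σ_e ^ 2 + σ_s ^ 2) / m ^ 2) / 2 - θ * b)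
        * queueTransform (π r) (θ * r)
        + θ * (idle π r - Real.exp (θ * ℓ₀) * palmLoss M π r)) (𝓝[R] 0) (𝓝 0) :=
  H.tendsto_zero_of_div_weight (H.tendsto_boundary_div_weight θ)

lemma tendsto_flow (H : IsHeavyTraffic R M π m σ_e σ_s b ℓ₀) :
    Tendsto (fun r => idle π r - palmLoss M π r) (𝓝[R] 0) (𝓝 b) := by
  simpa using (H.tendsto_zero_of_div_weight H.tendsto_flow_div_weight).add_const b

end FiniteQueue.IsHeavyTraffic

/-! ### Limits of the boundary probabilities. -/

namespace FiniteQueue.IsHeavyTraffic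

open FiniteQueue.IsStationary

variable {R : Set ℝ} {M : ℝ → FiniteQueue} {π : ℝ → ProbabilityMeasure QState}
  {m σ_e σ_s b ℓ₀ : ℝ}

/-- The queue length is nonnegative, so `exp (θ r L) - 1` has the sign of `θ`. Multiplication by `θ`
gives one inequality valid for both signs. -/
lemma le_mul_queueTransform (H : IsHeavyTraffic R M π m σ_e σ_s b ℓ₀) {r : ℝ} (hr : r ∈ R)
    (θ : ℝ) : θ ≤ θ * queueTransform (π r) (θ * r) := by
  have hr0 := H.mem_pos hr
  have hi : Integrable (fun x : QState => Real.exp (θ * r * x.1)) (π r : Measure QState) := by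
    refine integrable_of_ae_bound ((measurable_of_countable
      fun l : ℕ => Real.exp (θ * r * l)).comp measurable_fst)
      (C := Real.exp (|θ * r| * (M r).threshold)) ?_
    filter_upwards [(H.stationary r hr).ae_mem] with x hx
    rw [abs_of_pos (Real.exp_pos _), Real.exp_le_exp]
    exact mul_le_mul (le_abs_self _) (Nat.cast_le.2 hx.1) (Nat.cast_nonneg _) (abs_nonneg _)
  have h : 0 ≤ ∫ x : QState, (θ * Real.exp (θ * r * x.1) - θ) ∂(π r : Measure QState) := by
    refine integral_nonneg fun x => ?_
    have hl : 0 ≤ r * (x.1 : ℝ) := by positivity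
    rcases le_total 0 θ with h0 | h0
    · have := mul_le_mul_of_nonneg_left (Real.one_le_exp (mul_nonneg h0 hl)) h0
      rw [← mul_assoc] at this
      simpa using this
    · have := mul_le_mul_of_nonpos_left (Real.exp_le_one_iff.2 (mul_nonpos_of_nonpos_of_nonneg h0 hl))
        h0
      rw [← mul_assoc] at this
      simpa using this
  rw [integral_sub (hi.const_mul θ) (integrable_const θ), integral_const_mul, integral_const,
    probReal_univ, one_smul] at h
  unfold queueTransform
  linarith

/-- In the balanced case the scaled loss probability is asymptotically bounded from both sides. -/
lemma eventually_lt_mul_palmLoss (H : IsHeavyTraffic R M π m σ_e σ_s 0 ℓ₀) {θ u : ℝ} (hθ : θ ≠ 0)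
    (hu : u < θ * ((σ_e ^ 2 + σ_s ^ 2) / m ^ 2) / 2) :
    ∀ᶠ r in 𝓝[R] (0 : ℝ), u < (Real.exp (θ * ℓ₀) - 1) * palmLoss M π r := by
  set c := (σ_e ^ 2 + σ_s ^ 2) / m ^ 2 with hc
  have hc0 : 0 ≤ c := by positivity
  -- Dividing the boundary equation by `θ` and subtracting it from the flow equation removes `idle`;
  -- the transform that remains is bounded from one side by `le_mul_queueTransform`.
  have h := (H.tendsto_flow).sub ((H.tendsto_boundary θ).const_mul θ⁻¹)
  simp only [mul_zero, sub_zero] at h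
  filter_upwards [h.eventually_const_lt (show u - θ * c / 2 < 0 by linarith),
    IsTimeFamily.eventually_mem R] with r h1 hr
  have h2 := mul_le_mul_of_nonneg_right (H.le_mul_queueTransform hr θ) hc0
  have e : θ⁻¹ * (θ ^ 2 * c / 2 * queueTransform (π r) (θ * r)
      + θ * (idle π r - Real.exp (θ * ℓ₀) * palmLoss M π r))
      = θ * queueTransform (π r) (θ * r) * c / 2
        + (idle π r - Real.exp (θ * ℓ₀) * palmLoss M π r) := by
    field_simp
  rw [e] at h1
  linarith

/-- With zero drift the coefficient of the transform vanishes only at `θ = 0`, where the equation is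
empty. Instead, positive `θ` gives lower bounds and negative `θ` upper bounds, and both tend to `c /
(2 * ℓ₀)` as `θ → 0`, since the slope of `exp (θ * ℓ₀)` at `0` is `ℓ₀`. -/
lemma tendsto_palmLoss_of_drift_eq_zero (H : IsHeavyTraffic R M π m σ_e σ_s 0 ℓ₀) :
    Tendsto (palmLoss M π) (𝓝[R] 0) (𝓝 ((σ_e ^ 2 + σ_s ^ 2) / m ^ 2 / (2 * ℓ₀))) := by
  set c := (σ_e ^ 2 + σ_s ^ 2) / m ^ 2 with hc
  have hℓ := H.level_pos
  have hs : Tendsto (fun θ : ℝ => c / 2 / ((Real.exp (θ * ℓ₀) - 1) / θ)) (𝓝[≠] 0)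
      (𝓝 (c / (2 * ℓ₀))) := by
    have hd : HasDerivAt (fun θ : ℝ => Real.exp (θ * ℓ₀)) ℓ₀ 0 := by
      simpa using ((hasDerivAt_id (0 : ℝ)).mul_const ℓ₀).exp
    have := (tendsto_const_nhds (x := c / 2)).div hd.tendsto_slope hℓ.ne'
    have e : c / 2 / ℓ₀ = c / (2 * ℓ₀) := div_div _ _ _
    rw [e] at this
    refine this.congr fun θ => ?_
    simp [slope_def_field]
  refine tendsto_order.2 ⟨fun u hu => ?_, fun u hu => ?_⟩
  · have h1 := (hs.mono_left (nhdsGT_le_nhdsNE 0)).eventually_const_lt hu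
    obtain ⟨θ, h2, hθ : 0 < θ⟩ := (h1.and self_mem_nhdsWithin).exists
    have he : 0 < Real.exp (θ * ℓ₀) - 1 := by
      have := Real.add_one_lt_exp (mul_pos hθ hℓ).ne'
      linarith [mul_pos hθ hℓ]
    have h3 : (Real.exp (θ * ℓ₀) - 1) * u < θ * c / 2 := by
      rw [lt_div_iff₀ (by positivity)] at h2
      have := mul_lt_mul_of_pos_left h2 hθ
      calc _ = θ * (u * ((Real.exp (θ * ℓ₀) - 1) / θ)) := by field_simp
        _ < _ := this
        _ = _ := by ring
    filter_upwards [H.eventually_lt_mul_palmLoss hθ.ne' h3] with r hr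
    exact lt_of_mul_lt_mul_left hr he.le
  · have h1 := (hs.mono_left (nhdsLT_le_nhdsNE 0)).eventually_lt_const hu
    obtain ⟨θ, h2, hθ : θ < 0⟩ := (h1.and self_mem_nhdsWithin).exists
    have hneg := mul_neg_of_neg_of_pos hθ hℓ
    have he : Real.exp (θ * ℓ₀) - 1 < 0 := by
      linarith [Real.exp_lt_one_iff.2 hneg]
    have h3 : (Real.exp (θ * ℓ₀) - 1) * u < θ * c / 2 := by
      rw [div_lt_iff₀ (div_pos_of_neg_of_neg he hθ)] at h2
      have := mul_lt_mul_of_neg_left h2 hθ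
      have hθ' := hθ.ne
      calc _ = θ * (u * ((Real.exp (θ * ℓ₀) - 1) / θ)) := by field_simp
        _ < _ := this
        _ = _ := by ring
    filter_upwards [H.eventually_lt_mul_palmLoss hθ.ne h3] with r hr
    exact lt_of_mul_lt_mul_of_nonpos_left hr he.le

lemma tendsto_idle_of_drift_eq_zero (H : IsHeavyTraffic R M π m σ_e σ_s 0 ℓ₀) :
    Tendsto (idle π) (𝓝[R] 0) (𝓝 ((σ_e ^ 2 + σ_s ^ 2) / m ^ 2 / (2 * ℓ₀))) := by
  simpa using H.tendsto_flow.add H.tendsto_palmLoss_of_drift_eq_zero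

/-- `β` is the nonzero root of `θ ^ 2 * c / 2 - θ * b`. There the transform drops out, and the
boundary and flow equations form a solvable linear system for `idle` and `palmLoss`. -/
lemma tendsto_palmLoss_of_drift_ne_zero (H : IsHeavyTraffic R M π m σ_e σ_s b ℓ₀)
    (hσ : 0 < (σ_e ^ 2 + σ_s ^ 2) / m ^ 2) (hb : b ≠ 0) {β : ℝ}
    (hβ : β = 2 * b / ((σ_e ^ 2 + σ_s ^ 2) / m ^ 2)) :
    Tendsto (palmLoss M π) (𝓝[R] 0) (𝓝 (b / (Real.exp (β * ℓ₀) - 1))) := by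
  set c := (σ_e ^ 2 + σ_s ^ 2) / m ^ 2 with hc
  have hβ0 : β ≠ 0 := by rw [hβ]; exact div_ne_zero (mul_ne_zero two_ne_zero hb) hσ.ne'
  have he : Real.exp (β * ℓ₀) - 1 ≠ 0 := by
    rw [sub_ne_zero, Ne, Real.exp_eq_one_iff]
    exact mul_ne_zero hβ0 H.level_pos.ne'
  have h := (H.tendsto_flow.sub ((H.tendsto_boundary β).const_mul β⁻¹)).div_const
    (Real.exp (β * ℓ₀) - 1)
  rw [mul_zero, sub_zero] at h
  refine h.congr fun r => ?_
  have e : β ^ 2 * c / 2 - β * b = 0 := by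
    have : b = β * c / 2 := by rw [hβ]; field_simp
    rw [this]; ring
  rw [← hc, e, zero_mul, zero_add, inv_mul_cancel_left₀ hβ0]
  field_simp
  ring

lemma tendsto_idle_of_drift_ne_zero (H : IsHeavyTraffic R M π m σ_e σ_s b ℓ₀)
    (hσ : 0 < (σ_e ^ 2 + σ_s ^ 2) / m ^ 2) (hb : b ≠ 0) {β : ℝ}
    (hβ : β = 2 * b / ((σ_e ^ 2 + σ_s ^ 2) / m ^ 2)) :
    Tendsto (idle π) (𝓝[R] 0) (𝓝 (b * Real.exp (β * ℓ₀) / (Real.exp (β * ℓ₀) - 1))) := by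
  have hβ0 : β ≠ 0 := by rw [hβ]; exact div_ne_zero (mul_ne_zero two_ne_zero hb) hσ.ne'
  have he : Real.exp (β * ℓ₀) - 1 ≠ 0 := by
    rw [sub_ne_zero, Ne, Real.exp_eq_one_iff]
    exact mul_ne_zero hβ0 H.level_pos.ne'
  have h := H.tendsto_flow.add (H.tendsto_palmLoss_of_drift_ne_zero hσ hb hβ)
  have e : b + b / (Real.exp (β * ℓ₀) - 1)
      = b * Real.exp (β * ℓ₀) / (Real.exp (β * ℓ₀) - 1) := by
    field_simp
    ring
  rw [e] at h
  refine h.congr fun r => by ring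

end FiniteQueue.IsHeavyTraffic

/-! ### Weak convergence on a bounded interval from exponential moments. -/

lemma integrable_exp_of_ae_mem_Icc {μ : Measure ℝ} [IsFiniteMeasure μ] {a : ℝ}
    (hμ : ∀ᵐ x ∂μ, x ∈ Set.Icc 0 a) (t : ℝ) : Integrable (fun x => Real.exp (t * x)) μ := by
  refine FiniteQueue.integrable_of_ae_bound (by fun_prop) (C := Real.exp (|t| * a)) ?_
  filter_upwards [hμ] with x hx
  rw [abs_of_pos (Real.exp_pos _), Real.exp_le_exp]
  exact mul_le_mul (le_abs_self _) hx.2 hx.1 (abs_nonneg _)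

/-- Laws on a common bounded interval converge weakly if their exponential moments converge along
an arithmetic progression. -/
theorem MeasureTheory.ProbabilityMeasure.tendsto_of_tendsto_integral_exp {ι : Type*} {l : Filter ι}
    {μ : ι → ProbabilityMeasure ℝ} {ν : ProbabilityMeasure ℝ} {a ε : ℝ} (hε : 0 < ε)
    (hμ : ∀ᶠ i in l, ∀ᵐ x ∂(μ i : Measure ℝ), x ∈ Set.Icc 0 a)
    (hν : ∀ᵐ x ∂(ν : Measure ℝ), x ∈ Set.Icc 0 a)
    (h : ∀ k : ℕ, Tendsto (fun i => ∫ x, Real.exp (ε * k * x) ∂(μ i : Measure ℝ)) l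
      (𝓝 (∫ x, Real.exp (ε * k * x) ∂(ν : Measure ℝ)))) :
    Tendsto μ l (𝓝 ν) := by
  rw [ProbabilityMeasure.tendsto_iff_forall_integral_tendsto]
  intro f
  rw [Metric.tendsto_nhds]
  intro δ hδ
  -- In the variable `u = exp (ε * x)` the given moments are those of monomials, so Weierstrass
  -- approximation on `[1, exp (ε * a)]` applies to the test function.
  have hcont : ContinuousOn (fun u => f (Real.log u / ε)) (Set.Icc 1 (Real.exp (ε * a))) := by
    refine f.continuous.comp_continuousOn (ContinuousOn.div_const ?_ _)
    exact Real.continuousOn_log.mono fun u hu => by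
      have := hu.1
      simp only [Set.mem_compl_iff, Set.mem_singleton_iff]
      linarith
  obtain ⟨p, hp⟩ := exists_polynomial_near_of_continuousOn _ _ _ hcont (δ / 3) (by linarith)
  have hpf : ∀ x ∈ Set.Icc 0 a, |p.eval (Real.exp (ε * x)) - f x| ≤ δ / 3 := by
    intro x hx
    have := hp (Real.exp (ε * x)) ⟨Real.one_le_exp (mul_nonneg hε.le hx.1),
      Real.exp_le_exp.2 (mul_le_mul_of_nonneg_left hx.2 hε.le)⟩
    rw [Real.log_exp, mul_div_cancel_left₀ _ hε.ne'] at this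
    exact this.le
  have heval : ∀ x, p.eval (Real.exp (ε * x))
      = ∑ k ∈ Finset.range (p.natDegree + 1), p.coeff k * Real.exp (ε * k * x) := by
    intro x
    rw [Polynomial.eval_eq_sum_range]
    refine Finset.sum_congr rfl fun k _ => ?_
    rw [← Real.exp_nat_mul]
    ring_nf
  have hint : ∀ P : ProbabilityMeasure ℝ, (∀ᵐ x ∂(P : Measure ℝ), x ∈ Set.Icc 0 a) →
      Integrable (fun x => p.eval (Real.exp (ε * x))) (P : Measure ℝ) := by
    intro P hP
    simp_rw [heval]
    exact integrable_finsetSum _ fun k _ => (integrable_exp_of_ae_mem_Icc hP _).const_mul _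
  have hsum : ∀ P : ProbabilityMeasure ℝ, (∀ᵐ x ∂(P : Measure ℝ), x ∈ Set.Icc 0 a) →
      ∫ x, p.eval (Real.exp (ε * x)) ∂(P : Measure ℝ) = ∑ k ∈ Finset.range (p.natDegree + 1),
        p.coeff k * ∫ x, Real.exp (ε * k * x) ∂(P : Measure ℝ) := by
    intro P hP
    simp_rw [heval]
    rw [integral_finsetSum _ fun k _ => (integrable_exp_of_ae_mem_Icc hP _).const_mul _]
    simp_rw [integral_const_mul]
  have hclose : ∀ P : ProbabilityMeasure ℝ, (∀ᵐ x ∂(P : Measure ℝ), x ∈ Set.Icc 0 a) →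
      |∫ x, p.eval (Real.exp (ε * x)) ∂(P : Measure ℝ) - ∫ x, f x ∂(P : Measure ℝ)| ≤ δ / 3 := by
    intro P hP
    rw [← integral_sub (hint P hP) (f.integrable _)]
    have := norm_integral_le_of_norm_le_const (μ := (P : Measure ℝ)) (C := δ / 3)
      (f := fun x => p.eval (Real.exp (ε * x)) - f x) (by
        filter_upwards [hP] with x hx using hpf x hx)
    simpa using this
  have hlim : Tendsto (fun i => ∑ k ∈ Finset.range (p.natDegree + 1),
      p.coeff k * ∫ x, Real.exp (ε * k * x) ∂(μ i : Measure ℝ)) l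
      (𝓝 (∫ x, p.eval (Real.exp (ε * x)) ∂(ν : Measure ℝ))) := by
    rw [hsum ν hν]
    exact tendsto_finsetSum _ fun k _ => (h k).const_mul _
  filter_upwards [hμ, Metric.tendsto_nhds.1 hlim (δ / 3) (by linarith)] with i hi hd
  rw [← hsum (μ i) hi, Real.dist_eq] at hd
  rw [Real.dist_eq]
  have h1 := hclose _ hi
  have h2 := hclose _ hν
  rw [abs_le] at h1 h2
  rw [abs_lt] at hd ⊢
  constructor <;> linarith

/-! ### The truncated exponential law and its transform. -/

/-- Density of the exponential law with rate `β` truncated to `[0, ℓ]`, which is uniform for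
`β = 0`. -/
noncomputable def truncExpDensity (β ℓ : ℝ) : ℝ → ℝ :=
  if β = 0 then Set.indicator (Set.Icc 0 ℓ) (fun _ => 1 / ℓ)
  else Set.indicator (Set.Icc 0 ℓ) fun x => β / (1 - Real.exp (-β * ℓ)) * Real.exp (-β * x)

/-- Normalizing constant of `truncExpDensity`. -/
noncomputable def truncExpConst (β ℓ : ℝ) : ℝ :=
  if β = 0 then 1 / ℓ else β / (1 - Real.exp (-β * ℓ))

lemma truncExpDensity_eq (β ℓ : ℝ) : truncExpDensity β ℓ
    = Set.indicator (Set.Icc 0 ℓ) fun x => truncExpConst β ℓ * Real.exp (-β * x) := by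
  by_cases h : β = 0 <;> simp [truncExpDensity, truncExpConst, h]

lemma truncExpConst_pos (β : ℝ) {ℓ : ℝ} (hℓ : 0 < ℓ) : 0 < truncExpConst β ℓ := by
  rcases lt_trichotomy β 0 with h | h | h
  · rw [truncExpConst, if_neg h.ne]
    refine div_pos_of_neg_of_neg h ?_
    have := Real.one_lt_exp_iff.2 (show 0 < -β * ℓ by nlinarith)
    linarith
  · rw [truncExpConst, if_pos h]
    positivity
  · rw [truncExpConst, if_neg h.ne']
    refine div_pos h ?_
    have := Real.exp_lt_one_iff.2 (show -β * ℓ < 0 by nlinarith)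
    linarith

lemma measurable_truncExpDensity (β ℓ : ℝ) : Measurable (truncExpDensity β ℓ) := by
  rw [truncExpDensity_eq]
  exact Measurable.indicator (by fun_prop) measurableSet_Icc

lemma truncExpDensity_nonneg (β : ℝ) {ℓ : ℝ} (hℓ : 0 < ℓ) (x : ℝ) : 0 ≤ truncExpDensity β ℓ x := by
  rw [truncExpDensity_eq]
  refine Set.indicator_nonneg (fun x _ => ?_) x
  have := truncExpConst_pos β hℓ
  positivity

lemma integral_exp_mul_truncExpDensity (β : ℝ) {ℓ : ℝ} (hℓ : 0 < ℓ) (t : ℝ) :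
    ∫ x, truncExpDensity β ℓ x * Real.exp (t * x)
      = truncExpConst β ℓ * ∫ x in (0 : ℝ)..ℓ, Real.exp ((t - β) * x) := by
  have e : (fun x => truncExpDensity β ℓ x * Real.exp (t * x)) = Set.indicator (Set.Icc 0 ℓ)
      fun x => truncExpConst β ℓ * Real.exp ((t - β) * x) := by
    rw [truncExpDensity_eq]
    funext x
    by_cases hx : x ∈ Set.Icc 0 ℓ
    · rw [Set.indicator_of_mem hx, Set.indicator_of_mem hx, mul_assoc, ← Real.exp_add]
      ring_nf
    · rw [Set.indicator_of_notMem hx, Set.indicator_of_notMem hx, zero_mul]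
  rw [e, integral_indicator measurableSet_Icc, integral_const_mul,
    intervalIntegral.integral_of_le hℓ.le, integral_Icc_eq_integral_Ioc]

lemma integral_exp_mul_of_ne_zero {s : ℝ} (hs : s ≠ 0) (ℓ : ℝ) :
    ∫ x in (0 : ℝ)..ℓ, Real.exp (s * x) = (Real.exp (s * ℓ) - 1) / s := by
  rw [intervalIntegral.integral_comp_mul_left (fun x => Real.exp x) hs, integral_exp]
  simp [div_eq_inv_mul]

lemma integral_truncExpDensity (β : ℝ) {ℓ : ℝ} (hℓ : 0 < ℓ) :
    ∫ x, truncExpDensity β ℓ x = 1 := by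
  have h := integral_exp_mul_truncExpDensity β hℓ 0
  simp only [zero_mul, Real.exp_zero, mul_one, zero_sub] at h
  rw [h]
  by_cases hβ : β = 0
  · simp [truncExpConst, hβ, hℓ.ne']
  · rw [integral_exp_mul_of_ne_zero (neg_ne_zero.2 hβ), truncExpConst, if_neg hβ]
    have : 1 - Real.exp (-β * ℓ) ≠ 0 := by
      rw [sub_ne_zero, Ne, eq_comm, Real.exp_eq_one_iff]
      exact mul_ne_zero (neg_ne_zero.2 hβ) hℓ.ne'
    generalize Real.exp (-β * ℓ) = e at this ⊢
    field_simp
    ring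

lemma integrable_truncExpDensity (β : ℝ) {ℓ : ℝ} (hℓ : 0 < ℓ) :
    Integrable (truncExpDensity β ℓ) := by
  by_contra h
  have := integral_truncExpDensity β hℓ
  rw [integral_undef h] at this
  exact zero_ne_one this

/-- The truncated exponential law. -/
noncomputable def truncExp (β : ℝ) {ℓ : ℝ} (hℓ : 0 < ℓ) : ProbabilityMeasure ℝ :=
  ⟨volume.withDensity fun x => ENNReal.ofReal (truncExpDensity β ℓ x), ⟨by
    rw [withDensity_apply _ MeasurableSet.univ, setLIntegral_univ,
      ← ofReal_integral_eq_lintegral_ofReal (integrable_truncExpDensity β hℓ)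
        (ae_of_all _ (truncExpDensity_nonneg β hℓ)), integral_truncExpDensity β hℓ,
      ENNReal.ofReal_one]⟩⟩

lemma ae_truncExp (β : ℝ) {ℓ : ℝ} (hℓ : 0 < ℓ) :
    ∀ᵐ x ∂(truncExp β hℓ : Measure ℝ), x ∈ Set.Icc 0 ℓ := by
  change ∀ᵐ x ∂volume.withDensity fun x => ENNReal.ofReal (truncExpDensity β ℓ x), _
  rw [ae_withDensity_iff (measurable_truncExpDensity β ℓ).ennreal_ofReal]
  refine ae_of_all _ fun x hx => ?_
  by_contra h
  rw [truncExpDensity_eq, Set.indicator_of_notMem h] at hx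
  simp at hx

lemma integral_exp_truncExp (β : ℝ) {ℓ : ℝ} (hℓ : 0 < ℓ) (t : ℝ) :
    ∫ x, Real.exp (t * x) ∂(truncExp β hℓ : Measure ℝ)
      = truncExpConst β ℓ * ∫ x in (0 : ℝ)..ℓ, Real.exp ((t - β) * x) := by
  rw [← integral_exp_mul_truncExpDensity β hℓ]
  change ∫ x, Real.exp (t * x) ∂volume.withDensity
    (fun x => ENNReal.ofReal (truncExpDensity β ℓ x)) = _
  rw [integral_withDensity_eq_integral_toReal_smul (measurable_truncExpDensity β ℓ).ennreal_ofReal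
    (ae_of_all _ fun x => ENNReal.ofReal_lt_top)]
  refine integral_congr_ae (ae_of_all _ fun x => ?_)
  simp [ENNReal.toReal_ofReal (truncExpDensity_nonneg β hℓ x)]

/-! ### Identification of the limit law. -/

namespace FiniteQueue.IsHeavyTraffic

open FiniteQueue.IsStationary

variable {R : Set ℝ} {M : ℝ → FiniteQueue} {π : ℝ → ProbabilityMeasure QState}
  {m σ_e σ_s b ℓ₀ : ℝ}

/-- A form common to zero and nonzero drift: the limit is `c / 2` times the limit density at `0`.
Likewise `palmLoss` tends to `c / 2` times the density at `ℓ₀`. -/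
lemma tendsto_idle (H : IsHeavyTraffic R M π m σ_e σ_s b ℓ₀)
    (hσ : 0 < (σ_e ^ 2 + σ_s ^ 2) / m ^ 2) {β : ℝ}
    (hβ : β = 2 * b / ((σ_e ^ 2 + σ_s ^ 2) / m ^ 2)) :
    Tendsto (idle π) (𝓝[R] 0) (𝓝 ((σ_e ^ 2 + σ_s ^ 2) / m ^ 2 / 2 * truncExpConst β ℓ₀)) := by
  set c := (σ_e ^ 2 + σ_s ^ 2) / m ^ 2 with hc
  by_cases hb : b = 0
  · subst hb
    have h := H.tendsto_idle_of_drift_eq_zero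
    rw [mul_zero, zero_div] at hβ
    rwa [truncExpConst, if_pos hβ, div_mul_div_comm, mul_one]
  · have h := H.tendsto_idle_of_drift_ne_zero hσ hb hβ
    have hβ0 : β ≠ 0 := by rw [hβ]; exact div_ne_zero (mul_ne_zero two_ne_zero hb) hσ.ne'
    have hbc : b = β * c / 2 := by rw [hβ]; field_simp
    have he : Real.exp (β * ℓ₀) - 1 ≠ 0 := by
      rw [sub_ne_zero, Ne, Real.exp_eq_one_iff]
      exact mul_ne_zero hβ0 H.level_pos.ne'
    have e : b * Real.exp (β * ℓ₀) / (Real.exp (β * ℓ₀) - 1) = c / 2 * truncExpConst β ℓ₀ := by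
      rw [truncExpConst, if_neg hβ0, hbc, neg_mul, Real.exp_neg]
      have hp := (Real.exp_pos (β * ℓ₀)).ne'
      generalize Real.exp (β * ℓ₀) = y at he hp
      field_simp
    rwa [e] at h

lemma tendsto_palmLoss (H : IsHeavyTraffic R M π m σ_e σ_s b ℓ₀)
    (hσ : 0 < (σ_e ^ 2 + σ_s ^ 2) / m ^ 2) {β : ℝ}
    (hβ : β = 2 * b / ((σ_e ^ 2 + σ_s ^ 2) / m ^ 2)) :
    Tendsto (palmLoss M π) (𝓝[R] 0) (𝓝 ((σ_e ^ 2 + σ_s ^ 2) / m ^ 2 / 2 * truncExpConst β ℓ₀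
      * Real.exp (-β * ℓ₀))) := by
  set c := (σ_e ^ 2 + σ_s ^ 2) / m ^ 2 with hc
  by_cases hb : b = 0
  · subst hb
    have h := H.tendsto_palmLoss_of_drift_eq_zero
    rw [mul_zero, zero_div] at hβ
    rw [truncExpConst, if_pos hβ, div_mul_div_comm, mul_one, hβ]
    simpa using h
  · have h := H.tendsto_palmLoss_of_drift_ne_zero hσ hb hβ
    have hβ0 : β ≠ 0 := by rw [hβ]; exact div_ne_zero (mul_ne_zero two_ne_zero hb) hσ.ne'
    have hbc : b = β * c / 2 := by rw [hβ]; field_simp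
    have he : Real.exp (β * ℓ₀) - 1 ≠ 0 := by
      rw [sub_ne_zero, Ne, Real.exp_eq_one_iff]
      exact mul_ne_zero hβ0 H.level_pos.ne'
    have e : b / (Real.exp (β * ℓ₀) - 1) = c / 2 * truncExpConst β ℓ₀ * Real.exp (-β * ℓ₀) := by
      rw [truncExpConst, if_neg hβ0, hbc, neg_mul, Real.exp_neg]
      have hp := (Real.exp_pos (β * ℓ₀)).ne'
      generalize Real.exp (β * ℓ₀) = y at he hp
      field_simp
    rwa [e] at h

/-- With the boundary terms known, the boundary equation is solved for the transform. Its
coefficient factors as `t * c / 2 * (t - β)`, which is why `0` and `β` are excluded. -/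
lemma tendsto_queueTransform (H : IsHeavyTraffic R M π m σ_e σ_s b ℓ₀)
    (hσ : 0 < (σ_e ^ 2 + σ_s ^ 2) / m ^ 2) {β : ℝ}
    (hβ : β = 2 * b / ((σ_e ^ 2 + σ_s ^ 2) / m ^ 2)) {t : ℝ} (ht : t ≠ 0) (htβ : t ≠ β) :
    Tendsto (fun r => queueTransform (π r) (t * r)) (𝓝[R] 0)
      (𝓝 (∫ x, Real.exp (t * x) ∂(truncExp β H.level_pos : Measure ℝ))) := by
  have h := ((H.tendsto_boundary t).sub (((H.tendsto_idle hσ hβ).sub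
    ((H.tendsto_palmLoss hσ hβ).const_mul (Real.exp (t * ℓ₀)))).const_mul t)).div_const
      (t * ((σ_e ^ 2 + σ_s ^ 2) / m ^ 2) / 2 * (t - β))
  set c := (σ_e ^ 2 + σ_s ^ 2) / m ^ 2 with hc
  have hbc : b = β * c / 2 := by rw [hβ]; field_simp
  have hs := sub_ne_zero.2 htβ
  rw [integral_exp_truncExp, integral_exp_mul_of_ne_zero hs]
  have e : Real.exp ((t - β) * ℓ₀) = Real.exp (t * ℓ₀) * Real.exp (-β * ℓ₀) := by
    rw [← Real.exp_add]; ring_nf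
  have e' : truncExpConst β ℓ₀ * ((Real.exp ((t - β) * ℓ₀) - 1) / (t - β))
      = (0 - t * (c / 2 * truncExpConst β ℓ₀ - Real.exp (t * ℓ₀) * (c / 2 * truncExpConst β ℓ₀
        * Real.exp (-β * ℓ₀)))) / (t * c / 2 * (t - β)) := by
    rw [e]
    field_simp
    ring
  rw [e']
  refine h.congr fun r => ?_
  rw [hbc]
  field_simp
  ring

lemma measurable_scaled (r : ℝ) : Measurable fun x : QState => r * (x.1 : ℝ) :=
  (measurable_of_countable fun n : ℕ => r * (n : ℝ)).comp measurable_fst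

lemma integral_exp_scaledQueueLaw (r t : ℝ) (P : ProbabilityMeasure QState) :
    ∫ x, Real.exp (t * x) ∂(scaledQueueLaw r P : Measure ℝ) = queueTransform P (t * r) := by
  rw [scaledQueueLaw, ProbabilityMeasure.toMeasure_map, integral_map
    (measurable_scaled r).aemeasurable (by fun_prop), queueTransform]
  simp_rw [mul_assoc]

lemma eventually_ae_scaledQueueLaw (H : IsHeavyTraffic R M π m σ_e σ_s b ℓ₀) :
    ∀ᶠ r in 𝓝[R] (0 : ℝ), ∀ᵐ x ∂(scaledQueueLaw r (π r) : Measure ℝ),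
      x ∈ Set.Icc 0 (ℓ₀ + 1) := by
  filter_upwards [IsTimeFamily.eventually_mem R,
    H.tendsto_level.eventually_le_const (show ℓ₀ < ℓ₀ + 1 by linarith)] with r hr hl
  have hr0 := H.mem_pos hr
  rw [scaledQueueLaw, ProbabilityMeasure.toMeasure_map]
  refine (ae_map_iff (p := fun x => x ∈ Set.Icc 0 (ℓ₀ + 1)) (measurable_scaled r).aemeasurable
    measurableSet_Icc).2 ?_
  filter_upwards [(H.stationary r hr).ae_mem] with x hx
  exact ⟨by positivity,
    (mul_le_mul_of_nonneg_left (Nat.cast_le.2 hx.1) hr0.le).trans hl⟩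

theorem tendsto_scaledQueueLaw (H : IsHeavyTraffic R M π m σ_e σ_s b ℓ₀)
    (hσ : 0 < (σ_e ^ 2 + σ_s ^ 2) / m ^ 2) {β : ℝ}
    (hβ : β = 2 * b / ((σ_e ^ 2 + σ_s ^ 2) / m ^ 2)) :
    Tendsto (fun r => scaledQueueLaw r (π r)) (𝓝[R] 0) (𝓝 (truncExp β H.level_pos)) := by
  -- With this step every nonzero element of the progression exceeds `β`, so both excluded exponents
  -- are avoided; exponent zero is the total mass.
  have hε : 0 < |β| + 1 := by positivity
  refine ProbabilityMeasure.tendsto_of_tendsto_integral_exp hε H.eventually_ae_scaledQueueLaw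
    ((ae_truncExp β H.level_pos).mono fun x hx => ⟨hx.1, by linarith [hx.2]⟩) fun k => ?_
  rcases Nat.eq_zero_or_pos k with rfl | hk
  · simpa using tendsto_const_nhds
  simp_rw [integral_exp_scaledQueueLaw]
  have hk1 : (1 : ℝ) ≤ k := by exact_mod_cast hk
  refine H.tendsto_queueTransform hσ hβ (by positivity) (ne_of_gt ?_)
  calc β ≤ |β| := le_abs_self β
    _ < |β| + 1 := by linarith
    _ ≤ (|β| + 1) * k := le_mul_of_one_le_right hε.le hk1

lemma palmArrivalProb_full (H : IsHeavyTraffic R M π m σ_e σ_s b ℓ₀) {r : ℝ} (hr : r ∈ R) :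
    (M r).palmArrivalProb (π r) {x | x.1 = (M r).threshold} = palmLoss M π r * r := by
  have hr0 := (H.mem_pos hr).ne'
  have h : (M r).palmArrivalProb (π r) {x | x.1 = (M r).threshold}
      = (M r).lossRate (π r) / (M r).arrivalRate (π r) :=
    palmArrivalProb_eq (M r) (H.stationary r hr).ae_mem (M r).measurableSet_fullSet
  rw [h, H.arrivalRate_eq hr, palmLoss, loss]
  field_simp

lemma isLittleO_sub_mul (hR : R ⊆ Set.Ioc 0 1) {f u : ℝ → ℝ} {A : ℝ}
    (hu : Tendsto u (𝓝[R] 0) (𝓝 A)) (hf : ∀ r ∈ R, f r = u r * r) :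
    (fun r => f r - A * r) =o[𝓝[R] 0] fun r => r := by
  have h : ∀ᶠ r in 𝓝[R] (0 : ℝ), r ∈ R := IsTimeFamily.eventually_mem R
  rw [isLittleO_iff_tendsto' (h.mono fun r hr h0 => absurd h0 (hR hr).1.ne')]
  have h1 := hu.sub_const A
  rw [sub_self] at h1
  refine h1.congr' ?_
  filter_upwards [h] with r hr
  have hr0 := (hR hr).1.ne'
  rw [hf r hr]
  field_simp

end FiniteQueue.IsHeavyTraffic

/-! ### Monotonicity of the density and proof of the theorem. -/

lemma strictAntiOn_truncExpDensity {β ℓ : ℝ} (hℓ : 0 < ℓ) (hβ : 0 < β) :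
    StrictAntiOn (truncExpDensity β ℓ) (Set.Icc 0 ℓ) := by
  intro x hx y hy hxy
  rw [truncExpDensity_eq, Set.indicator_of_mem hx, Set.indicator_of_mem hy]
  refine mul_lt_mul_of_pos_left (Real.exp_lt_exp.2 ?_) (truncExpConst_pos β hℓ)
  nlinarith

lemma strictMonoOn_truncExpDensity {β ℓ : ℝ} (hℓ : 0 < ℓ) (hβ : β < 0) :
    StrictMonoOn (truncExpDensity β ℓ) (Set.Icc 0 ℓ) := by
  intro x hx y hy hxy
  rw [truncExpDensity_eq, Set.indicator_of_mem hx, Set.indicator_of_mem hy]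
  refine mul_lt_mul_of_pos_left (Real.exp_lt_exp.2 ?_) (truncExpConst_pos β hℓ)
  nlinarith

/-- As the reciprocals of the means also have a finite limit, the means cannot tend to `0`; this is
where positivity of the limit mean comes from. -/
lemma SqUniformlyIntegrable.mul_eq_one {R : Set ℝ} {P : ℝ → ProbabilityMeasure ℝ}
    (h : SqUniformlyIntegrable R P) (hpos : ∀ r, ∀ᵐ x ∂(P r : Measure ℝ), 0 < x)
    [(𝓝[R] (0 : ℝ)).NeBot] {m lam : ℝ} (hm : Tendsto (fun r => lawMean (P r)) (𝓝[R] 0) (𝓝 m))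
    (hlam : Tendsto (fun r => (lawMean (P r))⁻¹) (𝓝[R] 0) (𝓝 lam)) : m * lam = 1 := by
  refine tendsto_nhds_unique (hm.mul hlam) (tendsto_const_nhds.congr' ?_)
  filter_upwards [IsTimeFamily.eventually_mem R] with r hr
  exact (mul_inv_cancel₀ (lawMean_pos (h.integrable_sq (hpos r) hr) (hpos r)).ne').symm

lemma SqUniformlyIntegrable.limit_mean_pos {R : Set ℝ} {P : ℝ → ProbabilityMeasure ℝ}
    (h : SqUniformlyIntegrable R P) (hpos : ∀ r, ∀ᵐ x ∂(P r : Measure ℝ), 0 < x)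
    [(𝓝[R] (0 : ℝ)).NeBot] {m lam : ℝ} (hm : Tendsto (fun r => lawMean (P r)) (𝓝[R] 0) (𝓝 m))
    (hlam : Tendsto (fun r => (lawMean (P r))⁻¹) (𝓝[R] 0) (𝓝 lam)) : 0 < m := by
  refine lt_of_le_of_ne (ge_of_tendsto hm ?_) ?_
  · filter_upwards [IsTimeFamily.eventually_mem R] with r hr
    exact (lawMean_pos (h.integrable_sq (hpos r) hr) (hpos r)).le
  · rintro rfl
    simpa using h.mul_eq_one hpos hm hlam

theorem mainTheorem2
    -- index set of the sequence of queues, `r ↓ 0` within `R`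
    (R : Set ℝ) (hR : R ⊆ Set.Ioc 0 1) (hR0 : (0 : ℝ) ∈ closure R)
    (M : ℝ → FiniteQueue) (π : ℝ → ProbabilityMeasure QState)
    (hπ : ∀ r ∈ R, (M r).IsStationary (π r))
    (m_e m_s lam mu σ_e σ_s b ℓ₀ : ℝ)
    (hUI_e : SqUniformlyIntegrable R fun r => (M r).interarrival)
    (hUI_s : SqUniformlyIntegrable R fun r => (M r).service)
    (hm_e : Tendsto (fun r => lawMean (M r).interarrival) (𝓝[R] 0) (𝓝 m_e))
    (hlam : Tendsto (fun r => (lawMean (M r).interarrival)⁻¹) (𝓝[R] 0) (𝓝 lam))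
    (hσ_e : Tendsto (fun r => lawStd (M r).interarrival) (𝓝[R] 0) (𝓝 σ_e))
    (hm_s : Tendsto (fun r => lawMean (M r).service) (𝓝[R] 0) (𝓝 m_s))
    (hmu : Tendsto (fun r => (lawMean (M r).service)⁻¹) (𝓝[R] 0) (𝓝 mu))
    (hσ_s : Tendsto (fun r => lawStd (M r).service) (𝓝[R] 0) (𝓝 σ_s))
    (hσ : 0 < σ_e ^ 2 + σ_s ^ 2)
    (hb : (fun r => (lawMean (M r).service)⁻¹ - (lawMean (M r).interarrival)⁻¹ - r * mu * b)
      =o[𝓝[R] 0] fun r => r)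
    (hℓ₀ : 0 < ℓ₀)
    (hℓ : Tendsto (fun r => r * ((M r).threshold : ℝ)) (𝓝[R] 0) (𝓝 ℓ₀)) :
    ∃ (g : ℝ → ℝ) (ν : ProbabilityMeasure ℝ),
      Measurable g ∧ (∀ x, 0 ≤ g x) ∧
      (ν : Measure ℝ) = volume.withDensity (fun x => ENNReal.ofReal (g x)) ∧
      Tendsto (fun r => scaledQueueLaw r (π r)) (𝓝[R] 0) (𝓝 ν) ∧
      (b = 0 →
        g = Set.indicator (Set.Icc 0 ℓ₀) (fun _ => 1 / ℓ₀) ∧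
        (fun r => (π r : Measure QState).real {x | x.1 = 0}
            - (lam ^ 2 * σ_e ^ 2 + mu ^ 2 * σ_s ^ 2) / (2 * ℓ₀) * r) =o[𝓝[R] 0] (fun r => r) ∧
        (fun r => (M r).palmArrivalProb (π r) {x | x.1 = (M r).threshold}
            - (lam ^ 2 * σ_e ^ 2 + mu ^ 2 * σ_s ^ 2) / (2 * ℓ₀) * r) =o[𝓝[R] 0] (fun r => r)) ∧
      (b ≠ 0 → ∀ β : ℝ, β = 2 * b / (lam ^ 2 * σ_e ^ 2 + mu ^ 2 * σ_s ^ 2) →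
        g = Set.indicator (Set.Icc 0 ℓ₀)
          (fun x => β / (1 - Real.exp (-β * ℓ₀)) * Real.exp (-β * x)) ∧
        (fun r => (π r : Measure QState).real {x | x.1 = 0}
            - b * Real.exp (β * ℓ₀) / (Real.exp (β * ℓ₀) - 1) * r) =o[𝓝[R] 0] (fun r => r) ∧
        (fun r => (M r).palmArrivalProb (π r) {x | x.1 = (M r).threshold}
            - b / (Real.exp (β * ℓ₀) - 1) * r) =o[𝓝[R] 0] (fun r => r) ∧
        (0 < b → StrictAntiOn g (Set.Icc 0 ℓ₀)) ∧
        (b < 0 → StrictMonoOn g (Set.Icc 0 ℓ₀))) := by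
  have : (𝓝[R] (0 : ℝ)).NeBot := mem_closure_iff_nhdsWithin_neBot.1 hR0
  have hpe : ∀ r, ∀ᵐ x ∂((M r).interarrival : Measure ℝ), 0 < x := fun r => (M r).interarrival_pos
  have hps : ∀ r, ∀ᵐ x ∂((M r).service : Measure ℝ), 0 < x := fun r => (M r).service_pos
  have hme0 := hUI_e.limit_mean_pos hpe hm_e hlam
  have hms0 := hUI_s.limit_mean_pos hps hm_s hmu
  have hlam' : lam = m_e⁻¹ := eq_inv_of_mul_eq_one_right (hUI_e.mul_eq_one hpe hm_e hlam)
  have hmu' : mu = m_s⁻¹ := eq_inv_of_mul_eq_one_right (hUI_s.mul_eq_one hps hm_s hmu)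
  have hdrift : Tendsto (fun r => ((lawMean (M r).service)⁻¹
      - (lawMean (M r).interarrival)⁻¹) / r) (𝓝[R] 0) (𝓝 (mu * b)) := by
    have h := hb.tendsto_div_nhds_zero.add_const (mu * b)
    rw [zero_add] at h
    refine h.congr' ?_
    filter_upwards [IsTimeFamily.eventually_mem R] with r hr
    have hr0 := (hR hr).1.ne'
    field_simp
    ring
  -- The difference of the rates is `O(r)`, so the limit rates coincide, and with them the limit
  -- means; the variance parameter then takes the form `(σ_e ^ 2 + σ_s ^ 2) / m_s ^ 2`.
  have hmulam : mu = lam := by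
    have h1 := hdrift.mul (IsTimeFamily.tendsto_self R)
    rw [mul_zero] at h1
    refine sub_eq_zero.1 (tendsto_nhds_unique (hmu.sub hlam) (h1.congr' ?_))
    filter_upwards [IsTimeFamily.eventually_mem R] with r hr
    exact div_mul_cancel₀ _ (hR hr).1.ne'
  have hmm : m_s = m_e := by rw [hmu', hlam', inv_inj] at hmulam; exact hmulam
  subst hmm
  have H : FiniteQueue.IsHeavyTraffic R M π m_s σ_e σ_s b ℓ₀ :=
    { arrival := ⟨hR, hpe, hUI_e, hme0, hm_e, hσ_e⟩
      service := ⟨hR, hps, hUI_s, hme0, hm_s, hσ_s⟩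
      stationary := hπ
      drift := hmu' ▸ hdrift
      level_pos := hℓ₀
      tendsto_level := hℓ }
  have hc : lam ^ 2 * σ_e ^ 2 + mu ^ 2 * σ_s ^ 2 = (σ_e ^ 2 + σ_s ^ 2) / m_s ^ 2 := by
    rw [hlam', hmu']; field_simp
  have hc0 : 0 < (σ_e ^ 2 + σ_s ^ 2) / m_s ^ 2 := by positivity
  rw [hc]
  have hidle : ∀ r ∈ R, (π r : Measure QState).real {x | x.1 = 0}
      = FiniteQueue.IsHeavyTraffic.idle π r * r := fun r hr =>
    (div_mul_cancel₀ _ (hR hr).1.ne').symm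
  have hpalm := fun r (hr : r ∈ R) => H.palmArrivalProb_full hr
  -- One witness serves both cases: for `b = 0` the rate is `0`, and the truncated exponential
  -- density is by definition the uniform one.
  refine ⟨truncExpDensity (2 * b / ((σ_e ^ 2 + σ_s ^ 2) / m_s ^ 2)) ℓ₀,
    truncExp (2 * b / ((σ_e ^ 2 + σ_s ^ 2) / m_s ^ 2)) hℓ₀, measurable_truncExpDensity _ _,
    truncExpDensity_nonneg _ hℓ₀, rfl, H.tendsto_scaledQueueLaw hc0 rfl, ?_, ?_⟩
  · rintro rfl
    exact ⟨by simp [truncExpDensity],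
      FiniteQueue.IsHeavyTraffic.isLittleO_sub_mul hR H.tendsto_idle_of_drift_eq_zero hidle,
      FiniteQueue.IsHeavyTraffic.isLittleO_sub_mul hR H.tendsto_palmLoss_of_drift_eq_zero hpalm⟩
  · rintro hb0 β hβ
    rw [← hβ]
    have hβ0 : β ≠ 0 := by rw [hβ]; exact div_ne_zero (mul_ne_zero two_ne_zero hb0) hc0.ne'
    refine ⟨if_neg hβ0,
      FiniteQueue.IsHeavyTraffic.isLittleO_sub_mul hR
        (H.tendsto_idle_of_drift_ne_zero hc0 hb0 hβ) hidle,
      FiniteQueue.IsHeavyTraffic.isLittleO_sub_mul hR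
        (H.tendsto_palmLoss_of_drift_ne_zero hc0 hb0 hβ) hpalm,
      fun h => strictAntiOn_truncExpDensity hℓ₀ ?_, fun h => strictMonoOn_truncExpDensity hℓ₀ ?_⟩
    · rw [hβ]; positivity
    · rw [hβ]; exact div_neg_of_neg_of_pos (by linarith) hc0
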